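/- **Theorem 4.1 (The regular piece).** Let $\Gamma\subset\mathbb R^2$ be a lattice, $\Gamma^\#=\{b\in\mathbb R^2 : b\cdot\gamma\in 2\pi\mathbb Z \text{ for all } \gamma\in\Gamma\}$ its dual lattice, and let $2\Lambda$ be the length of the shortest nonzero vector of $\Gamma^\#$. For $\varphi$ on $\mathbb R^2/\Gamma$ put $\hat\varphi(b)=|\Gamma|^{-1}\int_{\mathbb R^2/\Gamma}\varphi(x)e^{-ib\cdot x}\,dx$, where $|\Gamma|$ is the area of $\mathbb R^2/\Gamma$. Let $A=(A_1,A_2)$, where $A_1,A_2$ and $V$ are complex-valued functions in $L^2(\mathbb R^2/\Gamma)$, normalised so that $\hat A(0)=0$, and put $q=(i\nabla\cdot A)+A^2+V$ with $A^2=A_1^2+A_2^2$. The lifted Fermi curve $\widehat{\mathcal F}(A,V)$ is the set of all $k\in\mathbb C^2$ such that $\big((i\nabla+A-k)^2+V\big)\varphi=0$ for some nonzero $\varphi\in L^2(\mathbb R^2/\Gamma)$ in the domain of this operator (that is, also $(i\nabla+A-k)\varphi\in L^2(\mathbb R^2/\Gamma)$, derivatives being taken in the sense of distributions). For $\nu\in\{1,2\}$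 and $b\in\Gamma^\#$ let $$T_\nu(b)=\{k\in\mathbb C^2 : |(k_1+b_1)+i(-1)^\nu(k_2+b_2)|<\varepsilon\},\qquad T_b=T_1(b)\cup T_2(b),$$ let $\theta_\nu(x)=\tfrac12((-1)^\nu x_2+ix_1)$ for $x\in\mathbb C^2$, let $\mathcal K_\rho=\{k\in\mathbb C^2 : |\operatorname{Im}k|\le\rho\}$, and let $pr(k_1,k_2)=k_2$. Let $0<\varepsilon<\Lambda/6$ and assume that $\sum_{b\in\Gamma^\#}|b|^2|\hat q(b)|<\infty$ and $$\Big(\sum_{j=1}^{2}\Big(\sum_{b\in\Gamma^\#\setminus\{0\}}(1+|b|^2)\,|\hat A_j(b)|\Big)^2\Big)^{1/2}<\frac{2\varepsilon}{63}.$$ Then there are constants $\rho_0>0$ and $C$, depending only on $\Gamma,\varepsilon,q,A$, such that for all $\rho\ge\rho_0$ and $\nu\in\{1,2\}$ the following holds. The projection $pr$ induces a biholomorphic map between $$\mathcal M=\big(\widehat{\mathcal F}(A,V)\cap T_\nu(0)\big)\setminus\Big(\mathcal K_\rho\cup\bigcup_{b\in\Gamma^\#\setminus\{0\}}T_b\Big)$$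 and its image in $\mathbb C$. (As $\mathcal M$ need not be open in $\widehat{\mathcal F}(A,V)$, this means: there are open sets $W\supseteq\mathcal M$ in $\mathbb C^2$ and $U\subseteq\mathbb C$ such that $pr$ maps $\widehat{\mathcal F}(A,V)\cap W$ bijectively onto $U$, with an inverse that is holomorphic on $U$.) The image $pr(\mathcal M)$ contains $$\{z\in\mathbb C : |z|>\rho+\varepsilon \text{ and } |z+(-1)^\nu\theta_\nu(b)|>\varepsilon \text{ for all } b\in\Gamma^\#\setminus\{0\}\}$$ and is contained in $$\Big\{z\in\mathbb C : 8|z|>\rho \text{ and } |z+(-1)^\nu\theta_\nu(b)|>\tfrac12\Big(\varepsilon-\frac{\varepsilon^2}{40\Lambda}\Big)\text{ for all } b\in\Gamma^\#\setminus\{0\}\Big\}.$$ Furthermore, the inverse of $pr$ has the form $$y\longmapsto\big(-\beta_2^{(1,0)}-i(-1)^\nu y-r(y),\;y\big),$$ where, with $\nu'=3-\nu$ and $G_1'=\{b\in\Gamma^\# : 0<|b|<\rho/4\}$, the constant $\beta_2^{(1,0)}$ is $$\beta_2^{(1,0)}=2i\sum_{b,c\in G_1'}\frac{\theta_{\nu'}(\hat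 A(-b))}{\theta_{\nu'}(b)}\left[\delta_{b,c}+\frac{\theta_{\nu'}(\hat A(b-c))}{\theta_{\nu'}(c)}\right]\theta_{\nu'}(\hat A(c)),$$ and where $$|\beta_2^{(1,0)}|<\frac{\varepsilon^2}{100\Lambda},\qquad |r(y)|\le\frac{\varepsilon^3}{50\Lambda^2}+\frac{C}{\rho}\quad\text{for all } y\in pr(\mathcal M).$$ -/

import Mathlib

open MeasureTheory
open scoped ContDiff

noncomputable section

namespace FermiCurve

/-- The Euclidean plane `ℝ²`. -/
abbrev Plane : Type := EuclideanSpace ℝ (Fin 2)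

/-- The lattice `Γ = ℤ γ₁ + ℤ γ₂` generated by a basis `γ` of `ℝ²`
(every lattice in `ℝ²` is of this form). -/
def lattice (γ : Module.Basis (Fin 2) ℝ Plane) : Submodule ℤ Plane :=
  Submodule.span ℤ (Set.range γ)

/-- The fundamental cell `{t₁ γ₁ + t₂ γ₂ | 0 ≤ t₁, t₂ < 1}`. Integrals over `ℝ² / Γ` of
`Γ`-periodic functions are integrals over this cell. -/
def cell (γ : Module.Basis (Fin 2) ℝ Plane) : Set Plane := ZSpan.fundamentalDomain γ

/-- The dual lattice `Γ^# = {b | b · x ∈ 2πℤ for all x ∈ Γ}`. -/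
def dualLattice (γ : Module.Basis (Fin 2) ℝ Plane) : Set Plane :=
  {b | ∀ x ∈ lattice γ, ∃ n : ℤ, inner ℝ b x = 2 * Real.pi * n}

/-- The nonzero vectors of the dual lattice. -/
def dualLatticeNZ (γ : Module.Basis (Fin 2) ℝ Plane) : Set Plane :=
  {b | b ∈ dualLattice γ ∧ b ≠ 0}

/-- `f` is (a representative of) an element of `L²(ℝ²/Γ)`. -/
structure PeriodicL2 (γ : Module.Basis (Fin 2) ℝ Plane) (f : Plane → ℂ) : Prop where
  periodic : ∀ x : Plane, ∀ g ∈ lattice γ, f (x + g) = f x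
  memLp : MemLp f 2 (volume.restrict (cell γ))

/-- A test function on `ℝ²/Γ`: smooth and `Γ`-periodic. -/
structure PeriodicTest (γ : Module.Basis (Fin 2) ℝ Plane) (χ : Plane → ℂ) : Prop where
  periodic : ∀ x : Plane, ∀ g ∈ lattice γ, χ (x + g) = χ x
  smooth : ContDiff ℝ ∞ χ

/-- The Fourier coefficient `f̂(b) = |Γ|⁻¹ ∫_{ℝ²/Γ} f(x) e^{-i b·x} dx`. -/
def hat (γ : Module.Basis (Fin 2) ℝ Plane) (f : Plane → ℂ) (b : Plane) : ℂ :=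
  ((volume (cell γ)).toReal : ℂ)⁻¹ *
    ∫ x in cell γ, f x * Complex.exp (-Complex.I * ((inner ℝ b x : ℝ) : ℂ))

/-- The vector `Â(b) ∈ ℂ²` of Fourier coefficients of `A = (A₁, A₂)`. -/
def hatVec (γ : Module.Basis (Fin 2) ℝ Plane) (A : Fin 2 → Plane → ℂ) (b : Plane) : Fin 2 → ℂ :=
  fun j => hat γ (A j) b

/-- The Fourier coefficients of the distribution `q = (i∇·A) + A² + V`, where `A² = A₁² + A₂²`
and the divergence term `i∇·A` has the Fourier coefficients `-b·Â(b)`. -/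
def qHat (γ : Module.Basis (Fin 2) ℝ Plane) (A : Fin 2 → Plane → ℂ) (V : Plane → ℂ)
    (b : Plane) : ℂ :=
  -(∑ j : Fin 2, (b j : ℂ) * hat γ (A j) b)
    + hat γ (fun x => ∑ j : Fin 2, A j x ^ 2) b + hat γ V b

/-- The formal transpose `-i∂_j + A_j - k_j` of the operator `i∂_j + A_j - k_j`, applied to a
test function. -/
def transposeOp (A : Fin 2 → Plane → ℂ) (k : Fin 2 → ℂ) (j : Fin 2) (χ : Plane → ℂ)
    (x : Plane) : ℂ :=
  -Complex.I * fderiv ℝ χ x (EuclideanSpace.single j (1 : ℝ)) + (A j x - k j) * χ x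

/-- `P = (i∂_j + A_j - k_j) φ` in the sense of distributions on `ℝ²/Γ`. -/
def IsMagneticDeriv (γ : Module.Basis (Fin 2) ℝ Plane) (A : Fin 2 → Plane → ℂ) (k : Fin 2 → ℂ)
    (j : Fin 2) (φ P : Plane → ℂ) : Prop :=
  ∀ χ : Plane → ℂ, PeriodicTest γ χ →
    ∫ x in cell γ, P x * χ x = ∫ x in cell γ, φ x * transposeOp A k j χ x

/-- The complex lifted Fermi curve `F̂(A,V)`: all `k ∈ ℂ²` such that
`H_k(A,V) φ = (i∇ + A - k)² φ + V φ = 0` for some nonzero `φ ∈ L²(ℝ²/Γ)` in the domain of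
`H_k(A,V)`, that is, such that `P := (i∇ + A - k) φ` is in `L²(ℝ²/Γ)` and
`(i∇ + A - k)·P + V φ` (a distribution on `ℝ²/Γ`) is in `L²(ℝ²/Γ)`; here it is zero. -/
def liftedFermiCurve (γ : Module.Basis (Fin 2) ℝ Plane) (A : Fin 2 → Plane → ℂ)
    (V : Plane → ℂ) : Set (Fin 2 → ℂ) :=
  {k | ∃ (φ : Plane → ℂ) (P : Fin 2 → Plane → ℂ),
    PeriodicL2 γ φ ∧ ¬ (φ =ᵐ[volume.restrict (cell γ)] 0) ∧
    (∀ j, PeriodicL2 γ (P j) ∧ IsMagneticDeriv γ A k j φ (P j)) ∧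
    ∀ χ : Plane → ℂ, PeriodicTest γ χ →
      (∑ j : Fin 2, ∫ x in cell γ, P j x * transposeOp A k j χ x)
        + ∫ x in cell γ, V x * φ x * χ x = 0}

/-- The linear form `N_{b,ν}(k) = (k₁ + b₁) + i (-1)^ν (k₂ + b₂)`. -/
def linN (ν : ℕ) (b : Plane) (k : Fin 2 → ℂ) : ℂ :=
  (k 0 + (b 0 : ℂ)) + Complex.I * (-1) ^ ν * (k 1 + (b 1 : ℂ))

/-- The `ε`-tube `T_ν(b)` about the line `N_{b,ν}(k) = 0`. -/
def tube (ε : ℝ) (ν : ℕ) (b : Plane) : Set (Fin 2 → ℂ) := {k | ‖linN ν b k‖ < ε}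

/-- The `ε`-tube `T_b = T_1(b) ∪ T_2(b)`. -/
def tubes (ε : ℝ) (b : Plane) : Set (Fin 2 → ℂ) := tube ε 1 b ∪ tube ε 2 b

/-- `K_ρ = {k = u + i v ∈ ℂ² | |v| ≤ ρ}`, with the Euclidean norm of `v ∈ ℝ²`. -/
def imagBounded (ρ : ℝ) : Set (Fin 2 → ℂ) :=
  {k | Real.sqrt ((k 0).im ^ 2 + (k 1).im ^ 2) ≤ ρ}

/-- The projection `pr (k₁, k₂) = k₂`. -/
def pr (k : Fin 2 → ℂ) : ℂ := k 1

/-- `θ_ν(x) = ½ ((-1)^ν x₂ + i x₁)` for `x ∈ ℂ²`. -/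
def theta (ν : ℕ) (x : Fin 2 → ℂ) : ℂ := (1 / 2) * ((-1) ^ ν * x 1 + Complex.I * x 0)

/-- A real vector, as a vector in `ℂ²`. -/
def toC (b : Plane) : Fin 2 → ℂ := fun j => (b j : ℂ)

/-- The part of the lifted Fermi curve in `T_ν(0)`, with `|Im k| > ρ` and outside of all other
tubes. -/
def regularPiece (γ : Module.Basis (Fin 2) ℝ Plane) (A : Fin 2 → Plane → ℂ) (V : Plane → ℂ)
    (ε ρ : ℝ) (ν : ℕ) : Set (Fin 2 → ℂ) :=
  (liftedFermiCurve γ A V ∩ tube ε ν 0) \ (imagBounded ρ ∪ ⋃ b ∈ dualLatticeNZ γ, tubes ε b)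

/-- The finite set of nonzero `b ∈ Γ^#` with `|b| < ρ/4`. -/
def cutoffSet (γ : Module.Basis (Fin 2) ℝ Plane) (ρ : ℝ) : Set Plane :=
  {b | b ∈ dualLatticeNZ γ ∧ ‖b‖ < ρ / 4}

open Classical in
/-- The constant `β₂^{(1,0)}`; the complementary index `ν'` of `ν ∈ {1,2}` is `3 - ν`. -/
def betaConst (γ : Module.Basis (Fin 2) ℝ Plane) (A : Fin 2 → Plane → ℂ) (ρ : ℝ) (ν : ℕ) : ℂ :=
  2 * Complex.I * ∑ᶠ b ∈ cutoffSet γ ρ, ∑ᶠ c ∈ cutoffSet γ ρ,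
    theta (3 - ν) (hatVec γ A (-b)) / theta (3 - ν) (toC b)
      * ((if b = c then 1 else 0)
          + theta (3 - ν) (hatVec γ A (b - c)) / theta (3 - ν) (toC c))
      * theta (3 - ν) (hatVec γ A c)

/-- The map `p` induces a biholomorphic map between the piece `M` of the curve `X ⊆ ℂ²` and its
image, with inverse `s`. As `M` need not be open in `X` (nor its image open in `ℂ`), this means
that `p` maps an open part of `X` that contains `M` bijectively onto an open subset `U` of the
plane, with `p` and the inverse map `s` holomorphic. -/
def IsBiholomorphicOntoImage (X M : Set (Fin 2 → ℂ)) (p : (Fin 2 → ℂ) → ℂ)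
    (s : ℂ → Fin 2 → ℂ) : Prop :=
  M ⊆ X ∧ ∃ (W : Set (Fin 2 → ℂ)) (U : Set ℂ), IsOpen W ∧ IsOpen U ∧ M ⊆ W ∧
    DifferentiableOn ℂ p W ∧ DifferentiableOn ℂ s U ∧
    Set.MapsTo p (X ∩ W) U ∧ Set.MapsTo s U (X ∩ W) ∧ Set.InvOn s p (X ∩ W) U

end FermiCurve

end

open FermiCurve

/-!
In Fourier space, `(i∇ + A - k)² φ + V φ = 0` is an infinite linear system for the coefficients of `φ`
on the dual lattice. Its diagonal is the free symbol, which in the coordinates `η = k₁ + i (-1)^ν k₂`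
and `n = k₁ - i (-1)^ν k₂` is the product `(η + τ b) (n + τ' b)` of two linear factors, and its
off-diagonal part is built from the Fourier coefficients of `A` and `q`. A point of the Fermi curve
gives a bounded solution of the system; conversely a solution with a summable first moment is the
sequence of coefficients of an element of the domain (`exists_fourier_solution`,
`mem_liftedFermiCurve_of_fourier`). Essential boundedness of `A`, a consequence of the summability of
its coefficients, makes products with `A` square integrable.

For `k` in the tube `T_ν(0)`, outside the other tubes and with `n` large, the free symbol at a nonzero
mode is bounded below by `ε ‖n‖ / 4`, and more precisely the numerators of the couplings cancel one
of its two factors (`TubeData.Region.K_eq`). The quotient of coupling and free symbol on the nonzero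
modes is therefore dominated by a convolution kernel of norm at most `1 / 2` on the `ℓ¹` space with
weight `1 + |b|`. The nonzero modes are eliminated by a Neumann series (`neumannSol`), which is unique
among bounded sequences and holomorphic in the parameters. What remains is one scalar equation
`η + g η n = 0` (`Admissible.mem_liftedFermiCurve_iff`).

Expanding the Neumann series to first order shows that `g` is a constant of second order in `A`, up to
errors of third order and of order `1 / ‖n‖` (`TubeData.Region.norm_g_sub_beta₀_le`), and this constant
is `β₂^{(1,0)}` up to the same kinds of error. In particular `|g| < δ = ε² / (40 Λ)`. With
`n = η - 2 i (-1)^ν k₂`, Cauchy's estimate makes `η ↦ -g` a contraction of the disc of radius `δ`, so for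
every admissible `k₂` there is exactly one solution `η`, holomorphic in `k₂`
(`TubeData.exists_solution_reduced`). Conversely the a priori bound `|η| = |g| < δ` holds on the whole
regular piece. These facts give the biholomorphic parametrisation by `k₂`, the two inclusions for its
range, and, with `r = g - β₂^{(1,0)}`, the bounds for its form.
-/

noncomputable section

namespace FermiCurve

/-! ### The dual lattice in integer coordinates -/

/-- The vector that represents the `j`-th coordinate functional of the basis `γ`. -/
def coordVec (γ : Module.Basis (Fin 2) ℝ Plane) (j : Fin 2) : Plane :=
  (InnerProductSpace.toDual ℝ Plane).symm (LinearMap.toContinuousLinearMap (γ.coord j))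

lemma inner_coordVec (γ : Module.Basis (Fin 2) ℝ Plane) (j : Fin 2) (x : Plane) :
    inner ℝ (coordVec γ j) x = γ.repr x j := by
  simp [coordVec]

/-- The vector of the dual lattice with integer coordinates `n`. All sums over the dual lattice are
indexed by these coordinates. -/
def dualVec (γ : Module.Basis (Fin 2) ℝ Plane) : (Fin 2 → ℤ) →+ Plane where
  toFun n := ∑ j, (2 * Real.pi * (n j : ℝ)) • coordVec γ j
  map_zero' := by simp
  map_add' m n := by
    simp only [Pi.add_apply, Int.cast_add, mul_add, add_smul, Finset.sum_add_distrib]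

lemma inner_dualVec (γ : Module.Basis (Fin 2) ℝ Plane) (n : Fin 2 → ℤ) (x : Plane) :
    inner ℝ (dualVec γ n) x = 2 * Real.pi * ∑ j, (n j : ℝ) * γ.repr x j := by
  simp only [dualVec, AddMonoidHom.coe_mk, ZeroHom.coe_mk, sum_inner, real_inner_smul_left,
    inner_coordVec, Finset.mul_sum, mul_assoc]

lemma repr_int_of_mem_lattice {γ : Module.Basis (Fin 2) ℝ Plane} {x : Plane}
    (hx : x ∈ lattice γ) (j : Fin 2) : ∃ m : ℤ, γ.repr x j = m := by
  have := (γ.mem_span_iff_repr_mem ℤ x).1 hx j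
  obtain ⟨m, hm⟩ := this
  exact ⟨m, by simpa using hm.symm⟩

lemma dualVec_mem (γ : Module.Basis (Fin 2) ℝ Plane) (n : Fin 2 → ℤ) :
    dualVec γ n ∈ dualLattice γ := by
  intro x hx
  choose m hm using fun j => repr_int_of_mem_lattice hx j
  refine ⟨∑ j, n j * m j, ?_⟩
  rw [inner_dualVec]
  simp [hm]

lemma dualVec_injective (γ : Module.Basis (Fin 2) ℝ Plane) :
    Function.Injective (dualVec γ) := by
  intro m n h
  ext j
  have h1 := inner_dualVec γ m (γ j)
  rw [h, inner_dualVec] at h1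
  simp [Finsupp.single_apply] at h1
  exact h1.symm

lemma exists_dualVec {γ : Module.Basis (Fin 2) ℝ Plane} {b : Plane} (hb : b ∈ dualLattice γ) :
    ∃ n, dualVec γ n = b := by
  choose n hn using fun j => hb (γ j) (Submodule.subset_span ⟨j, rfl⟩)
  refine ⟨n, InnerProductSpace.ext_inner_right_basis (𝕜 := ℝ) γ fun j => ?_⟩
  rw [hn, inner_dualVec]
  simp [Finsupp.single_apply]

/-- Integer coordinates on the dual lattice. -/
def dualEquiv (γ : Module.Basis (Fin 2) ℝ Plane) : (Fin 2 → ℤ) ≃ dualLattice γ :=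
  Equiv.ofBijective (fun n => ⟨dualVec γ n, dualVec_mem γ n⟩)
    ⟨fun _ _ h => dualVec_injective γ (congrArg Subtype.val h),
      fun b => (exists_dualVec b.2).imp fun _ h => Subtype.ext h⟩

lemma dualVec_finite (γ : Module.Basis (Fin 2) ℝ Plane) (R : ℝ) :
    {n : Fin 2 → ℤ | ‖dualVec γ n‖ < R}.Finite := by
  have key : ∀ n : Fin 2 → ℤ, ‖dualVec γ n‖ < R → ∀ j,
      n j ∈ Set.Icc (-⌈R * ‖γ j‖⌉) ⌈R * ‖γ j‖⌉ := by
    intro n hn j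
    have h1 := abs_real_inner_le_norm (dualVec γ n) (γ j)
    have h2 : inner ℝ (dualVec γ n) (γ j) = 2 * Real.pi * n j := by
      rw [inner_dualVec]; simp [Finsupp.single_apply]
    rw [h2, abs_mul, abs_of_pos Real.two_pi_pos] at h1
    have h3 : |(n j : ℝ)| ≤ R * ‖γ j‖ := by
      have : |(n j : ℝ)| ≤ 2 * Real.pi * |(n j : ℝ)| :=
        le_mul_of_one_le_left (abs_nonneg _) (by linarith [Real.pi_gt_three])
      refine this.trans (h1.trans ?_)
      gcongr
    have h4 := (abs_le.1 (h3.trans (Int.le_ceil _)))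
    exact ⟨by exact_mod_cast h4.1, by exact_mod_cast h4.2⟩
  refine (Set.finite_Icc (fun j => -⌈R * ‖γ j‖⌉) (fun j => ⌈R * ‖γ j‖⌉)).subset ?_
  intro n hn
  exact ⟨fun j => (key n hn j).1, fun j => (key n hn j).2⟩

/-! ### Fourier series on the period cell -/

section

-- The volume of `UnitAddCircle` is its normalised Haar measure, as in the Fourier theory of
-- `UnitAddTorus`.
attribute [local instance] instMeasureSpaceUnitAddCircle

local instance isAddHaarMeasure_unitAddCircle :
    Measure.IsAddHaarMeasure (volume : Measure UnitAddCircle) :=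
  inferInstanceAs (Measure.IsAddHaarMeasure AddCircle.haarAddCircle)

/-- The normalised Lebesgue measure on the fundamental cell; `hat` is integration against it. -/
def cellMeasure (γ : Module.Basis (Fin 2) ℝ Plane) : Measure Plane :=
  (volume (cell γ))⁻¹ • volume.restrict (cell γ)

lemma volume_cell_ne_zero (γ : Module.Basis (Fin 2) ℝ Plane) : volume (cell γ) ≠ 0 :=
  ZSpan.measure_fundamentalDomain_ne_zero γ

lemma volume_cell_ne_top (γ : Module.Basis (Fin 2) ℝ Plane) : volume (cell γ) ≠ ⊤ :=
  (ZSpan.fundamentalDomain_isBounded γ).measure_lt_top.ne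

instance (γ : Module.Basis (Fin 2) ℝ Plane) : IsProbabilityMeasure (cellMeasure γ) :=
  ⟨by simp [cellMeasure, ENNReal.inv_mul_cancel (volume_cell_ne_zero γ) (volume_cell_ne_top γ)]⟩

lemma integral_cellMeasure (γ : Module.Basis (Fin 2) ℝ Plane) (f : Plane → ℂ) :
    ∫ x, f x ∂cellMeasure γ = ((volume (cell γ)).toReal : ℂ)⁻¹ * ∫ x in cell γ, f x := by
  rw [cellMeasure, integral_smul_measure, ENNReal.toReal_inv, Complex.real_smul]
  push_cast; rfl

lemma ae_cellMeasure (γ : Module.Basis (Fin 2) ℝ Plane) :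
    ae (cellMeasure γ) = ae (volume.restrict (cell γ)) := by
  rw [cellMeasure]
  exact Measure.ae_ennreal_smul_measure_eq (ENNReal.inv_ne_zero.2 (volume_cell_ne_top γ)) _

lemma memLp_cellMeasure {γ : Module.Basis (Fin 2) ℝ Plane} {f : Plane → ℂ} :
    MemLp f 2 (cellMeasure γ) ↔ MemLp f 2 (volume.restrict (cell γ)) := by
  constructor
  · intro h
    have := h.smul_measure (c := volume (cell γ)) (volume_cell_ne_top γ)
    rwa [cellMeasure, smul_smul,
      ENNReal.mul_inv_cancel (volume_cell_ne_zero γ) (volume_cell_ne_top γ), one_smul] at this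
  · intro h
    exact h.smul_measure (ENNReal.inv_ne_top.2 (volume_cell_ne_zero γ))

/-- The coordinates with respect to `γ` modulo `1`. This map carries the Fourier theory of
`UnitAddTorus` over to periodic functions on the plane. -/
def toTorus (γ : Module.Basis (Fin 2) ℝ Plane) (x : Plane) : UnitAddTorus (Fin 2) :=
  fun j => (γ.repr x j : UnitAddCircle)

lemma measurable_toTorus (γ : Module.Basis (Fin 2) ℝ Plane) : Measurable (toTorus γ) := by
  refine measurable_pi_lambda _ fun j => AddCircle.measurable_mk'.comp ?_
  exact (LinearMap.continuous_of_finiteDimensional (γ.coord j)).measurable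

lemma measurePreserving_toTorus (γ : Module.Basis (Fin 2) ℝ Plane) :
    MeasurePreserving (toTorus γ) (cellMeasure γ) volume := by
  set e : Plane ≃L[ℝ] (Fin 2 → ℝ) := γ.equivFun.toContinuousLinearEquiv with he
  set box : Set (Fin 2 → ℝ) := Set.univ.pi fun _ => Set.Ico (0 : ℝ) 1 with hbox
  have hpre : e ⁻¹' box = cell γ := by
    ext x
    simp [he, hbox, cell, ZSpan.mem_fundamentalDomain, Set.mem_pi]
  have hhaar : (Measure.map e (volume : Measure Plane)).IsAddHaarMeasure :=
    e.isAddHaarMeasure_map _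
  have hsm := Measure.isAddLeftInvariant_eq_smul (Measure.map e (volume : Measure Plane))
    (volume : Measure (Fin 2 → ℝ))
  set c := (Measure.map e (volume : Measure Plane)).addHaarScalarFactor volume
  have hbm : MeasurableSet box := MeasurableSet.univ_pi fun _ => measurableSet_Ico
  have hvol : volume (cell γ) = c := by
    rw [← hpre, ← Measure.map_apply e.continuous.measurable hbm, hsm]
    simp [hbox, volume_pi_pi]
  have h1 : Measure.map e (cellMeasure γ) = volume.restrict box := by
    rw [cellMeasure, Measure.map_smul, ← hpre, ← Measure.restrict_map e.continuous.measurable hbm,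
      hsm, hpre, hvol, Measure.restrict_smul, ← hvol]
    have : c • volume.restrict box = (c : ENNReal) • volume.restrict box := rfl
    rw [this, ← hvol, smul_smul, ENNReal.inv_mul_cancel (volume_cell_ne_zero γ)
      (volume_cell_ne_top γ), one_smul]
  have h2 : (volume : Measure (Fin 2 → ℝ)).restrict box
      = Measure.pi fun _ => volume.restrict (Set.Ioc (0 : ℝ) (0 + 1)) := by
    rw [hbox, volume_pi, Measure.restrict_pi_pi]
    simp only [restrict_Ico_eq_restrict_Ioc, zero_add]
  have h3 : MeasurePreserving (fun (a : Fin 2 → ℝ) i => (a i : UnitAddCircle))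
      (Measure.pi fun _ => volume.restrict (Set.Ioc (0 : ℝ) (0 + 1))) volume := by
    refine measurePreserving_pi _ _ fun i => ?_
    have := AddCircle.measurePreserving_mk 1 0
    convert! this using 1
    simp [volume, AddCircle.haarAddCircle]
  have h4 : MeasurePreserving e (cellMeasure γ)
      (Measure.pi fun _ => volume.restrict (Set.Ioc (0 : ℝ) (0 + 1))) :=
    ⟨e.continuous.measurable, h1.trans h2⟩
  exact h3.comp h4

/-- The section of `toTorus` with values in the fundamental cell. -/
def fromTorus (γ : Module.Basis (Fin 2) ℝ Plane) (t : UnitAddTorus (Fin 2)) : Plane :=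
  ∑ j, (AddCircle.equivIco (1 : ℝ) 0 (t j) : ℝ) • γ j

lemma measurable_fromTorus (γ : Module.Basis (Fin 2) ℝ Plane) : Measurable (fromTorus γ) := by
  refine Finset.measurable_sum _ fun j _ => ?_
  refine Measurable.smul_const ?_ _
  exact measurable_subtype_coe.comp
    ((AddCircle.measurableEquivIco (1 : ℝ) 0).measurable.comp (measurable_pi_apply j))

lemma fromTorus_toTorus {γ : Module.Basis (Fin 2) ℝ Plane} {x : Plane} (hx : x ∈ cell γ) :
    fromTorus γ (toTorus γ x) = x := by
  have h : ∀ j, ((AddCircle.equivIco (1 : ℝ) 0 (toTorus γ x j) : ℝ)) = γ.repr x j := by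
    intro j
    have := AddCircle.coe_equivIco_mk_apply (1 : ℝ) (γ.repr x j)
    rw [toTorus, this, div_one, mul_one]
    exact Int.fract_eq_self.2 ((ZSpan.mem_fundamentalDomain γ).1 hx j)
  simp only [fromTorus, h]
  exact γ.sum_repr x

lemma toTorus_fromTorus (γ : Module.Basis (Fin 2) ℝ Plane) (t : UnitAddTorus (Fin 2)) :
    toTorus γ (fromTorus γ t) = t := by
  ext j
  have h : γ.repr (fromTorus γ t) j = (AddCircle.equivIco (1 : ℝ) 0 (t j) : ℝ) := by
    fin_cases j <;> simp [fromTorus]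
  rw [toTorus, h]
  exact (AddCircle.equivIco (1 : ℝ) 0).symm_apply_apply (t j)

lemma ae_mem_cell (γ : Module.Basis (Fin 2) ℝ Plane) : ∀ᵐ x ∂cellMeasure γ, x ∈ cell γ := by
  rw [ae_cellMeasure]
  exact ae_restrict_mem (ZSpan.fundamentalDomain_measurableSet γ)

lemma measurePreserving_fromTorus (γ : Module.Basis (Fin 2) ℝ Plane) :
    MeasurePreserving (fromTorus γ) volume (cellMeasure γ) := by
  refine ⟨measurable_fromTorus γ, ?_⟩
  rw [← (measurePreserving_toTorus γ).map_eq,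
    Measure.map_map (measurable_fromTorus γ) (measurable_toTorus γ)]
  conv_rhs => rw [← Measure.map_id (μ := cellMeasure γ)]
  refine Measure.map_congr ?_
  filter_upwards [ae_mem_cell γ] with x hx using fromTorus_toTorus hx

lemma integral_fromTorus {γ : Module.Basis (Fin 2) ℝ Plane} {f : Plane → ℂ}
    (hf : AEStronglyMeasurable f (cellMeasure γ)) :
    ∫ t, f (fromTorus γ t) = ∫ x, f x ∂cellMeasure γ := by
  rw [← (measurePreserving_fromTorus γ).map_eq] at hf ⊢
  exact (integral_map (measurable_fromTorus γ).aemeasurable hf).symm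

/-- The exponential `x ↦ exp (i b · x)` for the dual lattice vector `b` with coordinates `n`. -/
def expo (γ : Module.Basis (Fin 2) ℝ Plane) (n : Fin 2 → ℤ) (x : Plane) : ℂ :=
  Complex.exp (Complex.I * ((inner ℝ (dualVec γ n) x : ℝ) : ℂ))

lemma mFourier_toTorus (γ : Module.Basis (Fin 2) ℝ Plane) (n : Fin 2 → ℤ) (x : Plane) :
    UnitAddTorus.mFourier n (toTorus γ x) = expo γ n x := by
  rw [expo, inner_dualVec]
  simp only [UnitAddTorus.mFourier, ContinuousMap.coe_mk, toTorus, fourier_coe_apply]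
  rw [← Complex.exp_sum]
  congr 1
  push_cast
  simp only [Fin.sum_univ_two]
  ring

lemma mFourier_eq_expo (γ : Module.Basis (Fin 2) ℝ Plane) (n : Fin 2 → ℤ)
    (t : UnitAddTorus (Fin 2)) :
    UnitAddTorus.mFourier n t = expo γ n (fromTorus γ t) := by
  rw [← mFourier_toTorus, toTorus_fromTorus]

lemma expo_neg (γ : Module.Basis (Fin 2) ℝ Plane) (n : Fin 2 → ℤ) (x : Plane) :
    expo γ (-n) x = Complex.exp (-Complex.I * ((inner ℝ (dualVec γ n) x : ℝ) : ℂ)) := by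
  simp [expo]

lemma norm_expo (γ : Module.Basis (Fin 2) ℝ Plane) (n : Fin 2 → ℤ) (x : Plane) :
    ‖expo γ n x‖ = 1 := by
  rw [expo, mul_comm]; exact Complex.norm_exp_ofReal_mul_I _

lemma expo_add (γ : Module.Basis (Fin 2) ℝ Plane) (m n : Fin 2 → ℤ) (x : Plane) :
    expo γ (m + n) x = expo γ m x * expo γ n x := by
  rw [expo, expo, expo, ← Complex.exp_add, map_add, inner_add_left]
  push_cast; ring_nf

lemma contDiff_expo (γ : Module.Basis (Fin 2) ℝ Plane) (n : Fin 2 → ℤ) :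
    ContDiff ℝ ∞ (expo γ n) := by
  unfold expo
  have h : ContDiff ℝ ∞ fun x : Plane => ((inner ℝ (dualVec γ n) x : ℝ) : ℂ) :=
    Complex.ofRealCLM.contDiff.comp (contDiff_const.inner ℝ contDiff_id)
  exact (contDiff_const.mul h).cexp

lemma continuous_expo (γ : Module.Basis (Fin 2) ℝ Plane) (n : Fin 2 → ℤ) :
    Continuous (expo γ n) := (contDiff_expo γ n).continuous

lemma expo_periodic (γ : Module.Basis (Fin 2) ℝ Plane) (n : Fin 2 → ℤ) (x : Plane) (g : Plane)
    (hg : g ∈ lattice γ) : expo γ n (x + g) = expo γ n x := by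
  obtain ⟨m, hm⟩ := dualVec_mem γ n g hg
  rw [expo, expo, inner_add_right, hm]
  push_cast
  rw [mul_add, Complex.exp_add]
  have : Complex.exp (Complex.I * (2 * Real.pi * m)) = 1 :=
    Complex.exp_eq_one_iff.2 ⟨m, by ring⟩
  rw [this, mul_one]

lemma periodicTest_expo (γ : Module.Basis (Fin 2) ℝ Plane) (n : Fin 2 → ℤ) :
    PeriodicTest γ (expo γ n) := ⟨expo_periodic γ n, contDiff_expo γ n⟩

lemma hat_eq_integral (γ : Module.Basis (Fin 2) ℝ Plane) (f : Plane → ℂ) (n : Fin 2 → ℤ) :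
    hat γ f (dualVec γ n) = ∫ x, f x * expo γ (-n) x ∂cellMeasure γ := by
  rw [integral_cellMeasure, hat]
  simp only [expo_neg]

lemma hat_eq_mFourierCoeff {γ : Module.Basis (Fin 2) ℝ Plane} {f : Plane → ℂ}
    (hf : AEStronglyMeasurable f (cellMeasure γ)) (n : Fin 2 → ℤ) :
    hat γ f (dualVec γ n) = UnitAddTorus.mFourierCoeff (fun t => f (fromTorus γ t)) n := by
  rw [hat_eq_integral, UnitAddTorus.mFourierCoeff, ← integral_fromTorus]
  · congr 1; ext t
    rw [mFourier_eq_expo γ, smul_eq_mul, mul_comm]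
  · exact hf.mul (continuous_expo γ _).aestronglyMeasurable

lemma hat_congr {γ : Module.Basis (Fin 2) ℝ Plane} {f g : Plane → ℂ}
    (h : f =ᵐ[cellMeasure γ] g) (n : Fin 2 → ℤ) :
    hat γ f (dualVec γ n) = hat γ g (dualVec γ n) := by
  rw [hat_eq_integral, hat_eq_integral]
  exact integral_congr_ae (h.mono fun x hx => by simp only [hx])

/-- The Fourier coefficients of a product of two `L²` functions are the convolution of the
Fourier coefficients of the factors. -/
lemma hasSum_hat_mul {γ : Module.Basis (Fin 2) ℝ Plane} {f g : Plane → ℂ}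
    (hf : MemLp f 2 (cellMeasure γ)) (hg : MemLp g 2 (cellMeasure γ)) (n : Fin 2 → ℤ) :
    HasSum (fun m => hat γ f (dualVec γ (n - m)) * hat γ g (dualVec γ m))
      (hat γ (fun x => f x * g x) (dualVec γ n)) := by
  have hF0 : MemLp (fun x => (starRingEnd ℂ) (f x) * expo γ n x) 2 (cellMeasure γ) := by
    have h1 : MemLp (fun x => (starRingEnd ℂ) (f x)) 2 (cellMeasure γ) := hf.star
    exact h1.mono (h1.1.mul (continuous_expo γ n).aestronglyMeasurable)
      (Filter.Eventually.of_forall fun x => by simp [norm_expo])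
  have hF := hF0.comp_measurePreserving (measurePreserving_fromTorus γ)
  have hG := hg.comp_measurePreserving (measurePreserving_fromTorus γ)
  have key := UnitAddTorus.hasSum_prod_mFourierCoeff hF.toLp hG.toLp
  -- Parseval's identity for `conj f · e_n` and `g`: conjugation turns the coefficient of the first
  -- factor at `m` into the coefficient of `f` at `n - m`.
  have e1 : ∀ m, (starRingEnd ℂ) (UnitAddTorus.mFourierCoeff hF.toLp m)
      = hat γ f (dualVec γ (n - m)) := by
    intro m
    rw [hat_eq_mFourierCoeff hf.1, UnitAddTorus.mFourierCoeff, UnitAddTorus.mFourierCoeff,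
      ← integral_conj]
    refine integral_congr_ae ?_
    filter_upwards [hF.coeFn_toLp] with t ht
    simp only [ht, Function.comp, smul_eq_mul, map_mul, Complex.conj_conj,
      ← mFourier_eq_expo γ]
    rw [← UnitAddTorus.mFourier_neg, ← UnitAddTorus.mFourier_neg, neg_neg, neg_sub, sub_eq_add_neg,
      UnitAddTorus.mFourier_add]
    ring
  have e2 : ∀ m, UnitAddTorus.mFourierCoeff hG.toLp m = hat γ g (dualVec γ m) := by
    intro m
    rw [hat_eq_mFourierCoeff hg.1, UnitAddTorus.mFourierCoeff, UnitAddTorus.mFourierCoeff]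
    refine integral_congr_ae ?_
    filter_upwards [hG.coeFn_toLp] with t ht
    simp only [ht, Function.comp]
  have e3 : ∫ t, (starRingEnd ℂ) (hF.toLp _ t) * hG.toLp _ t
      = hat γ (fun x => f x * g x) (dualVec γ n) := by
    rw [hat_eq_mFourierCoeff (f := fun x => f x * g x) (hf.1.mul hg.1), UnitAddTorus.mFourierCoeff]
    refine integral_congr_ae ?_
    filter_upwards [hG.coeFn_toLp, hF.coeFn_toLp] with t ht ht'
    simp only [ht, ht', Function.comp, smul_eq_mul, map_mul, Complex.conj_conj,
      ← mFourier_eq_expo γ]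
    rw [← UnitAddTorus.mFourier_neg]
    ring
  rw [e3] at key
  simpa only [e1, e2] using key

/-- An `L²` function is determined by its Fourier coefficients. -/
lemma ae_eq_of_hat_eq {γ : Module.Basis (Fin 2) ℝ Plane} {f g : Plane → ℂ}
    (hf : MemLp f 2 (cellMeasure γ)) (hg : MemLp g 2 (cellMeasure γ))
    (h : ∀ n, hat γ f (dualVec γ n) = hat γ g (dualVec γ n)) : f =ᵐ[cellMeasure γ] g := by
  have hF := hf.comp_measurePreserving (measurePreserving_fromTorus γ)
  have hG := hg.comp_measurePreserving (measurePreserving_fromTorus γ)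
  have e : ∀ {f : Plane → ℂ} (hf : MemLp f 2 (cellMeasure γ)) (m : Fin 2 → ℤ),
      UnitAddTorus.mFourierCoeff
        (hf.comp_measurePreserving (measurePreserving_fromTorus γ)).toLp m
        = hat γ f (dualVec γ m) := by
    intro g hg m
    rw [hat_eq_mFourierCoeff hg.1, UnitAddTorus.mFourierCoeff, UnitAddTorus.mFourierCoeff]
    refine integral_congr_ae ?_
    filter_upwards [(hg.comp_measurePreserving (measurePreserving_fromTorus γ)).coeFn_toLp]
      with t ht
    simp only [ht, Function.comp]
  have heq : hF.toLp = hG.toLp := by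
    have h1 := UnitAddTorus.hasSum_mFourier_series_L2 hF.toLp
    have h2 := UnitAddTorus.hasSum_mFourier_series_L2 hG.toLp
    refine h1.unique ?_
    convert! h2 using 1
    ext1 m
    rw [e hf, e hg, h]
  have h5 : (f ∘ fromTorus γ) =ᵐ[volume] (g ∘ fromTorus γ) :=
    (MemLp.toLp_eq_toLp_iff hF hG).1 heq
  have h6 := (measurePreserving_toTorus γ).quasiMeasurePreserving.ae h5
  filter_upwards [h6, ae_mem_cell γ] with x hx hc
  simpa [fromTorus_toTorus hc] using hx

/-- The sum of an absolutely convergent Fourier series. -/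
def trigSeries (γ : Module.Basis (Fin 2) ℝ Plane) (c : (Fin 2 → ℤ) → ℂ) (x : Plane) : ℂ :=
  ∑' n, c n * expo γ n x

lemma norm_trigSeries_le {γ : Module.Basis (Fin 2) ℝ Plane} {c : (Fin 2 → ℤ) → ℂ}
    (hc : Summable fun n => ‖c n‖) (x : Plane) : ‖trigSeries γ c x‖ ≤ ∑' n, ‖c n‖ :=
  tsum_of_norm_bounded hc.hasSum fun n => by simp [norm_expo]

lemma continuous_trigSeries {γ : Module.Basis (Fin 2) ℝ Plane} {c : (Fin 2 → ℤ) → ℂ}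
    (hc : Summable fun n => ‖c n‖) : Continuous (trigSeries γ c) :=
  continuous_tsum (fun n => continuous_const.mul (continuous_expo γ n)) hc
    fun n x => by simp [norm_expo]

lemma memLp_trigSeries {γ : Module.Basis (Fin 2) ℝ Plane} {c : (Fin 2 → ℤ) → ℂ}
    (hc : Summable fun n => ‖c n‖) : MemLp (trigSeries γ c) 2 (cellMeasure γ) :=
  MemLp.of_bound (continuous_trigSeries hc).aestronglyMeasurable _
    (Filter.Eventually.of_forall (norm_trigSeries_le hc))

lemma trigSeries_periodic (γ : Module.Basis (Fin 2) ℝ Plane) (c : (Fin 2 → ℤ) → ℂ) (x g : Plane)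
    (hg : g ∈ lattice γ) : trigSeries γ c (x + g) = trigSeries γ c x := by
  simp only [trigSeries, expo_periodic γ _ x g hg]

lemma periodicL2_trigSeries {γ : Module.Basis (Fin 2) ℝ Plane} {c : (Fin 2 → ℤ) → ℂ}
    (hc : Summable fun n => ‖c n‖) : PeriodicL2 γ (trigSeries γ c) :=
  ⟨trigSeries_periodic γ c, memLp_cellMeasure.1 (memLp_trigSeries hc)⟩

lemma integral_expo (γ : Module.Basis (Fin 2) ℝ Plane) (n : Fin 2 → ℤ) :
    ∫ x, expo γ n x ∂cellMeasure γ = if n = 0 then 1 else 0 := by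
  rw [← integral_fromTorus (continuous_expo γ n).aestronglyMeasurable]
  simp only [← mFourier_eq_expo]
  have h := (orthonormal_iff_ite.1 (UnitAddTorus.orthonormal_mFourier (d := Fin 2))) 0 n
  simp only [ContinuousMap.inner_toLp, ← UnitAddTorus.mFourier_neg,
    ← UnitAddTorus.mFourier_add] at h
  simpa [eq_comm] using h

lemma hat_trigSeries {γ : Module.Basis (Fin 2) ℝ Plane} {c : (Fin 2 → ℤ) → ℂ}
    (hc : Summable fun n => ‖c n‖) (n : Fin 2 → ℤ) :
    hat γ (trigSeries γ c) (dualVec γ n) = c n := by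
  rw [hat_eq_integral]
  have h1 : ∀ x, trigSeries γ c x * expo γ (-n) x = ∑' m, c m * expo γ (m - n) x := by
    intro x
    rw [trigSeries, ← tsum_mul_right]
    simp only [mul_assoc, ← expo_add, ← sub_eq_add_neg]
  simp only [h1]
  rw [← integral_tsum_of_summable_integral_norm]
  · simp only [integral_const_mul, integral_expo, sub_eq_zero]
    rw [tsum_eq_single n (fun m hm => by simp [hm])]
    simp
  · intro m
    refine Integrable.const_mul ?_ _
    exact Integrable.of_bound (continuous_expo γ _).aestronglyMeasurable 1
      (Filter.Eventually.of_forall fun x => (norm_expo γ _ x).le)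
  · simpa [norm_expo] using hc

lemma sub_mem_lattice_of_toTorus_eq {γ : Module.Basis (Fin 2) ℝ Plane} {x y : Plane}
    (h : toTorus γ x = toTorus γ y) : x - y ∈ lattice γ := by
  rw [lattice, γ.mem_span_iff_repr_mem ℤ]
  intro j
  have hj : ((γ.repr x j : ℝ) : UnitAddCircle) = (γ.repr y j : ℝ) := congrFun h j
  obtain ⟨m, hm⟩ := AddSubgroup.mem_zmultiples_iff.1 (QuotientAddGroup.eq_iff_sub_mem.1 hj)
  refine ⟨m, ?_⟩
  simpa using hm

lemma toTorus_add (γ : Module.Basis (Fin 2) ℝ Plane) (x y : Plane) :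
    toTorus γ (x + y) = toTorus γ x + toTorus γ y := by
  ext j; simp [toTorus]

lemma integral_translate {γ : Module.Basis (Fin 2) ℝ Plane} {f : Plane → ℂ} (hf : Continuous f)
    (hp : ∀ x : Plane, ∀ g ∈ lattice γ, f (x + g) = f x) (y : Plane) :
    ∫ x, f (x + y) ∂cellMeasure γ = ∫ x, f x ∂cellMeasure γ := by
  have hy : Continuous fun x => f (x + y) := hf.comp (continuous_id.add continuous_const)
  rw [← integral_fromTorus hy.aestronglyMeasurable,
    ← integral_fromTorus hf.aestronglyMeasurable]
  -- On the torus the translation by `y` is a group translation, up to lattice vectors that `f` does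
  -- not see.
  have h : ∀ t, f (fromTorus γ t + y) = (fun t => f (fromTorus γ t)) (t + toTorus γ y) := by
    intro t
    have h1 : fromTorus γ t + y - fromTorus γ (t + toTorus γ y) ∈ lattice γ := by
      apply sub_mem_lattice_of_toTorus_eq
      rw [toTorus_add, toTorus_fromTorus, toTorus_fromTorus]
    have h2 := hp (fromTorus γ (t + toTorus γ y)) _ h1
    rwa [add_sub_cancel] at h2
  simp only [h]
  exact integral_add_right_eq_self (μ := (volume : Measure (UnitAddTorus (Fin 2))))
    (fun t => f (fromTorus γ t)) (toTorus γ y)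

lemma exists_bound_of_periodic {γ : Module.Basis (Fin 2) ℝ Plane} {E : Type*}
    [NormedAddCommGroup E] {f : Plane → E} (hf : Continuous f)
    (hp : ∀ x : Plane, ∀ g ∈ lattice γ, f (x + g) = f x) : ∃ C, ∀ x, ‖f x‖ ≤ C := by
  have hc : IsCompact (closure (cell γ)) :=
    (ZSpan.fundamentalDomain_isBounded γ).isCompact_closure
  obtain ⟨C, hC⟩ := hc.exists_bound_of_continuousOn hf.continuousOn
  refine ⟨C, fun x => ?_⟩
  have h := hC _ (subset_closure (ZSpan.fract_mem_fundamentalDomain γ x))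
  rwa [ZSpan.fract_apply, sub_eq_add_neg, hp _ _ (neg_mem (ZSpan.floor γ x).2)] at h

lemma fderiv_periodic {γ : Module.Basis (Fin 2) ℝ Plane} {χ : Plane → ℂ}
    (h : PeriodicTest γ χ) (x g : Plane) (hg : g ∈ lattice γ) :
    fderiv ℝ χ (x + g) = fderiv ℝ χ x := by
  rw [← fderiv_comp_add_right]
  congr 1; ext y; exact h.periodic y g hg

lemma PeriodicTest.continuous_fderiv {γ : Module.Basis (Fin 2) ℝ Plane} {χ : Plane → ℂ}
    (h : PeriodicTest γ χ) (v : Plane) : Continuous fun x => fderiv ℝ χ x v :=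
  (h.smooth.continuous_fderiv (by simp)).clm_apply continuous_const

lemma memLp_of_continuous_periodic {γ : Module.Basis (Fin 2) ℝ Plane} {f : Plane → ℂ}
    (hf : Continuous f) (hp : ∀ x : Plane, ∀ g ∈ lattice γ, f (x + g) = f x) :
    MemLp f 2 (cellMeasure γ) := by
  obtain ⟨C, hC⟩ := exists_bound_of_periodic hf hp
  exact MemLp.of_bound hf.aestronglyMeasurable C (Filter.Eventually.of_forall hC)

lemma PeriodicTest.memLp {γ : Module.Basis (Fin 2) ℝ Plane} {χ : Plane → ℂ}
    (h : PeriodicTest γ χ) : MemLp χ 2 (cellMeasure γ) :=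
  memLp_of_continuous_periodic h.smooth.continuous h.periodic

lemma PeriodicTest.memLp_fderiv {γ : Module.Basis (Fin 2) ℝ Plane} {χ : Plane → ℂ}
    (h : PeriodicTest γ χ) (v : Plane) : MemLp (fun x => fderiv ℝ χ x v) 2 (cellMeasure γ) :=
  memLp_of_continuous_periodic (h.continuous_fderiv v)
    fun x g hg => by rw [fderiv_periodic h x g hg]

/-- The integral of a translate of `χ` does not depend on the translation; this is the derivative of
that identity. -/
lemma integral_fderiv_eq_zero {γ : Module.Basis (Fin 2) ℝ Plane} {χ : Plane → ℂ}
    (h : PeriodicTest γ χ) (v : Plane) : ∫ x, fderiv ℝ χ x v ∂cellMeasure γ = 0 := by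
  obtain ⟨C, hC⟩ := exists_bound_of_periodic (h.continuous_fderiv v)
    fun x g hg => by rw [fderiv_periodic h x g hg]
  have hd : HasDerivAt (fun t : ℝ => ∫ x, χ (x + t • v) ∂cellMeasure γ)
      (∫ x, fderiv ℝ χ (x + (0 : ℝ) • v) v ∂cellMeasure γ) 0 := by
    refine (hasDerivAt_integral_of_dominated_loc_of_deriv_le (bound := fun _ => C)
      (F' := fun t x => fderiv ℝ χ (x + t • v) v) (s := Set.univ) Filter.univ_mem
      (Filter.Eventually.of_forall fun t => ?_) ?_ ?_ ?_ (integrable_const _) ?_).2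
    · exact (h.smooth.continuous.comp
        (continuous_id.add continuous_const)).aestronglyMeasurable
    · simpa using h.memLp.integrable (by norm_num)
    · simpa using (h.continuous_fderiv v).aestronglyMeasurable
    · exact Filter.Eventually.of_forall fun x t _ => hC _
    · refine Filter.Eventually.of_forall fun x t _ => ?_
      have h1 : HasFDerivAt χ (fderiv ℝ χ (x + t • v)) (x + t • v) :=
        (h.smooth.differentiable (by simp) _).hasFDerivAt
      have h2 : HasDerivAt (fun t : ℝ => x + t • v) v t := by
        simpa using ((hasDerivAt_id t).smul_const v).const_add x
      exact h1.comp_hasDerivAt t h2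
  have hconst : (fun t : ℝ => ∫ x, χ (x + t • v) ∂cellMeasure γ)
      = fun _ => ∫ x, χ x ∂cellMeasure γ := by
    ext t
    exact integral_translate h.smooth.continuous h.periodic _
  rw [hconst] at hd
  simpa using hd.unique (hasDerivAt_const _ _)

lemma fderiv_expo (γ : Module.Basis (Fin 2) ℝ Plane) (n : Fin 2 → ℤ) (x v : Plane) :
    fderiv ℝ (expo γ n) x v
      = Complex.I * ((inner ℝ (dualVec γ n) v : ℝ) : ℂ) * expo γ n x := by
  have h1 : HasFDerivAt (fun x : Plane => ((inner ℝ (dualVec γ n) x : ℝ) : ℂ))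
      (Complex.ofRealCLM.comp (innerSL ℝ (dualVec γ n))) x :=
    (Complex.ofRealCLM.comp (innerSL ℝ (dualVec γ n))).hasFDerivAt
  have h2 := (h1.const_mul Complex.I).cexp
  rw [show expo γ n = fun x => Complex.exp (Complex.I * ((inner ℝ (dualVec γ n) x : ℝ) : ℂ))
    from rfl, h2.fderiv]
  simp
  ring

lemma PeriodicTest.mul_expo {γ : Module.Basis (Fin 2) ℝ Plane} {χ : Plane → ℂ}
    (h : PeriodicTest γ χ) (n : Fin 2 → ℤ) : PeriodicTest γ fun x => χ x * expo γ n x :=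
  ⟨fun x g hg => by rw [h.periodic x g hg, expo_periodic γ n x g hg],
    h.smooth.mul (contDiff_expo γ n)⟩

/-- Integration by parts on the torus: differentiation acts on Fourier coefficients as
multiplication by `i b · v`. -/
lemma hat_fderiv {γ : Module.Basis (Fin 2) ℝ Plane} {χ : Plane → ℂ} (h : PeriodicTest γ χ)
    (v : Plane) (n : Fin 2 → ℤ) :
    hat γ (fun x => fderiv ℝ χ x v) (dualVec γ n)
      = Complex.I * ((inner ℝ (dualVec γ n) v : ℝ) : ℂ) * hat γ χ (dualVec γ n) := by
  have h0 := integral_fderiv_eq_zero (h.mul_expo (-n)) v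
  have h1 : ∀ x, fderiv ℝ (fun x => χ x * expo γ (-n) x) x v
      = fderiv ℝ χ x v * expo γ (-n) x
        - Complex.I * ((inner ℝ (dualVec γ n) v : ℝ) : ℂ) * (χ x * expo γ (-n) x) := by
    intro x
    have hχ := h.smooth.differentiable (by simp) x
    have he := (contDiff_expo γ (-n)).differentiable (by simp) x
    rw [fderiv_fun_mul hχ he]
    simp only [add_apply, smul_apply, smul_eq_mul,
      fderiv_expo, map_neg, inner_neg_left]
    push_cast; ring
  simp only [h1] at h0
  have hi : ∀ f : Plane → ℂ, MemLp f 2 (cellMeasure γ) →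
      Integrable (fun x => f x * expo γ (-n) x) (cellMeasure γ) := fun f hf =>
    (hf.integrable (by norm_num)).mul_bdd (c := 1) (continuous_expo γ _).aestronglyMeasurable
      (Filter.Eventually.of_forall fun x => (norm_expo γ _ x).le)
  rw [integral_sub (hi _ (h.memLp_fderiv v)) ((hi _ h.memLp).const_mul _),
    integral_const_mul, sub_eq_zero] at h0
  rw [hat_eq_integral, hat_eq_integral, h0]

end

/-! ### The Fermi curve in Fourier space -/

lemma integral_cell_eq (γ : Module.Basis (Fin 2) ℝ Plane) (f : Plane → ℂ) :
    ∫ x in cell γ, f x = ((volume (cell γ)).toReal : ℂ) * ∫ x, f x ∂cellMeasure γ := by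
  have h : ((volume (cell γ)).toReal : ℂ) ≠ 0 := by
    exact_mod_cast (ENNReal.toReal_pos (volume_cell_ne_zero γ) (volume_cell_ne_top γ)).ne'
  rw [integral_cellMeasure, mul_inv_cancel_left₀ h]

lemma PeriodicL2.memLp_cell {γ : Module.Basis (Fin 2) ℝ Plane} {f : Plane → ℂ}
    (h : PeriodicL2 γ f) : MemLp f 2 (cellMeasure γ) := memLp_cellMeasure.2 h.memLp

lemma integrable_mul_expo {γ : Module.Basis (Fin 2) ℝ Plane} {f : Plane → ℂ}
    (hf : Integrable f (cellMeasure γ)) (n : Fin 2 → ℤ) :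
    Integrable (fun x => f x * expo γ n x) (cellMeasure γ) :=
  hf.mul_bdd (c := 1) (continuous_expo γ _).aestronglyMeasurable
    (Filter.Eventually.of_forall fun x => (norm_expo γ _ x).le)

lemma norm_hat_le {γ : Module.Basis (Fin 2) ℝ Plane} (f : Plane → ℂ) (n : Fin 2 → ℤ) :
    ‖hat γ f (dualVec γ n)‖ ≤ ∫ x, ‖f x‖ ∂cellMeasure γ := by
  rw [hat_eq_integral]
  refine (norm_integral_le_integral_norm _).trans (le_of_eq ?_)
  simp [norm_expo]

lemma hat_add {γ : Module.Basis (Fin 2) ℝ Plane} {f g : Plane → ℂ}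
    (hf : Integrable f (cellMeasure γ)) (hg : Integrable g (cellMeasure γ)) (n : Fin 2 → ℤ) :
    hat γ (fun x => f x + g x) (dualVec γ n)
      = hat γ f (dualVec γ n) + hat γ g (dualVec γ n) := by
  simp only [hat_eq_integral, add_mul]
  exact integral_add (integrable_mul_expo hf _) (integrable_mul_expo hg _)

/-- An `L²` function whose Fourier coefficients are absolutely summable is essentially bounded. -/
lemma exists_ae_bound {γ : Module.Basis (Fin 2) ℝ Plane} {f : Plane → ℂ}
    (hf : MemLp f 2 (cellMeasure γ)) (hs : Summable fun n => ‖hat γ f (dualVec γ n)‖) :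
    ∃ C, ∀ᵐ x ∂cellMeasure γ, ‖f x‖ ≤ C := by
  have h : f =ᵐ[cellMeasure γ] trigSeries γ fun n => hat γ f (dualVec γ n) :=
    ae_eq_of_hat_eq hf (memLp_trigSeries hs) fun n => (hat_trigSeries hs n).symm
  exact ⟨_, h.mono fun x hx => hx ▸ norm_trigSeries_le hs x⟩

lemma memLp_mul_of_ae_bound {γ : Module.Basis (Fin 2) ℝ Plane} {f g : Plane → ℂ} {C : ℝ}
    (hf : MemLp f 2 (cellMeasure γ)) (hC : ∀ᵐ x ∂cellMeasure γ, ‖f x‖ ≤ C)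
    (hg : MemLp g 2 (cellMeasure γ)) : MemLp (fun x => f x * g x) 2 (cellMeasure γ) :=
  hg.of_le_mul (c := C) (hf.1.mul hg.1) (hC.mono fun x hx => by
    rw [norm_mul]; gcongr)

lemma inner_single (b : Plane) (j : Fin 2) :
    inner ℝ b (EuclideanSpace.single j (1 : ℝ)) = b j := by
  rw [EuclideanSpace.inner_single_right]; simp

lemma transposeOp_expo (γ : Module.Basis (Fin 2) ℝ Plane) (A : Fin 2 → Plane → ℂ)
    (k : Fin 2 → ℂ) (j : Fin 2) (n : Fin 2 → ℤ) (x : Plane) :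
    transposeOp A k j (expo γ (-n)) x
      = A j x * expo γ (-n) x - (k j + (dualVec γ n j : ℂ)) * expo γ (-n) x := by
  rw [transposeOp, fderiv_expo, inner_single, map_neg]
  simp only [PiLp.neg_apply]
  push_cast
  linear_combination (dualVec γ n j : ℂ) * expo γ (-n) x * Complex.I_mul_I

lemma integral_mul_transposeOp_expo {γ : Module.Basis (Fin 2) ℝ Plane} {A : Fin 2 → Plane → ℂ}
    (k : Fin 2 → ℂ) {j : Fin 2} {f : Plane → ℂ} (hA : MemLp (A j) 2 (cellMeasure γ))
    (hf : MemLp f 2 (cellMeasure γ)) (n : Fin 2 → ℤ) :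
    ∫ x, f x * transposeOp A k j (expo γ (-n)) x ∂cellMeasure γ
      = hat γ (fun x => A j x * f x) (dualVec γ n)
        - (k j + (dualVec γ n j : ℂ)) * hat γ f (dualVec γ n) := by
  have h : ∀ x, f x * transposeOp A k j (expo γ (-n)) x = A j x * f x * expo γ (-n) x
      - (k j + (dualVec γ n j : ℂ)) * (f x * expo γ (-n) x) := by
    intro x; rw [transposeOp_expo]; ring
  simp only [h]
  rw [integral_sub, integral_const_mul, hat_eq_integral, hat_eq_integral]
  · exact integrable_mul_expo (hA.integrable_mul hf) _
  · exact (integrable_mul_expo (hf.integrable (by norm_num)) _).const_mul _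

/-- Parseval's identity for the pairing of an `L²` function with `transposeOp` of a test
function. -/
lemma hasSum_integral_mul_transposeOp {γ : Module.Basis (Fin 2) ℝ Plane}
    {A : Fin 2 → Plane → ℂ} (k : Fin 2 → ℂ) {j : Fin 2} {f χ : Plane → ℂ}
    (hA : MemLp (fun x => A j x * f x) 2 (cellMeasure γ)) (hf : MemLp f 2 (cellMeasure γ))
    (hχ : PeriodicTest γ χ) :
    HasSum (fun m => (hat γ (fun x => A j x * f x) (dualVec γ (-m))
        - (k j + (dualVec γ (-m) j : ℂ)) * hat γ f (dualVec γ (-m))) * hat γ χ (dualVec γ m))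
      (∫ x, f x * transposeOp A k j χ x ∂cellMeasure γ) := by
  have hd := hχ.memLp_fderiv (EuclideanSpace.single j (1 : ℝ))
  have h1 := hasSum_hat_mul hA hχ.memLp 0
  have h2 := hasSum_hat_mul hf hd 0
  have h3 := hasSum_hat_mul hf hχ.memLp 0
  have hz : ∀ f : Plane → ℂ, hat γ f (dualVec γ 0) = ∫ x, f x ∂cellMeasure γ := by
    intro f; rw [hat_eq_integral]; simp [expo]
  simp only [hz, zero_sub] at h1 h2 h3
  have hs : ∫ x, f x * transposeOp A k j χ x ∂cellMeasure γ
      = ∫ x, A j x * f x * χ x ∂cellMeasure γ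
        - Complex.I * ∫ x, f x * fderiv ℝ χ x (EuclideanSpace.single j (1 : ℝ)) ∂cellMeasure γ
        - k j * ∫ x, f x * χ x ∂cellMeasure γ := by
    rw [← integral_const_mul, ← integral_const_mul, ← integral_sub, ← integral_sub]
    · congr 1; ext x; rw [transposeOp]; ring
    · exact (hA.integrable_mul hχ.memLp).sub ((hf.integrable_mul hd).const_mul _)
    · exact (hf.integrable_mul hχ.memLp).const_mul _
    · exact hA.integrable_mul hχ.memLp
    · exact (hf.integrable_mul hd).const_mul _
  rw [hs]
  refine ((h1.sub (h2.mul_left Complex.I)).sub (h3.mul_left (k j))).congr_fun fun m => ?_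
  rw [hat_fderiv hχ, inner_single]
  simp only [map_neg, PiLp.neg_apply]
  push_cast
  linear_combination (dualVec γ m j : ℂ) * hat γ f (-dualVec γ m) * hat γ χ (dualVec γ m)
    * Complex.I_mul_I

/-- The potential part of the operator `H_k(A, V)` in Fourier space. The two cross terms
`-(k + n) · Â(n - m)` and `-(k + m) · Â(n - m)` are combined into `-2 (k + m) · Â(n - m)`; their
difference is the divergence term of `q`. -/
def fourierKernel (γ : Module.Basis (Fin 2) ℝ Plane) (A : Fin 2 → Plane → ℂ) (V : Plane → ℂ)
    (k : Fin 2 → ℂ) (n m : Fin 2 → ℤ) : ℂ :=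
  -2 * (∑ j, (k j + (dualVec γ m j : ℂ)) * hat γ (A j) (dualVec γ (n - m)))
    + qHat γ A V (dualVec γ (n - m))

/-- The symbol of the free operator `(i∇ - k)²` at the dual lattice vector with coordinates
`n`. -/
def freeSymbol (γ : Module.Basis (Fin 2) ℝ Plane) (k : Fin 2 → ℂ) (n : Fin 2 → ℤ) : ℂ :=
  ∑ j, (k j + (dualVec γ n j : ℂ)) ^ 2

section
variable {γ : Module.Basis (Fin 2) ℝ Plane} {A : Fin 2 → Plane → ℂ} {V : Plane → ℂ}

/-- The Fourier coefficient of `(i∇ + A - k) · P + V φ`, where `P = (i∇ + A - k) φ`, as the sum of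
the free part and the potential part applied to the coefficients of `φ`. -/
lemma hasSum_fourierKernel_mul (hA : ∀ j, MemLp (A j) 2 (cellMeasure γ))
    (hV : MemLp V 2 (cellMeasure γ))
    (hs : ∀ j, Summable fun n => ‖hat γ (A j) (dualVec γ n)‖) (k : Fin 2 → ℂ)
    {φ : Plane → ℂ} {P : Fin 2 → Plane → ℂ} (hφ : MemLp φ 2 (cellMeasure γ))
    (hP : ∀ j, MemLp (P j) 2 (cellMeasure γ))
    (hPφ : ∀ j n, hat γ (P j) (dualVec γ n) = hat γ (fun x => A j x * φ x) (dualVec γ n)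
      - (k j + (dualVec γ n j : ℂ)) * hat γ φ (dualVec γ n)) (n : Fin 2 → ℤ) :
    HasSum (fun m => fourierKernel γ A V k n m * hat γ φ (dualVec γ m))
      (∑ j, (hat γ (fun x => A j x * P j x) (dualVec γ n)
          - (k j + (dualVec γ n j : ℂ)) * hat γ (P j) (dualVec γ n))
        + hat γ (fun x => V x * φ x) (dualVec γ n)
        - freeSymbol γ k n * hat γ φ (dualVec γ n)) := by
  choose C hC using fun j => exists_ae_bound (hA j) (hs j)
  have hAφ : ∀ j, MemLp (fun x => A j x * φ x) 2 (cellMeasure γ) := fun j =>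
    memLp_mul_of_ae_bound (hA j) (hC j) hφ
  have hAA : MemLp (fun x => ∑ j : Fin 2, A j x ^ 2) 2 (cellMeasure γ) := by
    simp only [sq]
    exact memLp_finsetSum _ fun j _ => memLp_mul_of_ae_bound (hA j) (hC j) (hA j)
  have h1 : ∀ j, HasSum (fun m => hat γ (A j) (dualVec γ (n - m))
      * (-((k j + (dualVec γ m j : ℂ)) * hat γ φ (dualVec γ m))))
      (hat γ (fun x => A j x * P j x) (dualVec γ n)
        - hat γ (fun x => A j x * (A j x * φ x)) (dualVec γ n)) := by
    intro j
    refine ((hasSum_hat_mul (hA j) (hP j) n).sub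
      (hasSum_hat_mul (hA j) (hAφ j) n)).congr_fun fun m => ?_
    rw [hPφ]; ring
  have h2 : ∀ j, HasSum (fun m => -(k j + (dualVec γ n j : ℂ)) *
      (hat γ (A j) (dualVec γ (n - m)) * hat γ φ (dualVec γ m)))
      (-(k j + (dualVec γ n j : ℂ)) * hat γ (fun x => A j x * φ x) (dualVec γ n)) := fun j =>
    (hasSum_hat_mul (hA j) hφ n).mul_left _
  have h3 := hasSum_hat_mul hAA hφ n
  have h4 := hasSum_hat_mul hV hφ n
  have h5 : hat γ (fun x => (∑ j : Fin 2, A j x ^ 2) * φ x) (dualVec γ n)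
      = ∑ j, hat γ (fun x => A j x * (A j x * φ x)) (dualVec γ n) := by
    rw [Fin.sum_univ_two, ← hat_add (f := fun x => A 0 x * (A 0 x * φ x))
      (g := fun x => A 1 x * (A 1 x * φ x)) ((hA 0).integrable_mul (hAφ 0))
      ((hA 1).integrable_mul (hAφ 1))]
    congr 1; ext x; rw [Fin.sum_univ_two]; ring
  have h6 := (((hasSum_sum (s := Finset.univ) fun j _ => h1 j).add
    (hasSum_sum (s := Finset.univ) fun j _ => h2 j)).add h3).add h4
  rw [h5] at h6
  convert! h6 using 1
  · ext m
    simp only [fourierKernel, qHat, Fin.sum_univ_two, map_sub, PiLp.sub_apply]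
    push_cast
    ring
  · simp only [freeSymbol, Fin.sum_univ_two, hPφ]
    ring

/-- A point of the lifted Fermi curve gives a nonzero bounded solution of the equation
`H_k(A, V) φ = 0` in Fourier space. -/
lemma exists_fourier_solution (hA : ∀ j, PeriodicL2 γ (A j)) (hV : PeriodicL2 γ V)
    (hs : ∀ j, Summable fun n => ‖hat γ (A j) (dualVec γ n)‖) {k : Fin 2 → ℂ}
    (hk : k ∈ liftedFermiCurve γ A V) :
    ∃ f : (Fin 2 → ℤ) → ℂ, f ≠ 0 ∧ (∃ C, ∀ n, ‖f n‖ ≤ C) ∧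
      ∀ n, HasSum (fun m => fourierKernel γ A V k n m * f m) (-(freeSymbol γ k n * f n)) := by
  obtain ⟨φ, P, hφ, hφ0, hP, hsol⟩ := hk
  have hvol : ((volume (cell γ)).toReal : ℂ) ≠ 0 := by
    exact_mod_cast (ENNReal.toReal_pos (volume_cell_ne_zero γ) (volume_cell_ne_top γ)).ne'
  have hPφ : ∀ j n, hat γ (P j) (dualVec γ n) = hat γ (fun x => A j x * φ x) (dualVec γ n)
      - (k j + (dualVec γ n j : ℂ)) * hat γ φ (dualVec γ n) := by
    intro j n
    have h := (hP j).2 _ (periodicTest_expo γ (-n))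
    rw [integral_cell_eq, integral_cell_eq] at h
    have h' := mul_left_cancel₀ hvol h
    rwa [integral_mul_transposeOp_expo k (hA j).memLp_cell hφ.memLp_cell,
      ← hat_eq_integral] at h'
  refine ⟨fun n => hat γ φ (dualVec γ n), ?_, ⟨_, norm_hat_le φ⟩, fun n => ?_⟩
  · intro h0
    apply hφ0
    rw [Filter.EventuallyEq, ← ae_cellMeasure]
    refine ae_eq_of_hat_eq hφ.memLp_cell MemLp.zero' fun n => ?_
    have : hat γ φ (dualVec γ n) = 0 := congrFun h0 n
    rw [this, hat_eq_integral]; simp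
  · have h := hasSum_fourierKernel_mul (fun j => (hA j).memLp_cell) hV.memLp_cell hs k
      hφ.memLp_cell (fun j => (hP j).1.memLp_cell) hPφ n
    have h2 := hsol _ (periodicTest_expo γ (-n))
    simp only [integral_cell_eq] at h2
    rw [← Finset.mul_sum, ← mul_add] at h2
    have h2' := (mul_eq_zero.1 h2).resolve_left hvol
    simp only [fun j => integral_mul_transposeOp_expo k (hA j).memLp_cell (hP j).1.memLp_cell n]
      at h2'
    rw [← hat_eq_integral] at h2'
    rw [h2', zero_sub] at h
    exact h

/-- A solution of the equation `H_k(A, V) φ = 0` in Fourier space with a summable first moment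
comes from a point of the lifted Fermi curve. -/
lemma mem_liftedFermiCurve_of_fourier (hA : ∀ j, PeriodicL2 γ (A j)) (hV : PeriodicL2 γ V)
    (hs : ∀ j, Summable fun n => ‖hat γ (A j) (dualVec γ n)‖) {k : Fin 2 → ℂ}
    {f : (Fin 2 → ℤ) → ℂ} (hf0 : f ≠ 0) (hf : Summable fun n => (1 + ‖dualVec γ n‖) * ‖f n‖)
    (hsol : ∀ n, HasSum (fun m => fourierKernel γ A V k n m * f m) (-(freeSymbol γ k n * f n))) :
    k ∈ liftedFermiCurve γ A V := by
  have hf1 : Summable fun n => ‖f n‖ := by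
    refine Summable.of_nonneg_of_le (fun n => norm_nonneg _) (fun n => ?_) hf
    exact le_mul_of_one_le_left (norm_nonneg _) (by linarith [norm_nonneg (dualVec γ n)])
  have hD : ∀ j, Summable fun n => ‖-(k j + (dualVec γ n j : ℂ)) * f n‖ := by
    intro j
    refine Summable.of_nonneg_of_le (fun n => norm_nonneg _) (fun n => ?_)
      ((hf.mul_left (‖k j‖ + 1)))
    rw [norm_mul, norm_neg, ← mul_assoc]
    gcongr
    have h1 : ‖(dualVec γ n j : ℂ)‖ ≤ ‖dualVec γ n‖ := by
      rw [Complex.norm_real]; exact PiLp.norm_apply_le _ j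
    nlinarith [norm_add_le (k j) (dualVec γ n j : ℂ), norm_nonneg (k j),
      norm_nonneg (dualVec γ n)]
  -- `φ` is the sum of the Fourier series of `f`; its first moment makes `P` an `L²` function.
  set φ := trigSeries γ f with hφdef
  have hφ : PeriodicL2 γ φ := periodicL2_trigSeries hf1
  have hφhat : ∀ n, hat γ φ (dualVec γ n) = f n := hat_trigSeries hf1
  choose C hC using fun j => exists_ae_bound (hA j).memLp_cell (hs j)
  have hAφ : ∀ j, MemLp (fun x => A j x * φ x) 2 (cellMeasure γ) := fun j =>
    memLp_mul_of_ae_bound (hA j).memLp_cell (hC j) hφ.memLp_cell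
  set P : Fin 2 → Plane → ℂ := fun j x =>
    trigSeries γ (fun n => -(k j + (dualVec γ n j : ℂ)) * f n) x + A j x * φ x with hPdef
  have hPL : ∀ j, MemLp (P j) 2 (cellMeasure γ) := fun j =>
    (memLp_trigSeries (hD j)).add (hAφ j)
  have hPper : ∀ j, PeriodicL2 γ (P j) := fun j =>
    ⟨fun x g hg => by
      simp only [hPdef, hφdef, trigSeries_periodic γ _ x g hg, (hA j).periodic x g hg],
      memLp_cellMeasure.1 (hPL j)⟩
  have hAP : ∀ j, MemLp (fun x => A j x * P j x) 2 (cellMeasure γ) := fun j =>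
    memLp_mul_of_ae_bound (hA j).memLp_cell (hC j) (hPL j)
  have hVφ : MemLp (fun x => V x * φ x) 2 (cellMeasure γ) := by
    have := memLp_mul_of_ae_bound hφ.memLp_cell
      (Filter.Eventually.of_forall (norm_trigSeries_le hf1)) hV.memLp_cell
    simpa only [mul_comm] using this
  have hPφ : ∀ j n, hat γ (P j) (dualVec γ n) = hat γ (fun x => A j x * φ x) (dualVec γ n)
      - (k j + (dualVec γ n j : ℂ)) * hat γ φ (dualVec γ n) := by
    intro j n
    rw [hPdef, hat_add ((memLp_trigSeries (hD j)).integrable (by norm_num))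
      ((hAφ j).integrable (by norm_num)), hat_trigSeries (hD j), hφhat]
    ring
  have hsys : ∀ n, ∑ j, (hat γ (fun x => A j x * P j x) (dualVec γ n)
          - (k j + (dualVec γ n j : ℂ)) * hat γ (P j) (dualVec γ n))
        + hat γ (fun x => V x * φ x) (dualVec γ n) = 0 := by
    intro n
    have h := hasSum_fourierKernel_mul (fun j => (hA j).memLp_cell) hV.memLp_cell hs k
      hφ.memLp_cell hPL hPφ n
    simp only [hφhat] at h
    have := h.unique (hsol n)
    linear_combination this
  have hz : ∀ f : Plane → ℂ, hat γ f (dualVec γ 0) = ∫ x, f x ∂cellMeasure γ := by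
    intro f; rw [hat_eq_integral]; simp [expo]
  refine ⟨φ, P, hφ, fun h0 => hf0 ?_, fun j => ⟨hPper j, fun χ hχ => ?_⟩, fun χ hχ => ?_⟩
  · ext n
    rw [← hφhat, hat_congr (g := 0) (by rwa [Filter.EventuallyEq, ae_cellMeasure])]
    rw [hat_eq_integral]; simp
  · rw [integral_cell_eq, integral_cell_eq]
    congr 1
    have h1 := hasSum_hat_mul (hPL j) hχ.memLp 0
    rw [hz] at h1
    refine h1.unique ((hasSum_integral_mul_transposeOp k (hAφ j) hφ.memLp_cell hχ).congr_fun ?_)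
    intro m
    rw [zero_sub, hPφ]
  · simp only [integral_cell_eq]
    rw [← Finset.mul_sum, ← mul_add]
    have h1 := hasSum_hat_mul hVφ hχ.memLp 0
    rw [hz] at h1
    have h2 := (hasSum_sum (s := Finset.univ) fun j _ =>
      hasSum_integral_mul_transposeOp k (hAP j) (hPL j) hχ).add h1
    have h3 : ∀ m, (∑ j, (hat γ (fun x => A j x * P j x) (dualVec γ (-m))
        - (k j + (dualVec γ (-m) j : ℂ)) * hat γ (P j) (dualVec γ (-m))) * hat γ χ (dualVec γ m))
        + hat γ (fun x => V x * φ x) (dualVec γ (0 - m)) * hat γ χ (dualVec γ m) = 0 := by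
      intro m
      rw [zero_sub, ← Finset.sum_mul, ← add_mul, hsys, zero_mul]
    simp only [h3] at h2
    rw [h2.unique hasSum_zero, mul_zero]

end

/-! ### Neumann series for kernels dominated by a convolution -/

section Neumann

variable {G : Type*} [AddCommGroup G]

lemma summable_prod_conv {a x : G → ℝ} (ha0 : ∀ b, 0 ≤ a b) (hx0 : ∀ b, 0 ≤ x b)
    (ha : Summable a) (hx : Summable x) :
    Summable fun p : G × G => a (p.1 - p.2) * x p.2 := by
  have h := ha.mul_of_nonneg hx ha0 hx0
  let e : G × G ≃ G × G :=
    { toFun := fun p => (p.1 - p.2, p.2)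
      invFun := fun p => (p.1 + p.2, p.2)
      left_inv := fun p => by simp
      right_inv := fun p => by simp }
  exact (e.summable_iff (f := fun p : G × G => a p.1 * x p.2)).2 h

lemma summable_conv_apply {a x : G → ℝ} (ha0 : ∀ b, 0 ≤ a b) (hx0 : ∀ b, 0 ≤ x b)
    (ha : Summable a) (hx : Summable x) (c : G) : Summable fun d => a (c - d) * x d :=
  (summable_prod_conv ha0 hx0 ha hx).prod_factor c

lemma summable_conv {a x : G → ℝ} (ha0 : ∀ b, 0 ≤ a b) (hx0 : ∀ b, 0 ≤ x b)
    (ha : Summable a) (hx : Summable x) : Summable fun c => ∑' d, a (c - d) * x d :=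
  (summable_prod_conv ha0 hx0 ha hx).prod

lemma tsum_conv {a x : G → ℝ} (ha0 : ∀ b, 0 ≤ a b) (hx0 : ∀ b, 0 ≤ x b)
    (ha : Summable a) (hx : Summable x) :
    ∑' c, ∑' d, a (c - d) * x d = (∑' c, a c) * ∑' d, x d := by
  have h := summable_prod_conv ha0 hx0 ha hx
  have hm := ha.mul_of_nonneg hx ha0 hx0
  rw [← h.tsum_prod, ha.tsum_mul_tsum hx hm]
  let e : G × G ≃ G × G :=
    { toFun := fun p => (p.1 - p.2, p.2)
      invFun := fun p => (p.1 + p.2, p.2)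
      left_inv := fun p => by simp
      right_inv := fun p => by simp }
  exact e.tsum_eq (fun p : G × G => a p.1 * x p.2)

/-- The terms `Kⁿ K(·, 0)` of the Neumann series of the solution of `x = K(·, 0) + K x`. -/
def neumannTerm (K : G → G → ℂ) : ℕ → G → ℂ
  | 0 => fun c => K c 0
  | n + 1 => fun c => ∑' d, K c d * neumannTerm K n d

/-- The solution of `x = K(·, 0) + K x`, as a Neumann series. -/
def neumannSol (K : G → G → ℂ) (c : G) : ℂ := ∑' n, neumannTerm K n c

/-- The iterated convolutions of `a` with itself, which dominate the Neumann series of kernels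
dominated by `a`. -/
def convPow (a : G → ℝ) : ℕ → G → ℝ
  | 0 => a
  | n + 1 => fun c => ∑' d, a (c - d) * convPow a n d

/-- The weight `w` and the convolution kernel `a` are such that convolution with `a` has norm at
most `1/2` on the `ℓ¹` space with weight `w`. -/
structure IsContractive (w a : G → ℝ) : Prop where
  one_le : ∀ c, 1 ≤ w c
  submul : ∀ c d, w (c + d) ≤ w c * w d
  nonneg : ∀ c, 0 ≤ a c
  summable : Summable fun c => w c * a c
  tsum_le : ∑' c, w c * a c ≤ 1 / 2

namespace IsContractive
variable {w a : G → ℝ} (h : IsContractive w a)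
include h

lemma w_nonneg (c : G) : 0 ≤ w c := zero_le_one.trans (h.one_le c)

lemma le_w_mul {y : ℝ} (hy : 0 ≤ y) (c : G) : y ≤ w c * y :=
  le_mul_of_one_le_left hy (h.one_le c)

lemma summable_a : Summable a :=
  Summable.of_nonneg_of_le h.nonneg (fun c => h.le_w_mul (h.nonneg c) c) h.summable

lemma tsum_a_le : ∑' c, a c ≤ 1 / 2 :=
  (h.summable_a.tsum_le_tsum (fun c => h.le_w_mul (h.nonneg c) c) h.summable).trans h.tsum_le

lemma a_le (c : G) : a c ≤ 1 / 2 :=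
  (h.summable_a.le_tsum c fun d _ => h.nonneg d).trans h.tsum_a_le

lemma convPow_nonneg (n : ℕ) : ∀ c, 0 ≤ convPow a n c := by
  induction n with
  | zero => exact h.nonneg
  | succ n ih => exact fun c => tsum_nonneg fun d => mul_nonneg (h.nonneg _) (ih d)

lemma convPow_summable (n : ℕ) : Summable (fun c => w c * convPow a n c) ∧
    ∑' c, w c * convPow a n c ≤ (1 / 2) ^ (n + 1) := by
  induction n with
  | zero => rw [zero_add, pow_one]; exact ⟨h.summable, h.tsum_le⟩
  | succ n ih =>
    have hx0 : ∀ c, 0 ≤ w c * convPow a n c := fun c =>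
      mul_nonneg (h.w_nonneg c) (h.convPow_nonneg n c)
    have ha0 : ∀ c, 0 ≤ w c * a c := fun c => mul_nonneg (h.w_nonneg c) (h.nonneg c)
    have hx : Summable (convPow a n) := Summable.of_nonneg_of_le (h.convPow_nonneg n)
      (fun c => h.le_w_mul (h.convPow_nonneg n c) c) ih.1
    have hle : ∀ c, w c * convPow a (n + 1) c
        ≤ ∑' d, (w (c - d) * a (c - d)) * (w d * convPow a n d) := by
      intro c
      rw [convPow, ← tsum_mul_left]
      refine ((summable_conv_apply h.nonneg (h.convPow_nonneg n) h.summable_a hx c).mul_left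
        _).tsum_le_tsum (fun d => ?_) (summable_conv_apply ha0 hx0 h.summable ih.1 c)
      have h1 : w c ≤ w (c - d) * w d := by simpa using h.submul (c - d) d
      calc w c * (a (c - d) * convPow a n d)
          ≤ (w (c - d) * w d) * (a (c - d) * convPow a n d) :=
            mul_le_mul_of_nonneg_right h1 (mul_nonneg (h.nonneg _) (h.convPow_nonneg n d))
        _ = _ := by ring
    have hs := summable_conv ha0 hx0 h.summable ih.1
    have hs' : Summable fun c => w c * convPow a (n + 1) c := Summable.of_nonneg_of_le
      (fun c => mul_nonneg (h.w_nonneg c) (h.convPow_nonneg _ c)) hle hs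
    refine ⟨hs', (hs'.tsum_le_tsum hle hs).trans ?_⟩
    rw [tsum_conv ha0 hx0 h.summable ih.1, pow_succ' _ (n + 1)]
    exact mul_le_mul h.tsum_le ih.2 (tsum_nonneg hx0) (by norm_num)

/-- The weighted norm of the `n`-th convolution power is at most `2⁻ⁿ⁻¹`, hence the double series
over powers and modes converges absolutely. -/
lemma summable_convPow_prod : Summable fun p : ℕ × G => w p.2 * convPow a p.1 p.2 := by
  refine (summable_prod_of_nonneg fun p =>
    mul_nonneg (h.w_nonneg p.2) (h.convPow_nonneg p.1 p.2)).2 ⟨fun n => (h.convPow_summable n).1, ?_⟩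
  refine Summable.of_nonneg_of_le (fun n => tsum_nonneg fun c =>
    mul_nonneg (h.w_nonneg c) (h.convPow_nonneg n c)) (fun n => (h.convPow_summable n).2) ?_
  exact (summable_nat_add_iff 1).2 (summable_geometric_of_lt_one (by norm_num) (by norm_num))

lemma summable_convPow (c : G) : Summable fun n => convPow a n c := by
  have h1 := h.summable_convPow_prod.prod_symm.prod_factor c
  exact Summable.of_nonneg_of_le (fun n => h.convPow_nonneg n c)
    (fun n => h.le_w_mul (h.convPow_nonneg n c) c) h1

lemma majorant_nonneg (c : G) : 0 ≤ ∑' n, convPow a n c :=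
  tsum_nonneg fun n => h.convPow_nonneg n c

lemma summable_majorant : Summable fun c => w c * ∑' n, convPow a n c := by
  have h1 := h.summable_convPow_prod.prod_symm.prod
  simpa only [Prod.swap_prod_mk, Function.comp, tsum_mul_left] using h1

lemma tsum_majorant_le : ∑' c, w c * ∑' n, convPow a n c ≤ 1 := by
  have h1 : Summable fun n : ℕ => ((1 : ℝ) / 2) ^ (n + 1) :=
    (summable_nat_add_iff 1).2 (summable_geometric_of_lt_one (by norm_num) (by norm_num))
  calc ∑' c, w c * ∑' n, convPow a n c = ∑' c, ∑' n, w c * convPow a n c := by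
        simp only [tsum_mul_left]
    _ = ∑' n, ∑' c, w c * convPow a n c :=
        Summable.tsum_comm (f := fun n c => w c * convPow a n c) h.summable_convPow_prod
    _ ≤ ∑' n : ℕ, ((1 : ℝ) / 2) ^ (n + 1) := by
        refine Summable.tsum_le_tsum (fun n => (h.convPow_summable n).2)
          h.summable_convPow_prod.prod h1
    _ = 1 := by
        simp only [pow_succ]
        rw [tsum_mul_right, tsum_geometric_of_lt_one (by norm_num) (by norm_num)]
        norm_num

variable {K : G → G → ℂ} (hK : ∀ c d, ‖K c d‖ ≤ a (c - d))
include hK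

lemma norm_neumannTerm_le (n : ℕ) : ∀ c, ‖neumannTerm K n c‖ ≤ convPow a n c := by
  induction n with
  | zero => exact fun c => by simpa using! hK c 0
  | succ n ih =>
    intro c
    have hx : Summable (convPow a n) := Summable.of_nonneg_of_le (h.convPow_nonneg n)
      (fun c => h.le_w_mul (h.convPow_nonneg n c) c) (h.convPow_summable n).1
    refine tsum_of_norm_bounded
      (summable_conv_apply h.nonneg (h.convPow_nonneg n) h.summable_a hx c).hasSum fun d => ?_
    rw [norm_mul]
    exact mul_le_mul (hK c d) (ih d) (norm_nonneg _) (h.nonneg _)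

lemma norm_neumannSol_le (c : G) : ‖neumannSol K c‖ ≤ ∑' n, convPow a n c :=
  tsum_of_norm_bounded (h.summable_convPow c).hasSum fun n => h.norm_neumannTerm_le hK n c

lemma summable_norm_neumannSol : Summable fun c => w c * ‖neumannSol K c‖ :=
  Summable.of_nonneg_of_le (fun c => mul_nonneg (h.w_nonneg c) (norm_nonneg _))
    (fun c => mul_le_mul_of_nonneg_left (h.norm_neumannSol_le hK c) (h.w_nonneg c))
    h.summable_majorant

lemma tsum_norm_neumannSol_le : ∑' c, w c * ‖neumannSol K c‖ ≤ 1 :=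
  ((h.summable_norm_neumannSol hK).tsum_le_tsum
    (fun c => mul_le_mul_of_nonneg_left (h.norm_neumannSol_le hK c) (h.w_nonneg c))
    h.summable_majorant).trans h.tsum_majorant_le

/-- The Neumann series solves `x = K(·, 0) + K x`. -/
lemma neumannSol_eq (c : G) : neumannSol K c = K c 0 + ∑' d, K c d * neumannSol K d := by
  have hs : Summable fun n => neumannTerm K n c :=
    Summable.of_norm_bounded (h.summable_convPow c) fun n => h.norm_neumannTerm_le hK n c
  have hprod : Summable (Function.uncurry fun n d => K c d * neumannTerm K n d) := by
    refine Summable.of_norm_bounded h.summable_convPow_prod fun p => ?_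
    rw [Function.uncurry, norm_mul]
    have h1 : ‖K c p.2‖ ≤ w p.2 :=
      ((hK c p.2).trans (h.a_le _)).trans ((by norm_num : (1 : ℝ) / 2 ≤ 1).trans (h.one_le _))
    exact mul_le_mul h1 (h.norm_neumannTerm_le hK _ _) (norm_nonneg _) (h.w_nonneg _)
  rw [neumannSol, hs.tsum_eq_zero_add]
  congr 1
  simp only [neumannTerm, neumannSol, ← tsum_mul_left]
  exact Summable.tsum_comm (f := fun d n => K c d * neumannTerm K n d) hprod.prod_symm

/-- Uniqueness holds among bounded sequences: the Fourier coefficients of an `L²` solution need not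
be known to be summable. -/
lemma eq_zero_of_bounded {z : G → ℂ} {C : ℝ} (hz : ∀ c, ‖z c‖ ≤ C)
    (hfix : ∀ c, z c = ∑' d, K c d * z d) (c : G) : z c = 0 := by
  have hC : 0 ≤ C := (norm_nonneg _).trans (hz c)
  have key : ∀ n : ℕ, ∀ c, ‖z c‖ ≤ C * (1 / 2) ^ n := by
    intro n
    induction n with
    | zero => simpa using hz
    | succ n ih =>
      intro c
      have hs : Summable fun d => a (c - d) :=
        ((Equiv.subLeft c).summable_iff (f := a)).2 h.summable_a
      have ht : ∑' d, a (c - d) = ∑' d, a d := (Equiv.subLeft c).tsum_eq a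
      rw [hfix c]
      refine (tsum_of_norm_bounded (hs.mul_right (C * (1 / 2) ^ n)).hasSum fun d => ?_).trans ?_
      · rw [norm_mul]
        exact mul_le_mul (hK c d) (ih d) (norm_nonneg _) (h.nonneg _)
      · rw [tsum_mul_right, ht]
        have := mul_le_mul_of_nonneg_right h.tsum_a_le
          (show 0 ≤ C * (1 / 2) ^ n by positivity)
        refine this.trans (le_of_eq (by ring))
  have hlim : Filter.Tendsto (fun n : ℕ => C * (1 / 2) ^ n) Filter.atTop (nhds (C * 0)) :=
    (tendsto_pow_atTop_nhds_zero_of_lt_one (by norm_num) (by norm_num)).const_mul C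
  rw [mul_zero] at hlim
  exact norm_le_zero_iff.1 (ge_of_tendsto' hlim fun n => key n c)

end IsContractive

/-- The Neumann series depends holomorphically on the kernel. -/
lemma IsContractive.differentiableOn_neumannSol {w a : G → ℝ} (h : IsContractive w a)
    {K : ℂ → G → G → ℂ} {O : Set ℂ} (hO : IsOpen O)
    (hK : ∀ ζ ∈ O, ∀ c d, ‖K ζ c d‖ ≤ a (c - d))
    (hd : ∀ c d, DifferentiableOn ℂ (fun ζ => K ζ c d) O) (c : G) :
    DifferentiableOn ℂ (fun ζ => neumannSol (K ζ) c) O := by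
  have hterm : ∀ n c, DifferentiableOn ℂ (fun ζ => neumannTerm (K ζ) n c) O := by
    intro n
    induction n with
    | zero => exact fun c => hd c 0
    | succ n ih =>
      intro c
      have hx : Summable (convPow a n) := Summable.of_nonneg_of_le (h.convPow_nonneg n)
        (fun c => h.le_w_mul (h.convPow_nonneg n c) c) (h.convPow_summable n).1
      refine Complex.differentiableOn_tsum_of_summable_norm
        (summable_conv_apply h.nonneg (h.convPow_nonneg n) h.summable_a hx c)
        (fun d => (hd c d).mul (ih d)) hO fun d ζ hζ => ?_
      rw [norm_mul]
      exact mul_le_mul (hK ζ hζ c d) (h.norm_neumannTerm_le (hK ζ hζ) n d) (norm_nonneg _)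
        (h.nonneg _)
  exact Complex.differentiableOn_tsum_of_summable_norm (h.summable_convPow c) (fun n => hterm n c) hO
    fun n ζ hζ => h.norm_neumannTerm_le (hK ζ hζ) n c

end Neumann

/-! ### Elimination of the nonzero modes -/

/-- The data that describe the operator near one of its tubes, in the complex coordinates
`η = N_{0,ν}(k)` and `n = N_{0,ν'}(k)`, for Fourier modes in `G`: the free symbol at the mode `c`
is `(η + τ c) (n + τ' c)` and the potential terms couple `d` to `c` by
`(η + τ d) p (c - d) + (n + τ' d) p' (c - d) + q (c - d)`. The function `h` dominates the two complex
combinations `p`, `p'` of the Fourier coefficients of the magnetic potential. -/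
structure TubeData (G : Type*) [AddCommGroup G] where
  Λ : ℝ
  ε : ℝ
  τ : G →+ ℂ
  τ' : G →+ ℂ
  p : G → ℂ
  p' : G → ℂ
  q : G → ℂ
  h : G → ℝ
  ε_pos : 0 < ε
  ε_lt : ε < Λ / 6
  norm_τ' : ∀ b, ‖τ' b‖ = ‖τ b‖
  gap : ∀ b, b ≠ 0 → 2 * Λ ≤ ‖τ b‖
  p_zero : p 0 = 0
  p'_zero : p' 0 = 0
  p_le : ∀ b, ‖p b‖ ≤ h b
  p'_le : ∀ b, ‖p' b‖ ≤ h b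
  summable_h : Summable fun b => (1 + ‖τ b‖ ^ 2) * h b
  tsum_h : ∑' b, (1 + ‖τ b‖ ^ 2) * h b ≤ 9 * ε / 200
  summable_q : Summable fun b => (1 + ‖τ b‖) * ‖q b‖

namespace TubeData
variable {G : Type*} [AddCommGroup G] (D : TubeData G)

lemma Λ_pos : 0 < D.Λ := by linarith [D.ε_pos, D.ε_lt]

lemma h_nonneg (b : G) : 0 ≤ D.h b := (norm_nonneg _).trans (D.p_le b)

/-- The weight `1 + |b|`. -/
def w (b : G) : ℝ := 1 + ‖D.τ b‖

lemma one_le_w (b : G) : 1 ≤ D.w b := by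
  rw [w]; linarith [norm_nonneg (D.τ b)]

lemma w_nonneg (b : G) : 0 ≤ D.w b := zero_le_one.trans (D.one_le_w b)

lemma w_add_le (b c : G) : D.w (b + c) ≤ D.w b * D.w c := by
  simp only [w, map_add]
  nlinarith [norm_add_le (D.τ b) (D.τ c), norm_nonneg (D.τ b), norm_nonneg (D.τ c),
    mul_nonneg (norm_nonneg (D.τ b)) (norm_nonneg (D.τ c))]

lemma w_mul_h_le (b : G) : D.w b * D.h b ≤ 5 / 4 * ((1 + ‖D.τ b‖ ^ 2) * D.h b) := by
  have h1 : D.w b ≤ 5 / 4 * (1 + ‖D.τ b‖ ^ 2) := by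
    rw [w]; nlinarith [sq_nonneg (‖D.τ b‖ - 2 / 5)]
  have := mul_le_mul_of_nonneg_right h1 (D.h_nonneg b)
  linarith

lemma summable_w_h : Summable fun b => D.w b * D.h b :=
  Summable.of_nonneg_of_le (fun b => mul_nonneg (D.w_nonneg b) (D.h_nonneg b)) D.w_mul_h_le
    (D.summable_h.mul_left _)

lemma tsum_w_h_le : ∑' b, D.w b * D.h b ≤ 9 * D.ε / 160 := by
  have h1 := D.summable_w_h.tsum_le_tsum D.w_mul_h_le (D.summable_h.mul_left _)
  rw [tsum_mul_left] at h1
  linarith [D.tsum_h]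

lemma h_le_sq (b : G) : D.h b ≤ (1 + ‖D.τ b‖ ^ 2) * D.h b :=
  le_mul_of_one_le_left (D.h_nonneg b) (by nlinarith [norm_nonneg (D.τ b)])

lemma summable_h₀ : Summable D.h := Summable.of_nonneg_of_le D.h_nonneg D.h_le_sq D.summable_h

/-- The `ℓ¹` norm of `h`. -/
def S : ℝ := ∑' b, D.h b

lemma S_nonneg : 0 ≤ D.S := tsum_nonneg D.h_nonneg

lemma S_le : D.S ≤ 9 * D.ε / 200 :=
  (D.summable_h₀.tsum_le_tsum D.h_le_sq D.summable_h).trans D.tsum_h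

lemma h_le_S (b : G) : D.h b ≤ D.S := D.summable_h₀.le_tsum b fun c _ => D.h_nonneg c

/-- The part of the coupling that is divided by the full free symbol. -/
def u (b : G) : ℝ := 2 * ‖D.τ b‖ * D.h b + ‖D.q b‖

lemma u_nonneg (b : G) : 0 ≤ D.u b :=
  add_nonneg (mul_nonneg (by positivity) (D.h_nonneg b)) (norm_nonneg _)

lemma summable_w_u : Summable fun b => D.w b * D.u b := by
  have h1 : Summable fun b => 4 * ((1 + ‖D.τ b‖ ^ 2) * D.h b) + (1 + ‖D.τ b‖) * ‖D.q b‖ :=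
    (D.summable_h.mul_left 4).add D.summable_q
  refine Summable.of_nonneg_of_le (fun b => mul_nonneg (D.w_nonneg b) (D.u_nonneg b))
    (fun b => ?_) h1
  have h2 : D.w b * (2 * ‖D.τ b‖) ≤ 4 * (1 + ‖D.τ b‖ ^ 2) := by
    rw [w]; nlinarith [sq_nonneg (‖D.τ b‖ - 1)]
  have := mul_le_mul_of_nonneg_right h2 (D.h_nonneg b)
  rw [u, w] at *
  linarith

/-- The weighted `ℓ¹` norm of `u`. -/
def U : ℝ := ∑' b, D.w b * D.u b

lemma U_nonneg : 0 ≤ D.U := tsum_nonneg fun b => mul_nonneg (D.w_nonneg b) (D.u_nonneg b)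

lemma u_le_w_mul (b : G) : D.u b ≤ D.w b * D.u b :=
  le_mul_of_one_le_left (D.u_nonneg b) (D.one_le_w b)

lemma summable_u : Summable D.u :=
  Summable.of_nonneg_of_le D.u_nonneg D.u_le_w_mul D.summable_w_u

lemma u_le_U (b : G) : D.u b ≤ D.U :=
  (D.u_le_w_mul b).trans (D.summable_w_u.le_tsum b fun c _ =>
    mul_nonneg (D.w_nonneg c) (D.u_nonneg c))

/-- The coupling of the mode `d` to the mode `c`. -/
def M (η n : ℂ) (c d : G) : ℂ :=
  (η + D.τ d) * D.p (c - d) + (n + D.τ' d) * D.p' (c - d) + D.q (c - d)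

/-- The free symbol at the mode `c`. -/
def N (η n : ℂ) (c : G) : ℂ := (η + D.τ c) * (n + D.τ' c)

open Classical in
/-- The coupling divided by minus the free symbol, restricted to the nonzero modes `c`. -/
def K (η n : ℂ) (c d : G) : ℂ := if c = 0 then 0 else -(D.M η n c d / D.N η n c)

/-- The equation of the mode zero, divided by `n`, after the nonzero modes have been eliminated: the
reduced equation of the curve is `η + g η n = 0`. -/
def g (η n : ℂ) : ℂ :=
  D.q 0 / n + ∑' d, D.M η n 0 d / n * neumannSol (D.K η n) d

/-- The points near the tube of the zero mode and away from the tubes of the other modes. -/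
structure Region (R : ℝ) (η n : ℂ) : Prop where
  η_lt : ‖η‖ < D.ε
  le_n : R ≤ ‖n‖
  away : ∀ c, c ≠ 0 → 9 / 10 * D.ε ≤ ‖n + D.τ' c‖

/-- Beyond this threshold for `n` the coupling of the nonzero modes is a contraction; the summand
`10 U / ε` makes the contribution of `u` to the norm at most `2 / 5`. -/
def R₁ : ℝ := 1 + 3 * D.ε + 10 * D.U / D.ε

lemma le_R₁ : 1 + 3 * D.ε ≤ D.R₁ := by
  have : 0 ≤ 10 * D.U / D.ε := div_nonneg (by linarith [D.U_nonneg]) D.ε_pos.le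
  rw [R₁]; linarith

section region
variable {D} {R : ℝ} {η n : ℂ}

lemma Region.le_norm_add_τ (hr : D.Region R η n) {c : G} (hc : c ≠ 0) :
    11 / 6 * D.Λ ≤ ‖η + D.τ c‖ := by
  have h1 := norm_sub_le (η + D.τ c) η
  rw [add_sub_cancel_left] at h1
  linarith [D.gap c hc, hr.η_lt, D.ε_lt]

lemma Region.n_pos (hr : D.Region R η n) (hR : D.R₁ ≤ R) : 0 < ‖n‖ := by
  linarith [hr.le_n, D.le_R₁, D.ε_pos]

/-- Away from the other tubes the two factors of the free symbol are not small at the same time: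
for `|c|` up to about half of `‖n‖` the second factor is of the size of `‖n‖`, and for larger `c` the
first one is. -/
lemma Region.le_norm_N (hr : D.Region R η n) (hR : D.R₁ ≤ R) {c : G} (hc : c ≠ 0) :
    D.ε * ‖n‖ / 4 ≤ ‖D.N η n c‖ := by
  have h1 := norm_sub_le (η + D.τ c) η
  rw [add_sub_cancel_left] at h1
  have h2 := norm_sub_le (n + D.τ' c) (D.τ' c)
  rw [add_sub_cancel_right, D.norm_τ'] at h2
  have h3 := hr.away c hc
  have h4 := hr.le_norm_add_τ hc
  have h5 := hr.η_lt
  have h6 : 1 + 3 * D.ε ≤ ‖n‖ := D.le_R₁.trans (hR.trans hr.le_n)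
  have hε := D.ε_pos
  have hε' := D.ε_lt
  rw [N, norm_mul]
  rcases le_total ‖D.τ c‖ ((‖n‖ + D.ε) / 2) with h | h
  · nlinarith [mul_le_mul (show D.ε ≤ ‖η + D.τ c‖ by linarith)
      (show (‖n‖ - D.ε) / 2 ≤ ‖n + D.τ' c‖ by linarith) (by linarith) (by linarith)]
  · nlinarith [mul_le_mul (show (‖n‖ - D.ε) / 2 ≤ ‖η + D.τ c‖ by linarith) h3
      (by linarith) (by linarith)]

lemma Region.ne_zero (hr : D.Region R η n) {c : G} (hc : c ≠ 0) :
    η + D.τ c ≠ 0 ∧ n + D.τ' c ≠ 0 := by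
  constructor
  · exact norm_pos_iff.1 (by linarith [hr.le_norm_add_τ hc, D.Λ_pos])
  · exact norm_pos_iff.1 (by linarith [hr.away c hc, D.ε_pos])

/-- Each part of the coupling is divided by only one factor of the free symbol, up to a remainder
that contains no `η` or `n` and is divided by both. The part with `p'` is divided by the factor that
is at least `11 Λ / 6`, the part with `p` by the factor that may be as small as `ε`. -/
lemma Region.K_eq (hr : D.Region R η n) {c : G} (hc : c ≠ 0) (d : G) :
    D.K η n c d = -(D.p (c - d) / (n + D.τ' c)) - D.p' (c - d) / (η + D.τ c)
      + (D.τ (c - d) * D.p (c - d) + D.τ' (c - d) * D.p' (c - d) - D.q (c - d)) / D.N η n c := by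
  obtain ⟨h1, h2⟩ := hr.ne_zero hc
  rw [K, if_neg hc, M, N, map_sub, map_sub]
  field_simp
  ring

lemma norm_remainder_le (b : G) :
    ‖D.τ b * D.p b + D.τ' b * D.p' b - D.q b‖ ≤ D.u b := by
  have h1 := norm_sub_le (D.τ b * D.p b + D.τ' b * D.p' b) (D.q b)
  have h2 := norm_add_le (D.τ b * D.p b) (D.τ' b * D.p' b)
  rw [norm_mul, norm_mul, D.norm_τ'] at h2
  have h3 := mul_le_mul_of_nonneg_left (D.p_le b) (norm_nonneg (D.τ b))
  have h4 := mul_le_mul_of_nonneg_left (D.p'_le b) (norm_nonneg (D.τ b))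
  rw [u]; linarith

lemma Region.norm_remainder_div_le (hr : D.Region R η n) (hR : D.R₁ ≤ R) {c : G} (hc : c ≠ 0)
    (b : G) : ‖(D.τ b * D.p b + D.τ' b * D.p' b - D.q b) / D.N η n c‖
      ≤ 4 / D.ε * D.u b / ‖n‖ := by
  have hn := hr.n_pos hR
  have hε := D.ε_pos
  have hN := hr.le_norm_N hR hc
  rw [norm_div]
  calc _ ≤ D.u b / (D.ε * ‖n‖ / 4) :=
        div_le_div₀ (D.u_nonneg b) (norm_remainder_le b) (by positivity) hN
    _ = _ := by field_simp

/-- The convolution kernel that dominates the couplings uniformly on the region. -/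
def majorant (D : TubeData G) (R : ℝ) (b : G) : ℝ :=
  5 / (4 * D.ε) * D.h b + 4 / (D.ε * R) * D.u b

lemma isContractive_majorant (hR : D.R₁ ≤ R) : IsContractive D.w (D.majorant R) := by
  have hε := D.ε_pos
  have hR0 : 0 < R := by linarith [D.le_R₁]
  have e : ∀ b, D.w b * D.majorant R b
      = 5 / (4 * D.ε) * (D.w b * D.h b) + 4 / (D.ε * R) * (D.w b * D.u b) := by
    intro b; rw [majorant]; ring
  refine ⟨D.one_le_w, D.w_add_le, fun c => ?_, ?_, ?_⟩
  · exact add_nonneg (mul_nonneg (by positivity) (D.h_nonneg c))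
      (mul_nonneg (by positivity) (D.u_nonneg c))
  · simp only [e]
    exact (D.summable_w_h.mul_left _).add (D.summable_w_u.mul_left _)
  · simp only [e]
    rw [(D.summable_w_h.mul_left _).tsum_add (D.summable_w_u.mul_left _), tsum_mul_left,
      tsum_mul_left]
    have h1 : 5 / (4 * D.ε) * ∑' b, D.w b * D.h b ≤ 5 / (4 * D.ε) * (9 * D.ε / 160) :=
      mul_le_mul_of_nonneg_left D.tsum_w_h_le (by positivity)
    -- The two parts contribute at most `9 / 128` and `2 / 5`, together less than `1 / 2`.
    have h2 : 5 / (4 * D.ε) * (9 * D.ε / 160) = 9 / 128 := by field_simp; norm_num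
    have h3 : 4 / (D.ε * R) * D.U ≤ 2 / 5 := by
      rw [div_mul_eq_mul_div, div_le_iff₀ (by positivity)]
      have h4 : 10 * D.U / D.ε ≤ R := by rw [R₁] at hR; linarith
      rw [div_le_iff₀ hε] at h4
      linarith
    rw [U] at h3
    linarith

lemma Region.norm_K_le (hr : D.Region R η n) (hR : D.R₁ ≤ R) (c d : G) :
    ‖D.K η n c d‖ ≤ D.majorant R (c - d) := by
  by_cases hc : c = 0
  · rw [K, if_pos hc, norm_zero]; exact (isContractive_majorant hR).nonneg _
  have hε := D.ε_pos
  have hR0 : 0 < R := by linarith [D.le_R₁]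
  rw [hr.K_eq hc, majorant]
  set b := c - d
  have h1 : ‖D.p b / (n + D.τ' c)‖ ≤ D.h b / (9 / 10 * D.ε) := by
    rw [norm_div]
    exact div_le_div₀ (D.h_nonneg b) (D.p_le b) (by positivity) (hr.away c hc)
  have h2 : ‖D.p' b / (η + D.τ c)‖ ≤ D.h b / (11 * D.ε) := by
    rw [norm_div]
    refine div_le_div₀ (D.h_nonneg b) (D.p'_le b) (by positivity) ?_
    linarith [hr.le_norm_add_τ hc, D.ε_lt]
  have h3 := hr.norm_remainder_div_le hR hc b
  have h4 : 4 / D.ε * D.u b / ‖n‖ ≤ 4 / (D.ε * R) * D.u b := by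
    have : 4 / (D.ε * R) * D.u b = 4 / D.ε * D.u b / R := by field_simp
    rw [this]
    exact div_le_div_of_nonneg_left (mul_nonneg (by positivity) (D.u_nonneg b)) hR0 hr.le_n
  have h5 : D.h b / (9 / 10 * D.ε) + D.h b / (11 * D.ε) ≤ 5 / (4 * D.ε) * D.h b := by
    have : 5 / (4 * D.ε) * D.h b - (D.h b / (9 / 10 * D.ε) + D.h b / (11 * D.ε))
        = D.h b / D.ε * (5 / 4 - 10 / 9 - 1 / 11) := by
      field_simp; ring
    have h6 : 0 ≤ D.h b / D.ε := div_nonneg (D.h_nonneg b) hε.le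
    nlinarith
  refine (norm_add_le _ _).trans ?_
  have h7 := norm_sub_le (-(D.p b / (n + D.τ' c))) (D.p' b / (η + D.τ c))
  rw [norm_neg] at h7
  linarith

/-- In the equation of the mode zero, divided by `n`, only the coefficient `p'` survives for
large `n`. -/
lemma Region.norm_M_div_sub_le (hr : D.Region R η n) (hR : D.R₁ ≤ R) (d : G) :
    ‖D.M η n 0 d / n - D.p' (-d)‖ ≤ (D.ε ^ 2 + D.U) / ‖n‖ := by
  have hn := hr.n_pos hR
  have hn0 : n ≠ 0 := norm_pos_iff.1 hn
  have hε := D.ε_pos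
  have e : D.M η n 0 d / n - D.p' (-d)
      = (η * D.p (-d) - (D.τ (-d) * D.p (-d) + D.τ' (-d) * D.p' (-d) - D.q (-d))) / n := by
    rw [M, zero_sub, map_neg, map_neg]
    field_simp
    ring
  rw [e, norm_div]
  refine div_le_div_of_nonneg_right ((norm_sub_le _ _).trans ?_) hn.le
  refine add_le_add ?_ ((norm_remainder_le _).trans (D.u_le_U _))
  rw [norm_mul, sq]
  refine mul_le_mul hr.η_lt.le ((D.p_le _).trans ((D.h_le_S _).trans ?_)) (norm_nonneg _) hε.le
  linarith [D.S_le]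

lemma Region.norm_M_div_le (hr : D.Region R η n) (hR : D.R₁ ≤ R) (d : G) :
    ‖D.M η n 0 d / n‖ ≤ D.S + (D.ε ^ 2 + D.U) := by
  have h1 := hr.norm_M_div_sub_le hR d
  have h2 := norm_sub_norm_le (D.M η n 0 d / n) (D.p' (-d))
  have h3 := (D.p'_le (-d)).trans (D.h_le_S _)
  have h4 : (D.ε ^ 2 + D.U) / ‖n‖ ≤ D.ε ^ 2 + D.U :=
    div_le_self (add_nonneg (sq_nonneg _) D.U_nonneg)
      (by linarith [hr.le_n, D.le_R₁, D.ε_pos])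
  linarith

lemma neumannSol_zero (hr : D.Region R η n) (hR : D.R₁ ≤ R) :
    neumannSol (D.K η n) 0 = 0 := by
  rw [(isContractive_majorant hR).neumannSol_eq (hr.norm_K_le hR)]
  simp [K]

lemma Region.summable_norm_sol (hr : D.Region R η n) (hR : D.R₁ ≤ R) :
    Summable fun c => ‖neumannSol (D.K η n) c‖ :=
  Summable.of_nonneg_of_le (fun _ => norm_nonneg _)
    (fun _ => le_mul_of_one_le_left (norm_nonneg _) (D.one_le_w _))
    ((isContractive_majorant hR).summable_norm_neumannSol (hr.norm_K_le hR))

lemma Region.summable_K_mul_sol (hr : D.Region R η n) (hR : D.R₁ ≤ R) (c : G) :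
    Summable fun d => D.K η n c d * neumannSol (D.K η n) d := by
  refine Summable.of_norm_bounded (hr.summable_norm_sol hR) fun d => ?_
  rw [norm_mul]
  refine mul_le_of_le_one_left (norm_nonneg _) ?_
  linarith [(hr.norm_K_le hR c d).trans ((isContractive_majorant hR).a_le _)]

lemma Region.summable_M_mul_sol (hr : D.Region R η n) (hR : D.R₁ ≤ R) :
    Summable fun d => D.M η n 0 d / n * neumannSol (D.K η n) d := by
  refine Summable.of_norm_bounded
    ((hr.summable_norm_sol hR).mul_left (D.S + (D.ε ^ 2 + D.U))) fun d => ?_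
  rw [norm_mul]
  exact mul_le_mul_of_nonneg_right (hr.norm_M_div_le hR d) (norm_nonneg _)

lemma M_zero_zero : D.M η n 0 0 = D.q 0 := by
  simp [M, D.p_zero, D.p'_zero]

lemma N_zero : D.N η n 0 = η * n := by simp [N]

/-- A bounded nonzero null vector of the full system forces the reduced equation. -/
lemma Region.reduced_of_solution (hr : D.Region R η n) (hR : D.R₁ ≤ R) {f : G → ℂ}
    (hf0 : f ≠ 0) {C : ℝ} (hf : ∀ c, ‖f c‖ ≤ C)
    (hsol : ∀ c, HasSum (fun d => D.M η n c d * f d) (-(D.N η n c * f c))) :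
    η + D.g η n = 0 := by
  classical
  have hc := isContractive_majorant hR
  have hK := hr.norm_K_le hR
  have hn0 : n ≠ 0 := norm_pos_iff.1 (hr.n_pos hR)
  set x := neumannSol (D.K η n) with hx
  have hx0 : x 0 = 0 := neumannSol_zero hr hR
  have hKf : ∀ c, c ≠ 0 → HasSum (fun d => D.K η n c d * f d) (f c) := by
    intro c h0
    have hN : D.N η n c ≠ 0 := mul_ne_zero (hr.ne_zero h0).1 (hr.ne_zero h0).2
    have h1 := (hsol c).mul_left (-(D.N η n c)⁻¹)
    have e : -(D.N η n c)⁻¹ * -(D.N η n c * f c) = f c := by field_simp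
    rw [e] at h1
    refine h1.congr_fun fun d => ?_
    rw [K, if_neg h0]; ring
  -- The nonzero modes of `f` are determined by `f 0`: the difference `z` from the multiple `f 0` of
  -- the Neumann solution is a bounded fixed point of `K`, hence zero.
  set z : G → ℂ := fun c => f c - f 0 * ((if c = 0 then 1 else 0) + x c) with hz
  have hxb : ∀ c, ‖x c‖ ≤ 1 := by
    intro c
    have h1 := (hc.summable_norm_neumannSol hK).le_tsum c fun d _ =>
      mul_nonneg (D.w_nonneg d) (norm_nonneg _)
    have h2 := hc.tsum_norm_neumannSol_le hK
    have h3 := le_mul_of_one_le_left (norm_nonneg (x c)) (D.one_le_w c)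
    linarith
  have hzb : ∀ c, ‖z c‖ ≤ C + ‖f 0‖ * 2 := by
    intro c
    refine (norm_sub_le _ _).trans (add_le_add (hf c) ?_)
    rw [norm_mul]
    refine mul_le_mul_of_nonneg_left ((norm_add_le _ _).trans ?_) (norm_nonneg _)
    have : ‖(if c = 0 then 1 else 0 : ℂ)‖ ≤ 1 := by split_ifs <;> simp
    linarith [hxb c]
  have hzfix : ∀ c, z c = ∑' d, D.K η n c d * z d := by
    intro c
    by_cases h0 : c = 0
    · subst h0
      simp [hz, hx0, K]
    · have h1 : HasSum (fun d => D.K η n c d * (if d = 0 then 1 else 0 : ℂ)) (D.K η n c 0) := by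
        have := hasSum_single (f := fun d => D.K η n c d * (if d = 0 then 1 else 0 : ℂ)) 0
          fun d hd => by simp [hd]
        simpa using this
      have h2 := (hr.summable_K_mul_sol hR c).hasSum
      have h3 := (hKf c h0).sub ((h1.add h2).mul_left (f 0))
      have h4 := hc.neumannSol_eq hK c
      rw [← h4] at h3
      rw [show z c = f c - f 0 * neumannSol (D.K η n) c by simp [hz, h0, hx], ← h3.tsum_eq]
      congr 1; ext d; simp only [hz, hx]; ring
  have hz0 : ∀ c, z c = 0 := hc.eq_zero_of_bounded hK hzb hzfix
  have hfx : ∀ c, f c = f 0 * ((if c = 0 then 1 else 0) + x c) := fun c =>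
    sub_eq_zero.1 (hz0 c)
  have hf00 : f 0 ≠ 0 := by
    intro h0
    apply hf0
    ext c; rw [hfx c, h0, zero_mul]; rfl
  have h1 : HasSum (fun d => D.M η n 0 d / n * (if d = 0 then 1 else 0 : ℂ)) (D.q 0 / n) := by
    have := hasSum_single (f := fun d => D.M η n 0 d / n * (if d = 0 then 1 else 0 : ℂ)) 0
      fun d hd => by simp [hd]
    simpa [M_zero_zero] using this
  have h2 := h1.add (hr.summable_M_mul_sol hR).hasSum
  have h3 := (hsol 0).mul_left ((f 0)⁻¹ * n⁻¹)
  have h4 := h3.unique (h2.congr_fun fun d => by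
    rw [hfx d, ← hx]; field_simp)
  rw [N_zero] at h4
  rw [g, ← h4]
  field_simp
  ring

/-- A solution of the reduced equation yields a null vector of the full system. -/
lemma Region.exists_solution (hr : D.Region R η n) (hR : D.R₁ ≤ R) (hred : η + D.g η n = 0) :
    ∃ f : G → ℂ, f ≠ 0 ∧ (Summable fun c => D.w c * ‖f c‖) ∧
      ∀ c, HasSum (fun d => D.M η n c d * f d) (-(D.N η n c * f c)) := by
  classical
  have hc := isContractive_majorant hR
  have hK := hr.norm_K_le hR
  have hn0 : n ≠ 0 := norm_pos_iff.1 (hr.n_pos hR)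
  set x := neumannSol (D.K η n) with hx
  have hx0 : x 0 = 0 := neumannSol_zero hr hR
  have hδ : Summable fun c : G => D.w c * ‖(if c = 0 then 1 else 0 : ℂ)‖ :=
    summable_of_ne_finset_zero (s := {0}) fun c h0 => by
      rw [Finset.mem_singleton] at h0; simp [h0]
  refine ⟨fun c => (if c = 0 then 1 else 0) + x c, fun h0 => ?_, ?_, fun c => ?_⟩
  · have := congrFun h0 0
    simp [hx0] at this
  · refine Summable.of_nonneg_of_le (fun c => mul_nonneg (D.w_nonneg c) (norm_nonneg _))
      (fun c => ?_) (hδ.add (hc.summable_norm_neumannSol hK))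
    rw [← mul_add]
    exact mul_le_mul_of_nonneg_left (norm_add_le _ _) (D.w_nonneg c)
  · by_cases h0 : c = 0
    · subst h0
      have h1 : HasSum (fun d => D.M η n 0 d / n * (if d = 0 then 1 else 0 : ℂ))
          (D.q 0 / n) := by
        have := hasSum_single (f := fun d => D.M η n 0 d / n * (if d = 0 then 1 else 0 : ℂ)) 0
          fun d hd => by simp [hd]
        simpa [M_zero_zero] using this
      have h2 := (h1.add (hr.summable_M_mul_sol hR).hasSum).mul_left n
      rw [← g, show D.g η n = -η by linear_combination hred] at h2
      beta_reduce
      rw [if_pos rfl, hx0, N_zero, show -(η * n * (1 + 0)) = n * -η by ring]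
      refine h2.congr_fun fun d => ?_
      rw [← hx]; field_simp
    · have hN : D.N η n c ≠ 0 := mul_ne_zero (hr.ne_zero h0).1 (hr.ne_zero h0).2
      have h1 : HasSum (fun d => D.K η n c d * (if d = 0 then 1 else 0 : ℂ)) (D.K η n c 0) := by
        have := hasSum_single (f := fun d => D.K η n c d * (if d = 0 then 1 else 0 : ℂ)) 0
          fun d hd => by simp [hd]
        simpa using this
      have h2 := (h1.add (hr.summable_K_mul_sol hR c).hasSum).mul_left (-(D.N η n c))
      rw [← hc.neumannSol_eq hK c] at h2
      beta_reduce
      rw [if_neg h0, zero_add, ← neg_mul]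
      refine h2.congr_fun fun d => ?_
      rw [K, if_neg h0, ← hx]; field_simp; ring

end region

/-- The reduced function is holomorphic along holomorphic curves in the region. -/
lemma differentiableOn_g {R : ℝ} (hR : D.R₁ ≤ R) {O : Set ℂ} (hO : IsOpen O) {η n : ℂ → ℂ}
    (hη : DifferentiableOn ℂ η O) (hn : DifferentiableOn ℂ n O)
    (hr : ∀ ζ ∈ O, D.Region R (η ζ) (n ζ)) :
    DifferentiableOn ℂ (fun ζ => D.g (η ζ) (n ζ)) O := by
  have hc := isContractive_majorant hR
  have hn0 : ∀ ζ ∈ O, n ζ ≠ 0 := fun ζ hζ => norm_pos_iff.1 ((hr ζ hζ).n_pos hR)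
  have hM : ∀ c d, DifferentiableOn ℂ (fun ζ => D.M (η ζ) (n ζ) c d) O := fun c d =>
    (((hη.add_const _).mul_const _).add ((hn.add_const _).mul_const _)).add_const _
  have hK : ∀ c d, DifferentiableOn ℂ (fun ζ => D.K (η ζ) (n ζ) c d) O := by
    intro c d
    by_cases h0 : c = 0
    · simp only [K, h0, if_true]; exact differentiableOn_const _
    · simp only [K, h0, if_false]
      refine ((hM c d).div ((hη.add_const _).mul (hn.add_const _)) fun ζ hζ => ?_).neg
      exact mul_ne_zero ((hr ζ hζ).ne_zero h0).1 ((hr ζ hζ).ne_zero h0).2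
  refine ((differentiableOn_const _).div hn hn0).add ?_
  have hsum : Summable fun c => ∑' m, convPow (D.majorant R) m c :=
    Summable.of_nonneg_of_le hc.majorant_nonneg
      (fun c => hc.le_w_mul (hc.majorant_nonneg c) c) hc.summable_majorant
  refine Complex.differentiableOn_tsum_of_summable_norm
    (hsum.mul_left (D.S + (D.ε ^ 2 + D.U)))
    (fun d => ((hM 0 d).div hn hn0).mul
      (hc.differentiableOn_neumannSol hO (fun ζ hζ => (hr ζ hζ).norm_K_le hR) hK d)) hO
    fun d ζ hζ => ?_
  rw [norm_mul]
  exact mul_le_mul ((hr ζ hζ).norm_M_div_le hR d)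
    (hc.norm_neumannSol_le ((hr ζ hζ).norm_K_le hR) d) (norm_nonneg _)
    ((norm_nonneg _).trans ((hr ζ hζ).norm_M_div_le hR d))

end TubeData

namespace TubeData
variable {G : Type*} [AddCommGroup G] (D : TubeData G)

/-! ### Asymptotics of the reduced equation -/

/-- The coefficient of the `1 / ‖n‖` term in the refined bound for the couplings. -/
def v (b : G) : ℝ := (1 + 2 / D.ε) * (D.w b * D.h b) + 4 / D.ε * D.u b

lemma v_nonneg (b : G) : 0 ≤ D.v b := by
  have hε := D.ε_pos
  exact add_nonneg (mul_nonneg (by positivity) (mul_nonneg (D.w_nonneg b) (D.h_nonneg b)))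
    (mul_nonneg (by positivity) (D.u_nonneg b))

lemma summable_v : Summable D.v := (D.summable_w_h.mul_left _).add (D.summable_u.mul_left _)

/-- The `ℓ¹` norm of `v`. -/
def vSum : ℝ := ∑' b, D.v b

lemma vSum_nonneg : 0 ≤ D.vSum := tsum_nonneg D.v_nonneg

section region
variable {D} {R : ℝ} {η n : ℂ}

/-- The factor `n + τ' c` is small compared with `n` only for `c` comparable to `n`; this trades a
weight `w c ≤ w (c - d) w d` for the decay `1 / ‖n‖`. -/
lemma Region.norm_p_div_le (hr : D.Region R η n) (hR : D.R₁ ≤ R) {c : G} (hc : c ≠ 0) (d : G) :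
    ‖D.p (c - d) / (n + D.τ' c)‖
      ≤ (1 + 2 / D.ε) * (D.w (c - d) * D.h (c - d)) * D.w d / ‖n‖ := by
  have hn := hr.n_pos hR
  have hε := D.ε_pos
  have h1 := hr.away c hc
  have hy : 0 < ‖n + D.τ' c‖ := by linarith
  have h2 := norm_sub_le (n + D.τ' c) (D.τ' c)
  rw [add_sub_cancel_right, D.norm_τ'] at h2
  have h3 : D.w c ≤ D.w (c - d) * D.w d := by simpa using D.w_add_le (c - d) d
  have h4 : ‖n‖ ≤ (1 + 2 / D.ε) * D.w c * ‖n + D.τ' c‖ := by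
    have h5 : 1 ≤ 2 / D.ε * ‖n + D.τ' c‖ := by
      rw [div_mul_eq_mul_div, le_div_iff₀ hε]; linarith
    have h6 : ‖D.τ c‖ ≤ ‖D.τ c‖ * (2 / D.ε * ‖n + D.τ' c‖) :=
      le_mul_of_one_le_right (norm_nonneg _) h5
    have h7 : 0 ≤ ‖D.τ c‖ * ‖n + D.τ' c‖ := by positivity
    rw [w]
    nlinarith
  rw [norm_div, div_le_div_iff₀ hy hn]
  have h8 : (1 + 2 / D.ε) * D.w c * ‖n + D.τ' c‖
      ≤ (1 + 2 / D.ε) * (D.w (c - d) * D.w d) * ‖n + D.τ' c‖ := by gcongr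
  calc ‖D.p (c - d)‖ * ‖n‖
      ≤ D.h (c - d) * ((1 + 2 / D.ε) * (D.w (c - d) * D.w d) * ‖n + D.τ' c‖) :=
        mul_le_mul (D.p_le _) (h4.trans h8) (norm_nonneg _) (D.h_nonneg _)
    _ = _ := by ring

lemma Region.norm_remainder_div_le' (hr : D.Region R η n) (hR : D.R₁ ≤ R) {c : G} (hc : c ≠ 0)
    (d b : G) : ‖(D.τ b * D.p b + D.τ' b * D.p' b - D.q b) / D.N η n c‖
      ≤ 4 / D.ε * D.u b * D.w d / ‖n‖ := by
  have hε := D.ε_pos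
  refine (hr.norm_remainder_div_le hR hc b).trans (div_le_div_of_nonneg_right ?_ (norm_nonneg _))
  exact le_mul_of_one_le_right (mul_nonneg (by positivity) (D.u_nonneg b)) (D.one_le_w d)

/-- Up to terms of order `1 / ‖n‖`, only the factor of the free symbol that does not resonate
enters the couplings. -/
lemma Region.norm_K_le' (hr : D.Region R η n) (hR : D.R₁ ≤ R) (c d : G) :
    ‖D.K η n c d‖ ≤ D.h (c - d) / (11 / 6 * D.Λ) + D.v (c - d) * D.w d / ‖n‖ := by
  have hΛ := D.Λ_pos
  by_cases hc : c = 0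
  · rw [K, if_pos hc, norm_zero]
    exact add_nonneg (div_nonneg (D.h_nonneg _) (by positivity))
      (div_nonneg (mul_nonneg (D.v_nonneg _) (D.w_nonneg _)) (norm_nonneg _))
  have h1 := hr.norm_p_div_le hR hc d
  have h2 : ‖D.p' (c - d) / (η + D.τ c)‖ ≤ D.h (c - d) / (11 / 6 * D.Λ) := by
    rw [norm_div]
    exact div_le_div₀ (D.h_nonneg _) (D.p'_le _) (by positivity) (hr.le_norm_add_τ hc)
  have h3 := hr.norm_remainder_div_le' hR hc d (c - d)
  rw [hr.K_eq hc, v]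
  refine (norm_add_le _ _).trans ?_
  have h7 := norm_sub_le (-(D.p (c - d) / (n + D.τ' c))) (D.p' (c - d) / (η + D.τ c))
  rw [norm_neg] at h7
  rw [add_mul, add_div]
  linarith

/-- The first term of the Neumann series is `-p' c / τ c`, up to a term of higher order in `ε` and
a term of order `1 / ‖n‖`. -/
lemma Region.norm_K_zero_add_le (hr : D.Region R η n) (hR : D.R₁ ≤ R) (c : G) :
    ‖D.K η n c 0 + D.p' c / D.τ c‖
      ≤ D.h c * (D.ε / (11 / 6 * D.Λ * (2 * D.Λ))) + D.v c / ‖n‖ := by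
  have hΛ := D.Λ_pos
  have hε := D.ε_pos
  by_cases hc : c = 0
  · rw [K, if_pos hc, hc, D.p'_zero, zero_div, add_zero, norm_zero]
    exact add_nonneg (mul_nonneg (D.h_nonneg _) (by positivity))
      (div_nonneg (D.v_nonneg _) (norm_nonneg _))
  have h1 := hr.norm_p_div_le hR hc 0
  have h3 := hr.norm_remainder_div_le' hR hc 0 (c - 0)
  have hw : D.w 0 = 1 := by simp [w]
  rw [hw, mul_one] at h1 h3
  have hτ : D.τ c ≠ 0 := norm_pos_iff.1 (by linarith [D.gap c hc])
  have hητ := (hr.ne_zero hc).1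
  rw [hr.K_eq hc]
  simp only [sub_zero] at h1 h3 ⊢
  have h2 : ‖D.p' c / D.τ c - D.p' c / (η + D.τ c)‖
      ≤ D.h c * (D.ε / (11 / 6 * D.Λ * (2 * D.Λ))) := by
    have e : D.p' c / D.τ c - D.p' c / (η + D.τ c)
        = D.p' c * (η / ((η + D.τ c) * D.τ c)) := by
      field_simp; ring
    rw [e, norm_mul, norm_div, norm_mul]
    refine mul_le_mul (D.p'_le c) ?_ (by positivity) (D.h_nonneg c)
    refine div_le_div₀ hε.le hr.η_lt.le (by positivity) ?_
    exact mul_le_mul (hr.le_norm_add_τ hc) (D.gap c hc) (by positivity) (norm_nonneg _)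
  have e : -(D.p c / (n + D.τ' c)) - D.p' c / (η + D.τ c)
      + (D.τ c * D.p c + D.τ' c * D.p' c - D.q c) / D.N η n c + D.p' c / D.τ c
      = -(D.p c / (n + D.τ' c)) + (D.p' c / D.τ c - D.p' c / (η + D.τ c))
        + (D.τ c * D.p c + D.τ' c * D.p' c - D.q c) / D.N η n c := by ring
  rw [e]
  refine (norm_add_le _ _).trans ?_
  have h7 := norm_add_le (-(D.p c / (n + D.τ' c))) (D.p' c / D.τ c - D.p' c / (η + D.τ c))
  rw [norm_neg] at h7
  rw [v, add_div]
  linarith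

/-- A summable majorant of `K x` for the solution `x` of the nonzero modes. -/
def iterMajorant (D : TubeData G) (η n : ℂ) (c : G) : ℝ :=
  (11 / 6 * D.Λ)⁻¹ * (∑' d, D.h (c - d) * ‖neumannSol (D.K η n) d‖)
    + ‖n‖⁻¹ * ∑' d, D.v (c - d) * (D.w d * ‖neumannSol (D.K η n) d‖)

lemma Region.norm_tsum_K_le (hr : D.Region R η n) (hR : D.R₁ ≤ R) (c : G) :
    ‖∑' d, D.K η n c d * neumannSol (D.K η n) d‖ ≤ iterMajorant D η n c := by
  have h1 := summable_conv_apply D.h_nonneg (fun _ => norm_nonneg _) D.summable_h₀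
    (hr.summable_norm_sol hR) c
  have h2 := summable_conv_apply D.v_nonneg
    (fun d => mul_nonneg (D.w_nonneg d) (norm_nonneg (neumannSol (D.K η n) d))) D.summable_v
    ((isContractive_majorant hR).summable_norm_neumannSol (hr.norm_K_le hR)) c
  refine tsum_of_norm_bounded ((h1.hasSum.mul_left _).add (h2.hasSum.mul_left _)) fun d => ?_
  rw [norm_mul]
  refine (mul_le_mul_of_nonneg_right (hr.norm_K_le' hR c d) (norm_nonneg _)).trans (le_of_eq ?_)
  ring

lemma Region.summable_iterMajorant (hr : D.Region R η n) (hR : D.R₁ ≤ R) :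
    Summable (iterMajorant D η n) :=
  ((summable_conv D.h_nonneg (fun _ => norm_nonneg _) D.summable_h₀
    (hr.summable_norm_sol hR)).mul_left _).add ((summable_conv D.v_nonneg
    (fun d => mul_nonneg (D.w_nonneg d) (norm_nonneg (neumannSol (D.K η n) d))) D.summable_v
    ((isContractive_majorant hR).summable_norm_neumannSol (hr.norm_K_le hR))).mul_left _)

lemma Region.tsum_iterMajorant_le (hr : D.Region R η n) (hR : D.R₁ ≤ R) :
    ∑' c, iterMajorant D η n c
      ≤ D.S / (11 / 6 * D.Λ) * (∑' c, ‖neumannSol (D.K η n) c‖) + D.vSum / ‖n‖ := by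
  have h1 := summable_conv D.h_nonneg (fun d => norm_nonneg (neumannSol (D.K η n) d))
    D.summable_h₀ (hr.summable_norm_sol hR)
  have h2 := summable_conv D.v_nonneg
    (fun d => mul_nonneg (D.w_nonneg d) (norm_nonneg (neumannSol (D.K η n) d))) D.summable_v
    ((isContractive_majorant hR).summable_norm_neumannSol (hr.norm_K_le hR))
  have h3 := (isContractive_majorant hR).tsum_norm_neumannSol_le (hr.norm_K_le hR)
  unfold iterMajorant
  rw [(h1.mul_left _).tsum_add (h2.mul_left _), tsum_mul_left, tsum_mul_left,
    tsum_conv D.h_nonneg (fun _ => norm_nonneg _) D.summable_h₀ (hr.summable_norm_sol hR),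
    tsum_conv D.v_nonneg
    (fun d => mul_nonneg (D.w_nonneg d) (norm_nonneg (neumannSol (D.K η n) d))) D.summable_v
    ((isContractive_majorant hR).summable_norm_neumannSol (hr.norm_K_le hR))]
  have h4 := mul_le_mul_of_nonneg_left h3
    (mul_nonneg (inv_nonneg.2 (norm_nonneg n)) D.vSum_nonneg)
  rw [← S, ← vSum, div_eq_inv_mul D.S, div_eq_inv_mul D.vSum]
  linarith

lemma S_div_le : D.S / (11 / 6 * D.Λ) ≤ 27 / 1100 * (D.ε / D.Λ) := by
  have hΛ := D.Λ_pos
  rw [div_le_iff₀ (by positivity)]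
  have : 27 / 1100 * (D.ε / D.Λ) * (11 / 6 * D.Λ) = 9 * D.ε / 200 := by
    field_simp; ring
  rw [this]; exact D.S_le

lemma ε_div_Λ_le (D : TubeData G) : D.ε / D.Λ ≤ 1 / 6 := by
  rw [div_le_iff₀ D.Λ_pos]; linarith [D.ε_lt]

/-- In contrast to the bound by `1` from the contraction property, this bound is proportional to
the size of the magnetic potential, up to terms of order `1 / ‖n‖`. -/
lemma Region.tsum_norm_sol_le (hr : D.Region R η n) (hR : D.R₁ ≤ R) :
    ∑' c, ‖neumannSol (D.K η n) c‖
      ≤ 2 * (D.S / (11 / 6 * D.Λ)) + 2 * (D.vSum / ‖n‖) := by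
  have hΛ := D.Λ_pos
  have hc := isContractive_majorant hR
  have hK := hr.norm_K_le hR
  have hs := hr.summable_norm_sol hR
  have h1 : ∑' c, ‖neumannSol (D.K η n) c‖ ≤ 1 :=
    (hs.tsum_le_tsum (fun c => le_mul_of_one_le_left (norm_nonneg _) (D.one_le_w c))
      (hc.summable_norm_neumannSol hK)).trans (hc.tsum_norm_neumannSol_le hK)
  have h2 : ∀ c, ‖neumannSol (D.K η n) c‖
      ≤ (D.h c / (11 / 6 * D.Λ) + D.v c / ‖n‖) + iterMajorant D η n c := by
    intro c
    rw [hc.neumannSol_eq hK]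
    refine (norm_add_le _ _).trans (add_le_add ?_ (hr.norm_tsum_K_le hR c))
    have := hr.norm_K_le' hR c 0
    simpa [w] using this
  have h3 := (D.summable_h₀.div_const (11 / 6 * D.Λ)).add (D.summable_v.div_const ‖n‖)
  have h4 := hs.tsum_le_tsum h2 (h3.add (hr.summable_iterMajorant hR))
  rw [h3.tsum_add (hr.summable_iterMajorant hR), (D.summable_h₀.div_const _).tsum_add
    (D.summable_v.div_const _), tsum_div_const, tsum_div_const] at h4
  rw [← S, ← vSum] at h4
  have h5 := hr.tsum_iterMajorant_le hR
  have h6 : D.S / (11 / 6 * D.Λ) * (∑' c, ‖neumannSol (D.K η n) c‖) ≤ D.S / (11 / 6 * D.Λ) :=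
    mul_le_of_le_one_right (div_nonneg D.S_nonneg (by positivity)) h1
  linarith

end region

/-- The term of second order in the magnetic potential, with all modes retained. -/
def beta₀ : ℂ := -∑' d, D.p' (-d) * D.p' d / D.τ d

lemma norm_beta₀_term_le (d : G) :
    ‖D.p' (-d) * D.p' d / D.τ d‖ ≤ D.S / (2 * D.Λ) * D.h d := by
  have hΛ := D.Λ_pos
  by_cases hd : d = 0
  · rw [hd, D.p'_zero, mul_zero, zero_div, norm_zero]
    exact mul_nonneg (div_nonneg D.S_nonneg (by positivity)) (D.h_nonneg _)
  rw [norm_div, norm_mul]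
  calc _ ≤ D.S * D.h d / (2 * D.Λ) :=
        div_le_div₀ (mul_nonneg D.S_nonneg (D.h_nonneg d))
          (mul_le_mul ((D.p'_le _).trans (D.h_le_S _)) (D.p'_le d) (norm_nonneg _) D.S_nonneg)
          (by positivity) (D.gap d hd)
    _ = _ := by ring

lemma summable_beta₀ : Summable fun d => D.p' (-d) * D.p' d / D.τ d :=
  Summable.of_norm_bounded (D.summable_h₀.mul_left _) D.norm_beta₀_term_le

/-- The constant in the `1 / ‖n‖` error of `g - beta₀`. -/
def errConst : ℝ := ‖D.q 0‖ + (D.ε ^ 2 + D.U) + 3 * D.S * D.vSum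

lemma errConst_nonneg : 0 ≤ D.errConst := by
  have h1 := D.U_nonneg
  have h2 := D.S_nonneg
  have h3 := D.vSum_nonneg
  have h4 := norm_nonneg (D.q 0)
  rw [errConst]; positivity

/-- The reduced function is a constant of second order, up to an error of third order and an error of
order `1 / ‖n‖`. -/
lemma Region.norm_g_sub_beta₀_le {D : TubeData G} {R : ℝ} {η n : ℂ} (hr : D.Region R η n)
    (hR : D.R₁ ≤ R) :
    ‖D.g η n - D.beta₀‖ ≤ D.ε ^ 3 / (100 * D.Λ ^ 2) + D.errConst / ‖n‖ := by
  have hΛ := D.Λ_pos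
  have hε := D.ε_pos
  have hn := hr.n_pos hR
  have hc := isContractive_majorant hR
  have hK := hr.norm_K_le hR
  have hs := hr.summable_norm_sol hR
  set x := neumannSol (D.K η n) with hx
  set ℓ := 11 / 6 * D.Λ with hℓ
  have hs1 : ∑' c, ‖x c‖ ≤ 1 :=
    (hs.tsum_le_tsum (fun c => le_mul_of_one_le_left (norm_nonneg _) (D.one_le_w c))
      (hc.summable_norm_neumannSol hK)).trans (hc.tsum_norm_neumannSol_le hK)
  have b1 : ∀ d, ‖(D.M η n 0 d / n - D.p' (-d)) * x d‖ ≤ (D.ε ^ 2 + D.U) / ‖n‖ * ‖x d‖ := by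
    intro d
    rw [norm_mul]
    exact mul_le_mul_of_nonneg_right (hr.norm_M_div_sub_le hR d) (norm_nonneg _)
  have hy : ∀ d, ‖x d + D.p' d / D.τ d‖
      ≤ (D.h d * (D.ε / (ℓ * (2 * D.Λ))) + D.v d / ‖n‖) + iterMajorant D η n d := by
    intro d
    rw [hx, hc.neumannSol_eq hK, add_right_comm]
    exact (norm_add_le _ _).trans
      (add_le_add (hr.norm_K_zero_add_le hR d) (hr.norm_tsum_K_le hR d))
  have hYs := (D.summable_h₀.mul_right (D.ε / (ℓ * (2 * D.Λ)))).add
    (D.summable_v.div_const ‖n‖)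
  have hY := hYs.add (hr.summable_iterMajorant hR)
  have b2 : ∀ d, ‖D.p' (-d) * (x d + D.p' d / D.τ d)‖
      ≤ D.S * ((D.h d * (D.ε / (ℓ * (2 * D.Λ))) + D.v d / ‖n‖) + iterMajorant D η n d) := by
    intro d
    rw [norm_mul]
    exact mul_le_mul ((D.p'_le _).trans (D.h_le_S _)) (hy d) (norm_nonneg _) D.S_nonneg
  have s1 : Summable fun d => (D.M η n 0 d / n - D.p' (-d)) * x d :=
    Summable.of_norm_bounded (hs.mul_left _) b1
  have s2 : Summable fun d => D.p' (-d) * (x d + D.p' d / D.τ d) :=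
    Summable.of_norm_bounded (hY.mul_left _) b2
  -- Replace the row of the mode zero by `p' (-d)`, then the solution `x d` by `-p' d / τ d`.
  have e : D.g η n - D.beta₀ = D.q 0 / n + (∑' d, (D.M η n 0 d / n - D.p' (-d)) * x d)
      + ∑' d, D.p' (-d) * (x d + D.p' d / D.τ d) := by
    rw [g, beta₀, sub_neg_eq_add, add_assoc, add_assoc,
      ← (hr.summable_M_mul_sol hR).tsum_add D.summable_beta₀, ← s1.tsum_add s2]
    congr 2; ext d; rw [← hx]; ring
  have t1 := tsum_of_norm_bounded (hs.mul_left _).hasSum b1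
  have t2 := tsum_of_norm_bounded (hY.mul_left _).hasSum b2
  rw [tsum_mul_left] at t1 t2
  rw [hYs.tsum_add (hr.summable_iterMajorant hR), (D.summable_h₀.mul_right _).tsum_add
    (D.summable_v.div_const _), tsum_mul_right, tsum_div_const, ← S, ← vSum] at t2
  have t3 := hr.tsum_iterMajorant_le hR
  have t4 := hr.tsum_norm_sol_le hR
  rw [← hx, ← hℓ] at t3 t4
  have hSℓ : D.S / ℓ ≤ 27 / 1100 * (D.ε / D.Λ) := S_div_le
  have hr6 := ε_div_Λ_le D
  have hSℓ0 : 0 ≤ D.S / ℓ := div_nonneg D.S_nonneg (by positivity)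
  have hV0 : 0 ≤ D.vSum / ‖n‖ := div_nonneg D.vSum_nonneg hn.le
  have hU0 : 0 ≤ (D.ε ^ 2 + D.U) / ‖n‖ := div_nonneg (add_nonneg (sq_nonneg _) D.U_nonneg) hn.le
  have t5 : D.S / ℓ * ∑' c, ‖x c‖ ≤ 2 * (D.S / ℓ) ^ 2 + D.vSum / ‖n‖ := by
    have := mul_le_mul_of_nonneg_left t4 hSℓ0
    nlinarith
  have t6 : D.S * (D.S * (D.ε / (ℓ * (2 * D.Λ))) + D.vSum / ‖n‖ + ∑' d, iterMajorant D η n d)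
      ≤ D.S * (D.S * (D.ε / (ℓ * (2 * D.Λ))) + 2 * (D.S / ℓ) ^ 2) + 3 * D.S * (D.vSum / ‖n‖) := by
    have := mul_le_mul_of_nonneg_left
      (show D.S * (D.ε / (ℓ * (2 * D.Λ))) + D.vSum / ‖n‖ + ∑' d, iterMajorant D η n d
        ≤ D.S * (D.ε / (ℓ * (2 * D.Λ))) + 2 * (D.S / ℓ) ^ 2 + 3 * (D.vSum / ‖n‖) by linarith)
      D.S_nonneg
    linarith
  have t7 : D.S * (D.S * (D.ε / (ℓ * (2 * D.Λ))) + 2 * (D.S / ℓ) ^ 2)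
      ≤ D.ε ^ 3 / (100 * D.Λ ^ 2) := by
    have e1 : D.S * (D.ε / (ℓ * (2 * D.Λ))) = D.S / ℓ * (D.ε / D.Λ) / 2 := by field_simp
    have e2 : D.ε ^ 3 / (100 * D.Λ ^ 2) = D.ε * ((D.ε / D.Λ) ^ 2 / 100) := by field_simp
    rw [e1, e2]
    have hr0 : 0 ≤ D.ε / D.Λ := by positivity
    have h1 : D.S / ℓ * (D.ε / D.Λ) / 2 + 2 * (D.S / ℓ) ^ 2 ≤ (D.ε / D.Λ) ^ 2 / 50 := by
      nlinarith [mul_le_mul_of_nonneg_right hSℓ hr0, mul_le_mul hSℓ hSℓ hSℓ0 (by positivity)]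
    have h2 : D.S ≤ D.ε / 2 := by linarith [D.S_le]
    have := mul_le_mul h2 h1 (by positivity) (by positivity)
    linarith
  have t8 : ‖D.q 0 / n‖ = ‖D.q 0‖ / ‖n‖ := norm_div _ _
  have t9 : (D.ε ^ 2 + D.U) / ‖n‖ * ∑' c, ‖x c‖ ≤ (D.ε ^ 2 + D.U) / ‖n‖ :=
    mul_le_of_le_one_right hU0 hs1
  have t10 : D.errConst / ‖n‖
      = ‖D.q 0‖ / ‖n‖ + (D.ε ^ 2 + D.U) / ‖n‖ + 3 * D.S * (D.vSum / ‖n‖) := by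
    rw [errConst]; ring
  rw [e]
  refine (norm_add_le _ _).trans ?_
  have := norm_add_le (D.q 0 / n) (∑' d, (D.M η n 0 d / n - D.p' (-d)) * x d)
  linarith

open Classical in
/-- The constant `β₂^{(1,0)}` with the modes restricted to the finite set `F`. -/
def betaSum (F : Finset G) : ℂ :=
  -∑ b ∈ F, ∑ c ∈ F, D.p' (-b) / D.τ b * ((if b = c then 1 else 0) - D.p' (b - c) / D.τ c) * D.p' c

lemma betaSum_eq (F : Finset G) :
    D.betaSum F = -(∑ b ∈ F, D.p' (-b) * D.p' b / D.τ b)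
      + ∑ b ∈ F, ∑ c ∈ F, D.p' (-b) / D.τ b * (D.p' (b - c) / D.τ c) * D.p' c := by
  classical
  have h : ∀ b ∈ F, ∑ c ∈ F,
      D.p' (-b) / D.τ b * ((if b = c then 1 else 0) - D.p' (b - c) / D.τ c) * D.p' c
      = D.p' (-b) * D.p' b / D.τ b
        - ∑ c ∈ F, D.p' (-b) / D.τ b * (D.p' (b - c) / D.τ c) * D.p' c := by
    intro b hb
    simp only [mul_sub, sub_mul, Finset.sum_sub_distrib, mul_ite, ite_mul, mul_one, mul_zero,
      zero_mul, Finset.sum_ite_eq, if_pos hb]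
    ring
  rw [betaSum, Finset.sum_congr rfl h, Finset.sum_sub_distrib]
  ring

/-- The part of `betaSum` of third order in the magnetic potential belongs to the error term. -/
lemma norm_third_order_le {F : Finset G} (hF : (0 : G) ∉ F) :
    ‖∑ b ∈ F, ∑ c ∈ F, D.p' (-b) / D.τ b * (D.p' (b - c) / D.τ c) * D.p' c‖
      ≤ D.S ^ 3 / (2 * D.Λ) ^ 2 := by
  have hΛ := D.Λ_pos
  have hterm : ∀ b ∈ F, ∀ c ∈ F, ‖D.p' (-b) / D.τ b * (D.p' (b - c) / D.τ c) * D.p' c‖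
      ≤ D.h (-b) * (D.S / (2 * D.Λ) ^ 2 * D.h c) := by
    intro b hb c hc
    have hb0 : b ≠ 0 := fun h => hF (h ▸ hb)
    have hc0 : c ≠ 0 := fun h => hF (h ▸ hc)
    rw [norm_mul, norm_mul, norm_div, norm_div]
    have h1 : ‖D.p' (-b)‖ / ‖D.τ b‖ ≤ D.h (-b) / (2 * D.Λ) :=
      div_le_div₀ (D.h_nonneg _) (D.p'_le _) (by positivity) (D.gap b hb0)
    have h2 : ‖D.p' (b - c)‖ / ‖D.τ c‖ ≤ D.S / (2 * D.Λ) :=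
      div_le_div₀ D.S_nonneg ((D.p'_le _).trans (D.h_le_S _)) (by positivity) (D.gap c hc0)
    have h3 := mul_le_mul (mul_le_mul h1 h2 (by positivity)
      (div_nonneg (D.h_nonneg _) (by positivity))) (D.p'_le c) (norm_nonneg _)
      (mul_nonneg (div_nonneg (D.h_nonneg _) (by positivity))
        (div_nonneg D.S_nonneg (by positivity)))
    refine h3.trans (le_of_eq ?_)
    field_simp
  have hsF : ∑ c ∈ F, D.h c ≤ D.S := D.summable_h₀.sum_le_tsum F fun c _ => D.h_nonneg c
  have hsF' : ∑ b ∈ F, D.h (-b) ≤ D.S := by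
    have h1 : Summable fun b => D.h (-b) := (Equiv.neg G).summable_iff.2 D.summable_h₀
    refine (h1.sum_le_tsum F fun c _ => D.h_nonneg _).trans (le_of_eq ?_)
    exact (Equiv.neg G).tsum_eq D.h
  calc _ ≤ ∑ b ∈ F, ∑ c ∈ F, D.h (-b) * (D.S / (2 * D.Λ) ^ 2 * D.h c) :=
        norm_sum_le_of_le _ fun b hb => norm_sum_le_of_le _ fun c hc => hterm b hb c hc
    _ = (∑ b ∈ F, D.h (-b)) * (D.S / (2 * D.Λ) ^ 2 * ∑ c ∈ F, D.h c) := by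
        rw [Finset.sum_mul]
        simp only [Finset.mul_sum]
    _ ≤ D.S * (D.S / (2 * D.Λ) ^ 2 * D.S) := by
        have hS := D.S_nonneg
        refine mul_le_mul hsF' (mul_le_mul_of_nonneg_left hsF (by positivity)) ?_ hS
        exact mul_nonneg (by positivity) (Finset.sum_nonneg fun c _ => D.h_nonneg c)
    _ = _ := by ring

lemma S_cube_div_le : D.S ^ 3 / (2 * D.Λ) ^ 2 ≤ D.ε ^ 3 / (1000 * D.Λ ^ 2) := by
  have hΛ := D.Λ_pos
  have hε := D.ε_pos
  have h1 : D.S ^ 3 ≤ (9 * D.ε / 200) ^ 3 := pow_le_pow_left₀ D.S_nonneg D.S_le 3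
  rw [div_le_div_iff₀ (by positivity) (by positivity)]
  have h2 : 0 ≤ D.ε ^ 3 * D.Λ ^ 2 := by positivity
  nlinarith [mul_le_mul_of_nonneg_right h1 (sq_nonneg D.Λ)]

lemma norm_betaSum_lt {F : Finset G} (hF : (0 : G) ∉ F) :
    ‖D.betaSum F‖ < D.ε ^ 2 / (100 * D.Λ) := by
  have hΛ := D.Λ_pos
  have hε := D.ε_pos
  have h1 := D.norm_third_order_le hF
  have h2 : ‖∑ b ∈ F, D.p' (-b) * D.p' b / D.τ b‖ ≤ D.S ^ 2 / (2 * D.Λ) := by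
    refine (norm_sum_le_of_le _ fun b _ => D.norm_beta₀_term_le b).trans ?_
    rw [← Finset.mul_sum]
    have h3 : ∑ c ∈ F, D.h c ≤ D.S := D.summable_h₀.sum_le_tsum F fun c _ => D.h_nonneg c
    refine (mul_le_mul_of_nonneg_left h3 (div_nonneg D.S_nonneg (by positivity))).trans
      (le_of_eq (by ring))
  have h4 : D.S ^ 2 / (2 * D.Λ) ≤ D.ε ^ 2 / (400 * D.Λ) := by
    rw [div_le_div_iff₀ (by positivity) (by positivity)]
    have h1 : D.S ^ 2 ≤ (9 * D.ε / 200) ^ 2 := pow_le_pow_left₀ D.S_nonneg D.S_le 2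
    nlinarith [mul_le_mul_of_nonneg_right h1 hΛ.le, mul_pos (pow_pos hε 2) hΛ]
  have h5 : D.ε ^ 3 / (1000 * D.Λ ^ 2) = D.ε ^ 2 / (1000 * D.Λ) * (D.ε / D.Λ) := by field_simp
  have h6 : D.ε ^ 2 / (1000 * D.Λ) * (D.ε / D.Λ) ≤ D.ε ^ 2 / (1000 * D.Λ) * 1 :=
    mul_le_mul_of_nonneg_left (by linarith [ε_div_Λ_le D]) (by positivity)
  have h7 : D.ε ^ 2 / (400 * D.Λ) + D.ε ^ 2 / (1000 * D.Λ) < D.ε ^ 2 / (100 * D.Λ) := by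
    have e1 : D.ε ^ 2 / (400 * D.Λ) = D.ε ^ 2 / D.Λ / 400 := by field_simp
    have e2 : D.ε ^ 2 / (1000 * D.Λ) = D.ε ^ 2 / D.Λ / 1000 := by field_simp
    have e3 : D.ε ^ 2 / (100 * D.Λ) = D.ε ^ 2 / D.Λ / 100 := by field_simp
    have : 0 < D.ε ^ 2 / D.Λ := by positivity
    rw [e1, e2, e3]; linarith
  rw [D.betaSum_eq]
  have := norm_add_le (-(∑ b ∈ F, D.p' (-b) * D.p' b / D.τ b))
    (∑ b ∈ F, ∑ c ∈ F, D.p' (-b) / D.τ b * (D.p' (b - c) / D.τ c) * D.p' c)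
  rw [norm_neg] at this
  linarith [D.S_cube_div_le]

/-- The modes omitted by the cutoff contribute at most `ε / ρ`, since the magnetic potential has two
moments. -/
lemma norm_beta₀_sub_betaSum_le {F : Finset G} (hF : (0 : G) ∉ F) {ρ : ℝ} (hρ : 0 < ρ)
    (hout : ∀ b, b ∉ F → b ≠ 0 → ρ / 4 ≤ ‖D.τ b‖) :
    ‖D.beta₀ - D.betaSum F‖ ≤ D.ε ^ 3 / (1000 * D.Λ ^ 2) + D.ε / ρ := by
  classical
  have hΛ := D.Λ_pos
  have hε := D.ε_pos
  set t : G → ℂ := fun b => D.p' (-b) * D.p' b / D.τ b with ht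
  have h1 : HasSum (fun b => if b ∈ F then t b else 0) (∑ b ∈ F, t b) := by
    have : HasSum (fun b => if b ∈ F then t b else 0) (∑ b ∈ F, if b ∈ F then t b else 0) :=
      hasSum_sum_of_ne_finset_zero fun b hb => if_neg hb
    rwa [Finset.sum_congr rfl (g := t) fun b hb => if_pos hb] at this
  have h2 := D.summable_beta₀.hasSum.sub h1
  have h3 : ∀ b, ‖t b - if b ∈ F then t b else 0‖
      ≤ D.S / (2 * D.Λ) * (4 / ρ) * ((1 + ‖D.τ b‖ ^ 2) * D.h b) := by
    intro b
    have hnn : 0 ≤ D.S / (2 * D.Λ) * (4 / ρ) * ((1 + ‖D.τ b‖ ^ 2) * D.h b) :=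
      mul_nonneg (mul_nonneg (div_nonneg D.S_nonneg (by positivity)) (by positivity))
        (mul_nonneg (by positivity) (D.h_nonneg b))
    by_cases hb : b ∈ F
    · simpa [hb] using hnn
    by_cases hb0 : b = 0
    · have : t b = 0 := by simp [ht, hb0, D.p'_zero]
      simpa [hb, this] using hnn
    rw [if_neg hb, sub_zero]
    refine (D.norm_beta₀_term_le b).trans ?_
    have h4 := hout b hb hb0
    have h5 : 1 ≤ 4 / ρ * (1 + ‖D.τ b‖ ^ 2) := by
      rw [div_mul_eq_mul_div, le_div_iff₀ hρ]
      nlinarith [sq_nonneg (‖D.τ b‖ - 1 / 2)]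
    have h6 := mul_le_mul_of_nonneg_left (le_mul_of_one_le_left (D.h_nonneg b) h5)
      (div_nonneg D.S_nonneg (by positivity : 0 ≤ 2 * D.Λ))
    refine h6.trans (le_of_eq (by ring))
  have h4 := tsum_of_norm_bounded (D.summable_h.mul_left _).hasSum h3
  rw [h2.tsum_eq, tsum_mul_left] at h4
  have h5 : D.S / (2 * D.Λ) * (4 / ρ) * (∑' b, (1 + ‖D.τ b‖ ^ 2) * D.h b) ≤ D.ε / ρ := by
    have h6 : D.S / (2 * D.Λ) ≤ 1 / 4 := by
      rw [div_le_iff₀ (by positivity)]; linarith [D.S_le, D.ε_lt]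
    have h7 : D.S / (2 * D.Λ) * (4 / ρ) ≤ 1 / 4 * (4 / ρ) :=
      mul_le_mul_of_nonneg_right h6 (by positivity)
    have h8 : ∑' b, (1 + ‖D.τ b‖ ^ 2) * D.h b ≤ D.ε := by linarith [D.tsum_h]
    have h9 := mul_le_mul h7 h8 (tsum_nonneg fun b => mul_nonneg (by positivity) (D.h_nonneg b))
      (by positivity)
    refine h9.trans (le_of_eq (by ring))
  rw [D.betaSum_eq]
  have e : D.beta₀ - (-(∑ b ∈ F, t b)
      + ∑ b ∈ F, ∑ c ∈ F, D.p' (-b) / D.τ b * (D.p' (b - c) / D.τ c) * D.p' c)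
      = -(∑' b, t b - ∑ b ∈ F, t b)
        - ∑ b ∈ F, ∑ c ∈ F, D.p' (-b) / D.τ b * (D.p' (b - c) / D.τ c) * D.p' c := by
    rw [beta₀]; ring
  rw [e]
  refine (norm_sub_le _ _).trans ?_
  rw [norm_neg]
  linarith [D.norm_third_order_le hF, D.S_cube_div_le]

end TubeData

/-! ### Solution of the reduced equation -/

/-- A contraction that depends holomorphically on a parameter has a holomorphic fixed point. The
contraction property follows from Cauchy's estimate, as the maps are small on a larger disc. -/
lemma exists_holomorphic_fixedPoint {U : Set ℂ} (hU : IsOpen U) {r δ δ' : ℝ} (hδ' : 0 ≤ δ')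
    (h1 : δ' < δ) (hδr : δ < r) (h2 : 2 * δ' ≤ r - δ) (T : ℂ → ℂ → ℂ)
    (hT : ∀ z ∈ U, DifferentiableOn ℂ (T z) (Metric.ball 0 r))
    (hb : ∀ z ∈ U, ∀ η ∈ Metric.ball (0 : ℂ) r, ‖T z η‖ ≤ δ')
    (hj : ∀ f : ℂ → ℂ, DifferentiableOn ℂ f U → (∀ z ∈ U, f z ∈ Metric.ball 0 r) →
      DifferentiableOn ℂ (fun z => T z (f z)) U) :
    ∃ s : ℂ → ℂ, DifferentiableOn ℂ s U ∧ ∀ z ∈ U, ‖s z‖ < δ ∧ T z (s z) = s z ∧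
      ∀ η, ‖η‖ < δ → T z η = η → η = s z := by
  have hδ : 0 < δ := hδ'.trans_lt h1
  have hsub : Metric.ball (0 : ℂ) δ ⊆ Metric.ball 0 r := Metric.ball_subset_ball hδr.le
  -- Cauchy's estimate on discs of radius `r - δ`
  have hlip : ∀ z ∈ U, ∀ x ∈ Metric.ball (0 : ℂ) δ, ∀ y ∈ Metric.ball (0 : ℂ) δ,
      ‖T z y - T z x‖ ≤ 1 / 2 * ‖y - x‖ := by
    intro z hz x hx y hy
    refine (convex_ball (0 : ℂ) δ).norm_image_sub_le_of_norm_deriv_le (fun η hη => ?_)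
      (fun η hη => ?_) hx hy
    · exact (hT z hz).differentiableAt (Metric.isOpen_ball.mem_nhds (hsub hη))
    · have hin : Metric.closedBall η (r - δ) ⊆ Metric.ball 0 r := by
        intro ξ hξ
        rw [mem_ball_zero_iff] at hη ⊢
        rw [Metric.mem_closedBall, dist_eq_norm] at hξ
        have := norm_add_le (ξ - η) η
        rw [sub_add_cancel] at this
        linarith
      have hd : DiffContOnCl ℂ (T z) (Metric.ball η (r - δ)) :=
        ((hT z hz).mono hin).diffContOnCl_ball subset_rfl
      refine (Complex.norm_deriv_le_of_forall_mem_sphere_norm_le (by linarith) hd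
        fun ξ hξ => hb z hz ξ (hin (Metric.sphere_subset_closedBall hξ))).trans ?_
      rw [div_le_iff₀ (by linarith)]; linarith
  let f : ℕ → ℂ → ℂ := fun m => Nat.rec (fun _ => 0) (fun _ F z => T z (F z)) m
  have hf0 : ∀ z, f 0 z = 0 := fun _ => rfl
  have hfs : ∀ m z, f (m + 1) z = T z (f m z) := fun _ _ => rfl
  have hfmem : ∀ m, ∀ z ∈ U, ‖f m z‖ ≤ δ' := by
    intro m
    induction m with
    | zero => intro z _; rw [hf0, norm_zero]; exact hδ'
    | succ m ih =>
      intro z hz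
      rw [hfs]
      exact hb z hz _ (by rw [mem_ball_zero_iff]; linarith [ih z hz])
  have hfball : ∀ m, ∀ z ∈ U, f m z ∈ Metric.ball (0 : ℂ) δ := fun m z hz => by
    rw [mem_ball_zero_iff]; linarith [hfmem m z hz]
  have hfd : ∀ m, DifferentiableOn ℂ (f m) U := by
    intro m
    induction m with
    | zero => exact differentiableOn_const _
    | succ m ih => exact hj _ ih fun z hz => hsub (hfball m z hz)
  have hstep : ∀ m, ∀ z ∈ U, ‖f (m + 1) z - f m z‖ ≤ δ * (1 / 2) ^ m := by
    intro m
    induction m with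
    | zero => intro z hz; rw [hf0, sub_zero, pow_zero, mul_one]; exact (hfmem 1 z hz).trans h1.le
    | succ m ih =>
      intro z hz
      rw [hfs (m + 1), hfs m]
      refine (hlip z hz _ (hfball m z hz) _ (hfball (m + 1) z hz)).trans ?_
      rw [pow_succ]
      linarith [ih z hz]
  have hsum : Summable fun m : ℕ => δ * (1 / 2 : ℝ) ^ m :=
    (summable_geometric_of_lt_one (by norm_num) (by norm_num)).mul_left _
  set s : ℂ → ℂ := fun z => ∑' m, (f (m + 1) z - f m z) with hs
  have hlim : ∀ z ∈ U, Filter.Tendsto (fun m => f m z) Filter.atTop (nhds (s z)) := by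
    intro z hz
    have h3 : Summable fun m => f (m + 1) z - f m z :=
      Summable.of_norm_bounded hsum fun m => hstep m z hz
    have h4 := h3.hasSum.tendsto_sum_nat
    simpa only [Finset.sum_range_sub (fun m => f m z), hf0, sub_zero] using h4
  have hsle : ∀ z ∈ U, ‖s z‖ < δ := fun z hz =>
    (le_of_tendsto' (hlim z hz).norm fun m => hfmem m z hz).trans_lt h1
  refine ⟨s, Complex.differentiableOn_tsum_of_summable_norm hsum
    (fun m => (hfd (m + 1)).sub (hfd m)) hU fun m z hz => hstep m z hz, fun z hz => ?_⟩
  have hsb : s z ∈ Metric.ball (0 : ℂ) δ := by rw [mem_ball_zero_iff]; exact hsle z hz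
  have hfix : T z (s z) = s z := by
    have hcont : ContinuousAt (T z) (s z) :=
      ((hT z hz).differentiableAt (Metric.isOpen_ball.mem_nhds (hsub hsb))).continuousAt
    have h5 : Filter.Tendsto (fun m => T z (f m z)) Filter.atTop (nhds (T z (s z))) :=
      hcont.tendsto.comp (hlim z hz)
    have h6 := (hlim z hz).comp (Filter.tendsto_add_atTop_nat 1)
    exact tendsto_nhds_unique h5 h6
  refine ⟨hsle z hz, hfix, fun η hη hηfix => ?_⟩
  have h7 := hlip z hz (s z) hsb η (by rw [mem_ball_zero_iff]; exact hη)
  rw [hηfix, hfix] at h7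
  have h8 : ‖η - s z‖ = 0 := by linarith [norm_nonneg (η - s z)]
  exact sub_eq_zero.1 (norm_eq_zero.1 h8)

namespace TubeData
variable {G : Type*} [AddCommGroup G] (D : TubeData G)

/-- The radius of the disc in which the reduced equation is solved. -/
def δ : ℝ := D.ε ^ 2 / (40 * D.Λ)

lemma δ_pos : 0 < D.δ := by
  have := D.Λ_pos
  have := D.ε_pos
  rw [δ]; positivity

lemma δ_le : D.δ ≤ D.ε / 240 := by
  have hΛ := D.Λ_pos
  have hε := D.ε_pos
  rw [δ, div_le_div_iff₀ (by positivity) (by positivity)]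
  nlinarith [D.ε_lt]

lemma norm_beta₀_le : ‖D.beta₀‖ ≤ D.ε ^ 2 / (400 * D.Λ) := by
  have hΛ := D.Λ_pos
  have hε := D.ε_pos
  rw [beta₀, norm_neg]
  refine (tsum_of_norm_bounded (D.summable_h₀.mul_left _).hasSum D.norm_beta₀_term_le).trans ?_
  rw [tsum_mul_left, ← S, div_mul_eq_mul_div, div_le_div_iff₀ (by positivity) (by positivity)]
  have h1 : D.S * D.S ≤ (9 * D.ε / 200) * (9 * D.ε / 200) :=
    mul_le_mul D.S_le D.S_le D.S_nonneg (by positivity)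
  nlinarith [mul_le_mul_of_nonneg_right h1 hΛ.le, mul_pos (pow_pos hε 2) hΛ]

/-- Beyond this threshold for `n` the reduced function maps into the disc of radius `2 δ / 3`. -/
def R₂ : ℝ := D.R₁ + 100 * D.Λ * D.errConst / D.ε ^ 2

lemma R₁_le_R₂ : D.R₁ ≤ D.R₂ := by
  have h1 := D.Λ_pos
  have h2 := D.errConst_nonneg
  have : 0 ≤ 100 * D.Λ * D.errConst / D.ε ^ 2 := by positivity
  rw [R₂]; linarith

/-- In units of `δ`, the second order constant contributes `1 / 10`, the third order error `1 / 15`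
and the error of order `1 / ‖n‖` contributes `2 / 5`. -/
lemma Region.norm_g_le {D : TubeData G} {R : ℝ} {η n : ℂ} (hr : D.Region R η n)
    (hR : D.R₂ ≤ R) : ‖D.g η n‖ ≤ 2 / 3 * D.δ := by
  have hΛ := D.Λ_pos
  have hε := D.ε_pos
  have hR1 := D.R₁_le_R₂.trans hR
  have h1 := hr.norm_g_sub_beta₀_le hR1
  have h2 := D.norm_beta₀_le
  have hn := hr.n_pos hR1
  have h3 : D.errConst / ‖n‖ ≤ D.ε ^ 2 / (100 * D.Λ) := by
    rw [div_le_div_iff₀ hn (by positivity)]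
    have h4 : 100 * D.Λ * D.errConst / D.ε ^ 2 ≤ ‖n‖ := by
      have := hr.le_n
      have h5 := D.le_R₁
      rw [R₂] at hR; linarith
    rw [div_le_iff₀ (by positivity)] at h4
    linarith
  have h4 := norm_add_le (D.g η n - D.beta₀) D.beta₀
  rw [sub_add_cancel] at h4
  have h5 : D.ε ^ 3 / (100 * D.Λ ^ 2) ≤ D.ε ^ 2 / D.Λ / 600 := by
    have e : D.ε ^ 3 / (100 * D.Λ ^ 2) = D.ε ^ 2 / D.Λ / 100 * (D.ε / D.Λ) := by field_simp
    rw [e]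
    have := mul_le_mul_of_nonneg_left (ε_div_Λ_le D)
      (by positivity : 0 ≤ D.ε ^ 2 / D.Λ / 100)
    linarith
  have e1 : D.ε ^ 2 / (400 * D.Λ) = D.ε ^ 2 / D.Λ / 400 := by field_simp
  have e2 : D.ε ^ 2 / (100 * D.Λ) = D.ε ^ 2 / D.Λ / 100 := by field_simp
  have e3 : D.δ = D.ε ^ 2 / D.Λ / 40 := by rw [δ]; field_simp
  have : 0 < D.ε ^ 2 / D.Λ := by positivity
  rw [e1] at h2
  rw [e2] at h3
  rw [e3]; linarith

/-- The parameters `z = n - η` over which the reduced equation is solved: large and, uniformly,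
farther than `ε - δ` from the lines of the other tubes. -/
def goodSet (ρ : ℝ) : Set ℂ :=
  {z | ρ < ‖z‖ ∧ ∃ s, D.ε - D.δ < s ∧ ∀ c, c ≠ 0 → s ≤ ‖z + D.τ' c‖}

lemma isOpen_goodSet (ρ : ℝ) : IsOpen (D.goodSet ρ) := by
  rw [Metric.isOpen_iff]
  rintro z ⟨hz, s, hs, hzs⟩
  refine ⟨min (‖z‖ - ρ) ((s - (D.ε - D.δ)) / 2), lt_min (by linarith) (by linarith),
    fun y hy => ?_⟩
  rw [Metric.mem_ball, dist_eq_norm, lt_min_iff] at hy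
  refine ⟨?_, (s + (D.ε - D.δ)) / 2, by linarith, fun c hc => ?_⟩
  · have := norm_sub_norm_le z y
    rw [norm_sub_rev] at this
    linarith [hy.1]
  · have h1 := norm_sub_norm_le (z + D.τ' c) (y + D.τ' c)
    rw [add_sub_add_right_eq_sub, norm_sub_rev] at h1
    linarith [hy.2, hzs c hc]

lemma region_of_mem_goodSet {D : TubeData G} {ρ R : ℝ} (hρ : R + D.ε ≤ ρ) {z η : ℂ}
    (hz : z ∈ D.goodSet ρ) (hη : ‖η‖ < D.ε / 20) : D.Region R η (η + z) := by
  obtain ⟨hz1, s, hs, hzs⟩ := hz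
  have hε := D.ε_pos
  refine ⟨by linarith, ?_, fun c hc => ?_⟩
  · have := norm_sub_le (η + z) η
    rw [add_sub_cancel_left] at this
    linarith
  · have := norm_sub_le (η + (z + D.τ' c)) η
    rw [add_sub_cancel_left] at this
    rw [add_assoc]
    linarith [hzs c hc, D.δ_le]

/-- The reduced equation has exactly one solution in the disc of radius `δ`, and it depends
holomorphically on the parameter. -/
theorem exists_solution_reduced {ρ : ℝ} (hρ : D.R₂ + D.ε ≤ ρ) :
    ∃ s : ℂ → ℂ, DifferentiableOn ℂ s (D.goodSet ρ) ∧ ∀ z ∈ D.goodSet ρ,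
      ‖s z‖ < D.δ ∧ s z + D.g (s z) (s z + z) = 0 ∧
      ∀ η, ‖η‖ < D.δ → η + D.g η (η + z) = 0 → η = s z := by
  have hδ := D.δ_pos
  have hδε := D.δ_le
  have hε := D.ε_pos
  have hreg : ∀ {z η : ℂ}, z ∈ D.goodSet ρ → η ∈ Metric.ball (0 : ℂ) (D.ε / 20) →
      D.Region D.R₂ η (η + z) := fun hz hη =>
    region_of_mem_goodSet hρ hz (mem_ball_zero_iff.1 hη)
  obtain ⟨s, hs, hs'⟩ := exists_holomorphic_fixedPoint (D.isOpen_goodSet ρ) (r := D.ε / 20)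
    (δ := D.δ) (δ' := 2 / 3 * D.δ) (by positivity) (by linarith) (by linarith) (by linarith)
    (fun z η => -D.g η (η + z))
    (fun z hz => (D.differentiableOn_g D.R₁_le_R₂ Metric.isOpen_ball differentiableOn_id
      (differentiableOn_id.add_const z) fun η hη => hreg hz hη).neg)
    (fun z hz η hη => by rw [norm_neg]; exact (hreg hz hη).norm_g_le le_rfl)
    (fun f hf hfb => (D.differentiableOn_g D.R₁_le_R₂ (D.isOpen_goodSet ρ) hf
      (hf.add differentiableOn_id) fun z hz => hreg hz (hfb z hz)).neg)
  refine ⟨s, hs, fun z hz => ?_⟩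
  obtain ⟨h1, h2, h3⟩ := hs' z hz
  exact ⟨h1, by linear_combination -h2, fun η hη h => h3 η hη (by linear_combination -h)⟩

end TubeData

/-! ### The regular piece of the Fermi curve -/

section
variable {γ : Module.Basis (Fin 2) ℝ Plane}

lemma dualVec_mem_NZ {n : Fin 2 → ℤ} (hn : n ≠ 0) : dualVec γ n ∈ dualLatticeNZ γ :=
  ⟨dualVec_mem γ n, fun h => hn (dualVec_injective γ (by rw [h, map_zero]))⟩

lemma exists_dualVec_NZ {b : Plane} (hb : b ∈ dualLatticeNZ γ) :
    ∃ n : Fin 2 → ℤ, n ≠ 0 ∧ dualVec γ n = b := by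
  obtain ⟨n, rfl⟩ := exists_dualVec hb.1
  exact ⟨n, fun h => hb.2 (by rw [h, map_zero]), rfl⟩

/-- Nonzero integer vectors as coordinates of the nonzero vectors of the dual lattice. -/
def dualEquivNZ (γ : Module.Basis (Fin 2) ℝ Plane) :
    {n : Fin 2 → ℤ | n ≠ 0} ≃ dualLatticeNZ γ :=
  Equiv.ofBijective (fun n => ⟨dualVec γ n, dualVec_mem_NZ n.2⟩)
    ⟨fun _ _ h => Subtype.ext (dualVec_injective γ (congrArg Subtype.val h)), fun b => by
      obtain ⟨n, hn, h⟩ := exists_dualVec_NZ b.2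
      exact ⟨⟨n, hn⟩, Subtype.ext h⟩⟩

lemma summable_dualVec_iff {f : Plane → ℝ} (h0 : f 0 = 0) :
    (Summable fun n => f (dualVec γ n)) ↔ Summable fun b : dualLatticeNZ γ => f b := by
  have hsupp : Function.support (fun n => f (dualVec γ n)) ⊆ {n : Fin 2 → ℤ | n ≠ 0} := by
    intro n hn h
    refine hn ?_
    beta_reduce
    rw [h, map_zero, h0]
  rw [← (dualEquivNZ γ).summable_iff]
  exact exists_congr fun a => (hasSum_subtype_iff_of_support_subset hsupp).symm

lemma tsum_dualVec {f : Plane → ℝ} (h0 : f 0 = 0) :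
    ∑' n, f (dualVec γ n) = ∑' b : dualLatticeNZ γ, f b := by
  have hsupp : Function.support (fun n => f (dualVec γ n)) ⊆ {n : Fin 2 → ℤ | n ≠ 0} := by
    intro n hn h
    refine hn ?_
    beta_reduce
    rw [h, map_zero, h0]
  rw [← (dualEquivNZ γ).tsum_eq]
  exact (tsum_subtype_eq_of_support_subset hsupp).symm

lemma norm_coord_combination {σ : ℂ} (hσ : σ = 1 ∨ σ = -1) (b : Plane) :
    ‖(b 0 : ℂ) + Complex.I * σ * (b 1 : ℂ)‖ = ‖b‖ := by
  rw [EuclideanSpace.norm_eq, Complex.norm_eq_sqrt_sq_add_sq, Fin.sum_univ_two]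
  rcases hσ with rfl | rfl <;> simp

/-- The numerical constant rests on `2 √2 / 63 < 9 / 200`. -/
lemma sum_le_of_sqrt_lt {a b ε : ℝ} (hε : 0 < ε)
    (h : Real.sqrt (a ^ 2 + b ^ 2) < 2 * ε / 63) : a + b ≤ 9 * ε / 200 := by
  have h1 : a ^ 2 + b ^ 2 < (2 * ε / 63) ^ 2 := (Real.sqrt_lt' (by positivity)).1 h
  refine abs_le_of_sq_le_sq' ?_ (by positivity) |>.2
  nlinarith [sq_nonneg (a - b), sq_nonneg ε]

end

/-- The hypotheses on the lattice and on the potentials, with sums over the dual lattice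
expressed in integer coordinates. -/
structure Admissible (γ : Module.Basis (Fin 2) ℝ Plane) (Λ ε : ℝ) (A : Fin 2 → Plane → ℂ)
    (V : Plane → ℂ) : Prop where
  ε_pos : 0 < ε
  ε_lt : ε < Λ / 6
  gap : ∀ n : Fin 2 → ℤ, n ≠ 0 → 2 * Λ ≤ ‖dualVec γ n‖
  hA : ∀ j, PeriodicL2 γ (A j)
  hV : PeriodicL2 γ V
  hat_zero : ∀ j, hat γ (A j) 0 = 0
  summable_A : ∀ j, Summable fun n => (1 + ‖dualVec γ n‖ ^ 2) * ‖hat γ (A j) (dualVec γ n)‖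
  tsum_A : (∑' n, (1 + ‖dualVec γ n‖ ^ 2) * ‖hat γ (A 0) (dualVec γ n)‖)
    + ∑' n, (1 + ‖dualVec γ n‖ ^ 2) * ‖hat γ (A 1) (dualVec γ n)‖ ≤ 9 * ε / 200
  summable_q : Summable fun n => ‖dualVec γ n‖ ^ 2 * ‖qHat γ A V (dualVec γ n)‖

namespace Admissible
variable {γ : Module.Basis (Fin 2) ℝ Plane} {Λ ε : ℝ} {A : Fin 2 → Plane → ℂ} {V : Plane → ℂ}
  (h : Admissible γ Λ ε A V)
include h

lemma summable_hat (j : Fin 2) : Summable fun n => ‖hat γ (A j) (dualVec γ n)‖ :=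
  Summable.of_nonneg_of_le (fun _ => norm_nonneg _)
    (fun n => le_mul_of_one_le_left (norm_nonneg _) (by nlinarith [norm_nonneg (dualVec γ n)]))
    (h.summable_A j)

lemma summable_one_add_q :
    Summable fun n => (1 + ‖dualVec γ n‖) * ‖qHat γ A V (dualVec γ n)‖ := by
  classical
  have hΛ : 0 < Λ := by linarith [h.ε_pos, h.ε_lt]
  -- The gap of the dual lattice bounds `1` and `|b|` by multiples of `|b|²` for nonzero `b`.
  set c : ℝ := 1 / (2 * Λ) ^ 2 + 1 / (2 * Λ) with hc
  have h0 : Summable fun n : Fin 2 → ℤ => if n = 0 then ‖qHat γ A V 0‖ else 0 :=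
    summable_of_ne_finset_zero (s := {0}) fun n hn => by
      rw [Finset.mem_singleton] at hn; simp [hn]
  refine Summable.of_nonneg_of_le (fun n => by positivity) (fun n => ?_)
    ((h.summable_q.mul_left c).add h0)
  by_cases hn : n = 0
  · simp [hn]
  · rw [if_neg hn, add_zero, ← mul_assoc]
    refine mul_le_mul_of_nonneg_right ?_ (norm_nonneg _)
    have hg := h.gap n hn
    have h1 : 1 ≤ 1 / (2 * Λ) * ‖dualVec γ n‖ := by
      rw [one_div, inv_mul_eq_div, le_div_iff₀ (by positivity)]; linarith
    have h2 : 1 / (2 * Λ) ^ 2 = (1 / (2 * Λ)) ^ 2 := by rw [div_pow, one_pow]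
    rw [hc, h2]
    set x := ‖dualVec γ n‖
    have hx : 0 ≤ x := norm_nonneg _
    nlinarith [mul_le_mul_of_nonneg_right h1 hx, one_le_pow₀ h1 (n := 2)]

/-- The data of the operator near the tube of the zero mode whose index has sign `σ`. In the
coordinates `k₁ ± i σ k₂`, the scalar product `-2 (k + b) · Â` is the combination of the two factors of
the free symbol at `b` with coefficients `p` and `p'`. -/
def tubeData {σ : ℂ} (hσ : σ = 1 ∨ σ = -1) : TubeData (Fin 2 → ℤ) where
  Λ := Λ
  ε := ε
  τ :=
    { toFun := fun n => (dualVec γ n 0 : ℂ) + Complex.I * σ * (dualVec γ n 1 : ℂ)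
      map_zero' := by simp
      map_add' := fun m n => by simp only [map_add, PiLp.add_apply]; push_cast; ring }
  τ' :=
    { toFun := fun n => (dualVec γ n 0 : ℂ) - Complex.I * σ * (dualVec γ n 1 : ℂ)
      map_zero' := by simp
      map_add' := fun m n => by simp only [map_add, PiLp.add_apply]; push_cast; ring }
  p := fun n => -hat γ (A 0) (dualVec γ n) + Complex.I * σ * hat γ (A 1) (dualVec γ n)
  p' := fun n => -hat γ (A 0) (dualVec γ n) - Complex.I * σ * hat γ (A 1) (dualVec γ n)
  q := fun n => qHat γ A V (dualVec γ n)
  h := fun n => ‖hat γ (A 0) (dualVec γ n)‖ + ‖hat γ (A 1) (dualVec γ n)‖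
  ε_pos := h.ε_pos
  ε_lt := h.ε_lt
  norm_τ' := fun n => by
    have h1 := norm_coord_combination hσ (dualVec γ n)
    have h2 := norm_coord_combination (σ := -σ) (by rcases hσ with rfl | rfl <;> simp)
      (dualVec γ n)
    simp only [AddMonoidHom.coe_mk, ZeroHom.coe_mk]
    rw [h1, ← h2]
    congr 1; ring
  gap := fun n hn => by
    simp only [AddMonoidHom.coe_mk, ZeroHom.coe_mk]
    rw [norm_coord_combination hσ]; exact h.gap n hn
  p_zero := by simp [h.hat_zero]
  p'_zero := by simp [h.hat_zero]
  p_le := fun n => by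
    refine (norm_add_le _ _).trans (le_of_eq ?_)
    rcases hσ with rfl | rfl <;> simp
  p'_le := fun n => by
    refine (norm_sub_le _ _).trans (le_of_eq ?_)
    rcases hσ with rfl | rfl <;> simp
  summable_h := by
    simp only [AddMonoidHom.coe_mk, ZeroHom.coe_mk, norm_coord_combination hσ, mul_add]
    exact (h.summable_A 0).add (h.summable_A 1)
  tsum_h := by
    simp only [AddMonoidHom.coe_mk, ZeroHom.coe_mk, norm_coord_combination hσ, mul_add]
    rw [(h.summable_A 0).tsum_add (h.summable_A 1)]
    exact h.tsum_A
  summable_q := by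
    simp only [AddMonoidHom.coe_mk, ZeroHom.coe_mk, norm_coord_combination hσ]
    exact h.summable_one_add_q

section
variable {σ : ℂ} (hσ : σ = 1 ∨ σ = -1)

lemma norm_τ (n : Fin 2 → ℤ) : ‖(h.tubeData hσ).τ n‖ = ‖dualVec γ n‖ :=
  norm_coord_combination hσ _

lemma M_eq (k : Fin 2 → ℂ) (n m : Fin 2 → ℤ) :
    (h.tubeData hσ).M (k 0 + Complex.I * σ * k 1) (k 0 - Complex.I * σ * k 1) n m
      = fourierKernel γ A V k n m := by
  have h2 : σ ^ 2 = 1 := by rcases hσ with rfl | rfl <;> norm_num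
  simp only [TubeData.M, tubeData, AddMonoidHom.coe_mk, ZeroHom.coe_mk, fourierKernel,
    Fin.sum_univ_two]
  linear_combination 2 * (k 1 + (dualVec γ m 1 : ℂ)) * hat γ (A 1) (dualVec γ (n - m)) *
    (σ ^ 2 * Complex.I_sq - h2)

lemma N_eq (k : Fin 2 → ℂ) (n : Fin 2 → ℤ) :
    (h.tubeData hσ).N (k 0 + Complex.I * σ * k 1) (k 0 - Complex.I * σ * k 1) n
      = freeSymbol γ k n := by
  have h2 : σ ^ 2 = 1 := by rcases hσ with rfl | rfl <;> norm_num
  simp only [TubeData.N, tubeData, AddMonoidHom.coe_mk, ZeroHom.coe_mk, freeSymbol,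
    Fin.sum_univ_two]
  linear_combination (k 1 + (dualVec γ n 1 : ℂ)) ^ 2 * (h2 - σ ^ 2 * Complex.I_sq)

/-- Near the tube of the zero mode and away from the other tubes, the lifted Fermi curve is the
zero set of the reduced function. -/
lemma mem_liftedFermiCurve_iff {R : ℝ} (hR : (h.tubeData hσ).R₁ ≤ R) {k : Fin 2 → ℂ}
    (hr : (h.tubeData hσ).Region R (k 0 + Complex.I * σ * k 1) (k 0 - Complex.I * σ * k 1)) :
    k ∈ liftedFermiCurve γ A V ↔ (k 0 + Complex.I * σ * k 1)
      + (h.tubeData hσ).g (k 0 + Complex.I * σ * k 1) (k 0 - Complex.I * σ * k 1) = 0 := by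
  constructor
  · intro hk
    obtain ⟨f, hf0, ⟨C, hC⟩, hsol⟩ := exists_fourier_solution h.hA h.hV h.summable_hat hk
    refine hr.reduced_of_solution hR hf0 hC fun c => ?_
    simpa only [M_eq, N_eq] using hsol c
  · intro hred
    obtain ⟨f, hf0, hf, hsol⟩ := hr.exists_solution hR hred
    refine mem_liftedFermiCurve_of_fourier h.hA h.hV h.summable_hat hf0 ?_ fun n => ?_
    · simpa only [TubeData.w, h.norm_τ hσ] using hf
    · simpa only [M_eq, N_eq] using hsol n

end

/-- The constant `β₂^{(1,0)}` is the finite sum `betaSum` over the modes with `|b| < ρ / 4`, because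
`θ_{ν'}(b)` and `θ_{ν'}(Â(b))` are `(i / 2) τ b` and `-(i / 2) p' b`. -/
lemma betaConst_eq {ν : ℕ} (hν : ν = 1 ∨ ν = 2) (hσ : ((-1 : ℂ) ^ ν) = 1 ∨ ((-1 : ℂ) ^ ν) = -1)
    (ρ : ℝ) : ∃ F : Finset (Fin 2 → ℤ), (0 : Fin 2 → ℤ) ∉ F ∧
      (∀ n, n ∉ F → n ≠ 0 → ρ / 4 ≤ ‖dualVec γ n‖) ∧
      betaConst γ A ρ ν = (h.tubeData hσ).betaSum F := by
  classical
  have hfin : {n : Fin 2 → ℤ | n ≠ 0 ∧ ‖dualVec γ n‖ < ρ / 4}.Finite :=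
    (dualVec_finite γ (ρ / 4)).subset fun n hn => hn.2
  refine ⟨hfin.toFinset, by simp, fun n hn hn0 => ?_, ?_⟩
  · by_contra! hlt
    exact hn (by simp [hn0, hlt])
  have hcut : cutoffSet γ ρ = dualVec γ '' (hfin.toFinset : Set (Fin 2 → ℤ)) := by
    ext b
    constructor
    · rintro ⟨hb, hlt⟩
      obtain ⟨n, hn, rfl⟩ := exists_dualVec_NZ hb
      exact ⟨n, by simp [hn, hlt], rfl⟩
    · rintro ⟨n, hn, rfl⟩
      have : n ≠ 0 ∧ ‖dualVec γ n‖ < ρ / 4 := by simpa using hn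
      exact ⟨dualVec_mem_NZ this.1, this.2⟩
  have hν' : (-1 : ℂ) ^ (3 - ν) = -(-1) ^ ν := by rcases hν with rfl | rfl <;> norm_num
  have e1 : ∀ n, theta (3 - ν) (toC (dualVec γ n)) = Complex.I / 2 * (h.tubeData hσ).τ n := by
    intro n
    simp only [theta, toC, hν', tubeData, AddMonoidHom.coe_mk, ZeroHom.coe_mk]
    linear_combination -(1 / 2 * (-1) ^ ν * (dualVec γ n 1 : ℂ)) * Complex.I_sq
  have e2 : ∀ n, theta (3 - ν) (hatVec γ A (dualVec γ n))
      = -(Complex.I / 2) * (h.tubeData hσ).p' n := by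
    intro n
    simp only [theta, hatVec, hν', tubeData]
    linear_combination -(1 / 2 * (-1) ^ ν * hat γ (A 1) (dualVec γ n)) * Complex.I_sq
  have e3 : ∀ x y : ℂ, -(Complex.I / 2) * x / (Complex.I / 2 * y) = -(x / y) := by
    intro x y
    rw [neg_mul, neg_div, mul_div_mul_left _ _ (by simp)]
  rw [betaConst, hcut, finsum_mem_image (dualVec_injective γ).injOn, finsum_mem_coe_finset,
    TubeData.betaSum, Finset.mul_sum, ← Finset.sum_neg_distrib]
  refine Finset.sum_congr rfl fun n _ => ?_
  rw [finsum_mem_image (dualVec_injective γ).injOn, finsum_mem_coe_finset, Finset.mul_sum,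
    ← Finset.sum_neg_distrib]
  refine Finset.sum_congr rfl fun m _ => ?_
  simp only [(dualVec_injective γ).eq_iff, ← map_neg, ← map_sub, e1, e2, e3]
  have hif : (if n = m then (1 : ℂ) else 0) = @ite ℂ (n = m) (Classical.propDecidable _) 1 0 := by
    congr
  rw [hif]
  linear_combination (h.tubeData hσ).p' (-n) / (h.tubeData hσ).τ n
    * (@ite ℂ (n = m) (Classical.propDecidable _) 1 0 - (h.tubeData hσ).p' (n - m) / (h.tubeData hσ).τ m)
    * (h.tubeData hσ).p' m * Complex.I_sq

end Admissible

/-- The imaginary part of `k` in the coordinates `k₁ ± i k₂`. -/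
lemma sqrt_im_sq {σ : ℂ} (hσ : σ = 1 ∨ σ = -1) (k : Fin 2 → ℂ) :
    Real.sqrt ((k 0).im ^ 2 + (k 1).im ^ 2)
      = ‖(k 0 + Complex.I * σ * k 1) - (starRingEnd ℂ) (k 0 - Complex.I * σ * k 1)‖ / 2 := by
  rw [Complex.norm_eq_sqrt_sq_add_sq, eq_div_iff two_ne_zero, ← Real.sqrt_sq (zero_le_two (α := ℝ)),
    ← Real.sqrt_mul (by positivity)]
  congr 1
  rcases hσ with rfl | rfl <;> simp <;> ring

/-- The statement of the theorem for one of the two tubes, in terms of the sign of the tube. -/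
lemma Admissible.regularPiece_spec {γ : Module.Basis (Fin 2) ℝ Plane} {Λ ε : ℝ}
    {A : Fin 2 → Plane → ℂ} {V : Plane → ℂ} (h : Admissible γ Λ ε A V) {ν : ℕ}
    (hν : ν = 1 ∨ ν = 2) :
    ∃ ρ₀ C : ℝ, 0 < ρ₀ ∧ ∀ ρ : ℝ, ρ₀ ≤ ρ →
      {z : ℂ | ρ + ε < ‖z‖ ∧
          ∀ b ∈ dualLatticeNZ γ, ε < ‖z + (-1) ^ ν * theta ν (toC b)‖}
        ⊆ pr '' regularPiece γ A V ε ρ ν ∧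
      pr '' regularPiece γ A V ε ρ ν
        ⊆ {z : ℂ | ρ < 8 * ‖z‖ ∧ ∀ b ∈ dualLatticeNZ γ,
            (1 / 2) * (ε - ε ^ 2 / (40 * Λ)) < ‖z + (-1) ^ ν * theta ν (toC b)‖} ∧
      ‖betaConst γ A ρ ν‖ < ε ^ 2 / (100 * Λ) ∧
      ∃ r : ℂ → ℂ,
        IsBiholomorphicOntoImage (liftedFermiCurve γ A V) (regularPiece γ A V ε ρ ν) pr
          (fun y => ![-betaConst γ A ρ ν - Complex.I * (-1) ^ ν * y - r y, y]) ∧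
        ∀ y ∈ pr '' regularPiece γ A V ε ρ ν,
          ‖r y‖ ≤ ε ^ 3 / (50 * Λ ^ 2) + C / ρ := by
  have hσ : ((-1 : ℂ) ^ ν) = 1 ∨ ((-1 : ℂ) ^ ν) = -1 := by
    rcases hν with rfl | rfl <;> norm_num
  have hσ2 : ((-1 : ℂ) ^ ν) ^ 2 = 1 := by rcases hσ with h | h <;> rw [h] <;> norm_num
  have hσn : ‖((-1 : ℂ) ^ ν)‖ = 1 := by simp
  set D := h.tubeData hσ with hD
  have hε := h.ε_pos
  have hDε : D.ε = ε := rfl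
  have hDΛ : D.Λ = Λ := rfl
  have hΛ : 0 < Λ := D.Λ_pos
  have hδ := D.δ_pos
  have hδε : D.δ ≤ ε / 240 := D.δ_le
  have hlin : ∀ k, linN ν 0 k = k 0 + Complex.I * (-1) ^ ν * k 1 := by
    intro k; simp [linN]
  have hτ' : ∀ n, D.τ' n
      = (dualVec γ n 0 : ℂ) - Complex.I * (-1) ^ ν * (dualVec γ n 1 : ℂ) := fun n => rfl
  have hτ : ∀ n, D.τ n
      = (dualVec γ n 0 : ℂ) + Complex.I * (-1) ^ ν * (dualVec γ n 1 : ℂ) := fun n => rfl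
  set σ : ℂ := (-1) ^ ν with hσdef
  -- the two factors of the free symbol are bounded below off the tubes
  have htubes : ∀ k n, dualVec γ n ∈ dualLatticeNZ γ →
      (k ∉ tubes ε (dualVec γ n) ↔ ε ≤ ‖(k 0 + Complex.I * σ * k 1) + D.τ n‖ ∧
        ε ≤ ‖(k 0 - Complex.I * σ * k 1) + D.τ' n‖) := by
    intro k n _
    have e1 : linN ν (dualVec γ n) k = (k 0 + Complex.I * σ * k 1) + D.τ n := by
      rw [hτ, linN]; ring
    have e2 : linN (3 - ν) (dualVec γ n) k = (k 0 - Complex.I * σ * k 1) + D.τ' n := by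
      have : (-1 : ℂ) ^ (3 - ν) = -σ := by
        rw [hσdef]; rcases hν with rfl | rfl <;> norm_num
      rw [hτ', linN, this]; ring
    rw [← e1, ← e2]
    simp only [tubes, tube, Set.mem_union, Set.mem_ofPred_eq, not_or, not_lt]
    rcases hν with rfl | rfl
    · exact Iff.rfl
    · exact and_comm
  -- the difference `n - η` of the two coordinates is `-2 i σ k₂`, which serves as the parameter of the
  -- reduced equation
  have hz : ∀ (y : ℂ) n, -2 * Complex.I * σ * y + D.τ' n
      = -2 * Complex.I * σ * (y + σ * theta ν (toC (dualVec γ n))) := by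
    intro y n
    rw [hτ']
    simp only [theta, toC, ← hσdef]
    linear_combination (Complex.I * σ * (dualVec γ n 1 : ℂ)
      + Complex.I ^ 2 * (dualVec γ n 0 : ℂ)) * hσ2 + (dualVec γ n 0 : ℂ) * Complex.I_sq
  have hnorm : ∀ y : ℂ, ‖-2 * Complex.I * σ * y‖ = 2 * ‖y‖ := by
    intro y; simp [hσn]
  -- the summand `ε` of `C` pays for the cutoff in `β₂^{(1,0)}`
  refine ⟨D.R₂ + D.ε, D.errConst + ε, ?_, fun ρ hρ => ?_⟩
  · linarith [D.le_R₁, D.R₁_le_R₂]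
  have hρε : 1 + 4 * ε ≤ ρ := by linarith [D.le_R₁, D.R₁_le_R₂]
  have hR1ρ : D.R₁ ≤ ρ := by linarith [D.R₁_le_R₂]
  have hR2ρ : D.R₂ ≤ ρ := by linarith
  obtain ⟨F, hF0, hFout, hβ⟩ := h.betaConst_eq hν hσ ρ
  rw [← hD] at hβ
  obtain ⟨sol, hsold, hsol⟩ := D.exists_solution_reduced hρ
  -- the section of the projection, before the constant term is split off
  set lift : ℂ → Fin 2 → ℂ := fun y => ![sol (-2 * Complex.I * σ * y) - Complex.I * σ * y, y]
    with hlift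
  have hlift0 : ∀ y, lift y 0 = sol (-2 * Complex.I * σ * y) - Complex.I * σ * y := fun y => rfl
  have hlift1 : ∀ y, lift y 1 = y := fun y => rfl
  have hliftη : ∀ y, lift y 0 + Complex.I * σ * lift y 1 = sol (-2 * Complex.I * σ * y) := by
    intro y; rw [hlift0, hlift1]; ring
  have hliftn : ∀ y, lift y 0 - Complex.I * σ * lift y 1
      = sol (-2 * Complex.I * σ * y) + -2 * Complex.I * σ * y := by
    intro y; rw [hlift0, hlift1]; ring
  have hkn : ∀ k : Fin 2 → ℂ, k 0 - Complex.I * σ * k 1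
      = (k 0 + Complex.I * σ * k 1) + -2 * Complex.I * σ * k 1 := by
    intro k; ring
  have hregion : ∀ k : Fin 2 → ℂ, ‖k 0 + Complex.I * σ * k 1‖ < D.δ →
      -2 * Complex.I * σ * k 1 ∈ D.goodSet ρ →
      D.Region D.R₂ (k 0 + Complex.I * σ * k 1) (k 0 - Complex.I * σ * k 1) := by
    intro k hk hg
    rw [hkn]
    exact TubeData.region_of_mem_goodSet hρ hg (by rw [hDε]; linarith)
  have hlift_mem : ∀ y, -2 * Complex.I * σ * y ∈ D.goodSet ρ →
      lift y ∈ liftedFermiCurve γ A V := by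
    intro y hy
    obtain ⟨h1, h2, -⟩ := hsol _ hy
    rw [h.mem_liftedFermiCurve_iff hσ D.R₁_le_R₂ (hregion _ (by rw [hliftη]; exact h1)
      (by rw [hlift1]; exact hy)), hliftη, hliftn]
    exact h2
  have hunique : ∀ k ∈ liftedFermiCurve γ A V, ‖k 0 + Complex.I * σ * k 1‖ < D.δ →
      -2 * Complex.I * σ * k 1 ∈ D.goodSet ρ → lift (k 1) = k := by
    intro k hkX hk hg
    have h1 := (h.mem_liftedFermiCurve_iff hσ D.R₁_le_R₂ (hregion k hk hg)).1 hkX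
    rw [hkn] at h1
    have h2 := (hsol _ hg).2.2 _ hk h1
    ext j
    fin_cases j
    · change sol (-2 * Complex.I * σ * k 1) - Complex.I * σ * k 1 = k 0
      rw [← h2]; ring
    · rfl
  -- a priori bounds on the regular piece
  have hpiece : ∀ k ∈ regularPiece γ A V ε ρ ν, k ∈ liftedFermiCurve γ A V ∧
      D.Region ρ (k 0 + Complex.I * σ * k 1) (k 0 - Complex.I * σ * k 1) ∧
      ‖k 0 + Complex.I * σ * k 1‖ ≤ 2 / 3 * D.δ ∧
      2 * ρ - 2 * ε < ‖-2 * Complex.I * σ * k 1‖ ∧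
      (∀ n, n ≠ 0 → ε - 2 / 3 * D.δ ≤ ‖-2 * Complex.I * σ * k 1 + D.τ' n‖) := by
    rintro k ⟨⟨hkX, hk0⟩, hk⟩
    rw [Set.mem_union, not_or, Set.mem_iUnion₂] at hk
    obtain ⟨him, htu⟩ := hk
    simp only [not_exists] at htu
    have hη : ‖k 0 + Complex.I * σ * k 1‖ < ε := by rw [← hlin]; exact hk0
    have him' : ρ < Real.sqrt ((k 0).im ^ 2 + (k 1).im ^ 2) := not_le.1 him
    rw [sqrt_im_sq hσ] at him'
    have h1 := norm_sub_le (k 0 + Complex.I * σ * k 1)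
      ((starRingEnd ℂ) (k 0 - Complex.I * σ * k 1))
    rw [RCLike.norm_conj] at h1
    have haway : ∀ n, n ≠ 0 → ε ≤ ‖(k 0 - Complex.I * σ * k 1) + D.τ' n‖ := fun n hn =>
      ((htubes k n (dualVec_mem_NZ hn)).1 (htu _ (dualVec_mem_NZ hn))).2
    have hreg : D.Region ρ (k 0 + Complex.I * σ * k 1) (k 0 - Complex.I * σ * k 1) :=
      ⟨hη, by linarith, fun n hn => by rw [hDε]; linarith [haway n hn]⟩
    have hred := (h.mem_liftedFermiCurve_iff hσ hR1ρ hreg).1 hkX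
    have hη' : ‖k 0 + Complex.I * σ * k 1‖ ≤ 2 / 3 * D.δ := by
      rw [eq_neg_of_add_eq_zero_left hred, norm_neg]
      exact hreg.norm_g_le hR2ρ
    have ez : -2 * Complex.I * σ * k 1
        = (k 0 - Complex.I * σ * k 1) - (k 0 + Complex.I * σ * k 1) := by ring
    refine ⟨hkX, hreg, hη', ?_, fun n hn => ?_⟩
    · rw [ez]
      have := norm_sub_norm_le (k 0 - Complex.I * σ * k 1) (k 0 + Complex.I * σ * k 1)
      linarith
    · rw [ez, sub_add_eq_add_sub]
      have := norm_sub_norm_le ((k 0 - Complex.I * σ * k 1) + D.τ' n)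
        (k 0 + Complex.I * σ * k 1)
      linarith [haway n hn]
  have hpiece_good : ∀ k ∈ regularPiece γ A V ε ρ ν,
      ‖k 0 + Complex.I * σ * k 1‖ < D.δ ∧ -2 * Complex.I * σ * k 1 ∈ D.goodSet ρ := by
    intro k hk
    obtain ⟨-, -, h1, h2, h3⟩ := hpiece k hk
    exact ⟨by linarith, by linarith, ε - 2 / 3 * D.δ, by rw [hDε]; linarith, h3⟩
  refine ⟨?_, ?_, ?_, fun y => -betaConst γ A ρ ν - sol (-2 * Complex.I * σ * y), ?_, ?_⟩
  · -- the large part of the plane is covered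
    rintro y ⟨hy, hyb⟩
    have hyτ : ∀ n, n ≠ 0 → 2 * ε ≤ ‖-2 * Complex.I * σ * y + D.τ' n‖ := by
      intro n hn
      rw [hz, hnorm]
      linarith [hyb _ (dualVec_mem_NZ hn)]
    have hgood : -2 * Complex.I * σ * y ∈ D.goodSet ρ :=
      ⟨by rw [hnorm]; linarith, 2 * ε, by rw [hDε]; linarith, hyτ⟩
    have hs := (hsol _ hgood).1
    refine ⟨lift y, ⟨⟨hlift_mem y hgood, ?_⟩, ?_⟩, rfl⟩
    · rw [tube, Set.mem_ofPred_eq, hlin, hliftη]; linarith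
    · rw [Set.mem_union, not_or, Set.mem_iUnion₂]
      constructor
      · rw [imagBounded, Set.mem_ofPred_eq, not_le, sqrt_im_sq hσ, hliftη, hliftn]
        have h1 := norm_sub_norm_le ((starRingEnd ℂ)
          (sol (-2 * Complex.I * σ * y) + -2 * Complex.I * σ * y)) (sol (-2 * Complex.I * σ * y))
        rw [RCLike.norm_conj, norm_sub_rev] at h1
        have h2 := norm_sub_le (sol (-2 * Complex.I * σ * y) + -2 * Complex.I * σ * y)
          (sol (-2 * Complex.I * σ * y))
        rw [add_sub_cancel_left, hnorm] at h2
        linarith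
      · rintro ⟨b, hb, hbt⟩
        obtain ⟨n, hn, rfl⟩ := exists_dualVec_NZ hb
        refine (htubes _ n hb).2 ⟨?_, ?_⟩ hbt
        · rw [hliftη]
          have h1 := norm_sub_le (sol (-2 * Complex.I * σ * y) + D.τ n)
            (sol (-2 * Complex.I * σ * y))
          rw [add_sub_cancel_left] at h1
          have h2 := D.gap n hn
          rw [hDΛ] at h2
          linarith [h.ε_lt]
        · rw [hliftn, add_assoc]
          have h1 := norm_sub_le (sol (-2 * Complex.I * σ * y)
            + (-2 * Complex.I * σ * y + D.τ' n)) (sol (-2 * Complex.I * σ * y))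
          rw [add_sub_cancel_left] at h1
          linarith [hyτ n hn]
  · -- since `‖η‖ ≤ 2 δ / 3`, the parameter inherits its distance from the other tubes from `n`
    rintro _ ⟨k, hk, rfl⟩
    obtain ⟨-, -, h1, h2, h3⟩ := hpiece k hk
    refine ⟨?_, fun b hb => ?_⟩
    · rw [hnorm] at h2
      change ρ < 8 * ‖k 1‖
      linarith
    · obtain ⟨n, hn, rfl⟩ := exists_dualVec_NZ hb
      have h4 := h3 n hn
      rw [hz, hnorm] at h4
      change 1 / 2 * (ε - D.δ) < ‖k 1 + σ * theta ν (toC (dualVec γ n))‖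
      linarith
  · rw [hβ]; exact D.norm_betaSum_lt hF0
  · have hfun : (fun y => ![-betaConst γ A ρ ν - Complex.I * σ * y
        - (-betaConst γ A ρ ν - sol (-2 * Complex.I * σ * y)), y]) = lift := by
      ext y j
      fin_cases j
      · simp [hlift]
      · rfl
    rw [hfun]
    have hcont : Continuous fun y : ℂ => -2 * Complex.I * σ * y :=
      continuous_const.mul continuous_id
    have hU : IsOpen ((fun y : ℂ => -2 * Complex.I * σ * y) ⁻¹' D.goodSet ρ) :=
      (D.isOpen_goodSet ρ).preimage hcont
    refine ⟨fun k hk => (hpiece k hk).1,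
      {k | ‖k 0 + Complex.I * σ * k 1‖ < D.δ ∧ -2 * Complex.I * σ * k 1 ∈ D.goodSet ρ},
      (fun y : ℂ => -2 * Complex.I * σ * y) ⁻¹' D.goodSet ρ, ?_, hU, hpiece_good, ?_, ?_,
      fun k hk => hk.2.2, fun y hy => ⟨hlift_mem y hy, ?_, ?_⟩, fun k hk => ?_, fun y _ => rfl⟩
    · have h2 : IsOpen {k : Fin 2 → ℂ | -2 * Complex.I * σ * k 1 ∈ D.goodSet ρ} :=
        (D.isOpen_goodSet ρ).preimage
          (by fun_prop : Continuous fun k : Fin 2 → ℂ => -2 * Complex.I * σ * k 1)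
      have h1 : IsOpen {k : Fin 2 → ℂ | ‖k 0 + Complex.I * σ * k 1‖ < D.δ} :=
        isOpen_lt (by fun_prop) continuous_const
      exact h1.inter h2
    · unfold pr; fun_prop
    · rw [differentiableOn_pi]
      intro j
      have hmul : DifferentiableOn ℂ (fun y : ℂ => -2 * Complex.I * σ * y)
          ((fun y : ℂ => -2 * Complex.I * σ * y) ⁻¹' D.goodSet ρ) := by fun_prop
      fin_cases j
      · exact (hsold.comp hmul fun y hy => hy).sub (by fun_prop)
      · exact differentiableOn_id
    · rw [hliftη]; exact (hsol _ hy).1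
    · exact hy
    · exact hunique k hk.1 hk.2.1 hk.2.2
  · rintro _ ⟨k, hk, rfl⟩
    obtain ⟨hkX, hreg, h1, h2, h3⟩ := hpiece k hk
    obtain ⟨hkδ, hkg⟩ := hpiece_good k hk
    -- on the regular piece `r = (g - β₀) + (β₀ - β)`
    have hred := (h.mem_liftedFermiCurve_iff hσ hR1ρ hreg).1 hkX
    have hs : sol (-2 * Complex.I * σ * k 1) = k 0 + Complex.I * σ * k 1 := by
      rw [← hliftη, hunique k hkX hkδ hkg]
    have hg := hreg.norm_g_sub_beta₀_le hR1ρ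
    have hb := D.norm_beta₀_sub_betaSum_le hF0 (show 0 < ρ by linarith) fun n hn hn0 => by
      rw [hD, h.norm_τ hσ]; exact hFout n hn hn0
    have he : -betaConst γ A ρ ν - sol (-2 * Complex.I * σ * k 1)
        = (D.g (k 0 + Complex.I * σ * k 1) (k 0 - Complex.I * σ * k 1) - D.beta₀)
          + (D.beta₀ - D.betaSum F) := by
      rw [hs, hβ]; linear_combination -hred
    change ‖-betaConst γ A ρ ν - sol (-2 * Complex.I * σ * k 1)‖ ≤ _
    rw [he]
    refine (norm_add_le _ _).trans ?_
    have h4 : D.errConst / ‖k 0 - Complex.I * σ * k 1‖ ≤ D.errConst / ρ :=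
      div_le_div_of_nonneg_left D.errConst_nonneg (by linarith) hreg.le_n
    rw [hDε, hDΛ] at hg hb
    have e1 : ε ^ 3 / (100 * Λ ^ 2) = ε ^ 3 / Λ ^ 2 / 100 := by field_simp
    have e2 : ε ^ 3 / (1000 * Λ ^ 2) = ε ^ 3 / Λ ^ 2 / 1000 := by field_simp
    have e3 : ε ^ 3 / (50 * Λ ^ 2) = ε ^ 3 / Λ ^ 2 / 50 := by field_simp
    have e4 : 0 ≤ ε ^ 3 / Λ ^ 2 := by positivity
    rw [e1] at hg
    rw [e2] at hb
    rw [e3, add_div]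
    linarith

end FermiCurve

end

open FermiCurve

theorem theorem4p1
    (γ : Module.Basis (Fin 2) ℝ Plane) (Λ ε : ℝ)
    (hΛ : IsLeast {x : ℝ | ∃ b ∈ dualLatticeNZ γ, x = ‖b‖} (2 * Λ))
    (hε : 0 < ε) (hεΛ : ε < Λ / 6)
    (A : Fin 2 → Plane → ℂ) (V : Plane → ℂ)
    (hA : ∀ j, PeriodicL2 γ (A j)) (hV : PeriodicL2 γ V)
    (hA0 : ∀ j, hat γ (A j) 0 = 0)
    (hq : Summable fun b : dualLattice γ => ‖(b : Plane)‖ ^ 2 * ‖qHat γ A V b‖)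
    (hAsum : ∀ j, Summable fun b : dualLatticeNZ γ => (1 + ‖(b : Plane)‖ ^ 2) * ‖hat γ (A j) b‖)
    (hAsmall : Real.sqrt (∑ j : Fin 2,
        (∑' b : dualLatticeNZ γ, (1 + ‖(b : Plane)‖ ^ 2) * ‖hat γ (A j) b‖) ^ 2) < 2 * ε / 63) :
    ∃ ρ₀ C : ℝ, 0 < ρ₀ ∧ ∀ ρ : ℝ, ρ₀ ≤ ρ → ∀ ν : ℕ, ν = 1 ∨ ν = 2 →
      {z : ℂ | ρ + ε < ‖z‖ ∧
          ∀ b ∈ dualLatticeNZ γ, ε < ‖z + (-1) ^ ν * theta ν (toC b)‖}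
        ⊆ pr '' regularPiece γ A V ε ρ ν ∧
      pr '' regularPiece γ A V ε ρ ν
        ⊆ {z : ℂ | ρ < 8 * ‖z‖ ∧ ∀ b ∈ dualLatticeNZ γ,
            (1 / 2) * (ε - ε ^ 2 / (40 * Λ)) < ‖z + (-1) ^ ν * theta ν (toC b)‖} ∧
      ‖betaConst γ A ρ ν‖ < ε ^ 2 / (100 * Λ) ∧
      ∃ r : ℂ → ℂ,
        IsBiholomorphicOntoImage (liftedFermiCurve γ A V) (regularPiece γ A V ε ρ ν) pr
          (fun y => ![-betaConst γ A ρ ν - Complex.I * (-1) ^ ν * y - r y, y]) ∧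
        ∀ y ∈ pr '' regularPiece γ A V ε ρ ν,
          ‖r y‖ ≤ ε ^ 3 / (50 * Λ ^ 2) + C / ρ := by
  have h : Admissible γ Λ ε A V :=
    { ε_pos := hε
      ε_lt := hεΛ
      gap := fun n hn => hΛ.2 ⟨_, dualVec_mem_NZ hn, rfl⟩
      hA := hA
      hV := hV
      hat_zero := hA0
      summable_A := fun j =>
        (summable_dualVec_iff (f := fun b => (1 + ‖b‖ ^ 2) * ‖hat γ (A j) b‖)
          (by simp [hA0])).2 (hAsum j)
      tsum_A := by
        rw [tsum_dualVec (f := fun b => (1 + ‖b‖ ^ 2) * ‖hat γ (A 0) b‖) (by simp [hA0]),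
          tsum_dualVec (f := fun b => (1 + ‖b‖ ^ 2) * ‖hat γ (A 1) b‖) (by simp [hA0])]
        rw [Fin.sum_univ_two] at hAsmall
        exact sum_le_of_sqrt_lt hε hAsmall
      summable_q := (dualEquiv γ).summable_iff.2 hq }
  obtain ⟨ρ₁, C₁, hρ₁, h₁⟩ := h.regularPiece_spec (Or.inl rfl)
  obtain ⟨ρ₂, C₂, hρ₂, h₂⟩ := h.regularPiece_spec (Or.inr rfl)
  refine ⟨max ρ₁ ρ₂, max C₁ C₂, lt_max_of_lt_left hρ₁, fun ρ hρ ν hν => ?_⟩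
  have hρ0 : 0 < ρ := (lt_max_of_lt_left hρ₁).trans_le hρ
  rcases hν with rfl | rfl
  · obtain ⟨hsub, hsup, hβ, r, hr, hrle⟩ := h₁ ρ (le_of_max_le_left hρ)
    refine ⟨hsub, hsup, hβ, r, hr, fun y hy => (hrle y hy).trans ?_⟩
    gcongr
    exact le_max_left _ _
  · obtain ⟨hsub, hsup, hβ, r, hr, hrle⟩ := h₂ ρ (le_of_max_le_right hρ)
    refine ⟨hsub, hsup, hβ, r, hr, fun y hy => (hrle y hy).trans ?_⟩
    gcongr
    exact le_max_right _ _
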